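/- Conventions. A function $\nu:\mathbb N\to\mathbb R$ is negligible if $\lambda^c\,\nu(\lambda)\to 0$ as $\lambda\to\infty$ for every $c$. QPT means uniform quantum polynomial time; all algorithms and adversaries below also receive $1^\lambda$, and their running time is bounded by a polynomial in the size of their classical input. A collision-resistant family of hash functions consists of a QPT key sampler $s\leftarrow\mathsf{Gen}(1^\lambda)$ and a deterministic classical polynomial-time algorithm computing functions $H_s:\{0,1\}^*\to\{0,1\}^{\ell(\lambda)}$, such that every QPT adversary that is given $s\leftarrow\mathsf{Gen}(1^\lambda)$ outputs $x\ne y$ with $H_s(x)=H_s(y)$ only with negligible probability. A (stateful) digital signature scheme with revocable signing keys and message space $M$ is a tuple of QPT algorithms $\mathsf{Setup}(1^\lambda)\to(\mathsf{ck},\mathsf{pp})$; $\mathsf{KeyGen}(\mathsf{pp})\to(\mathsf{sigk}_0,\mathsf{vk})$; $\mathsf{Sign}(\mathsf{pp},\mathsf{sigk}_i,m)\to(\mathsf{sigk}_{i+1},\sigma)$; $\mathsf{Ver}(\mathsf{pp},\mathsf{vk},m,\sigma)\to\top/\bot$; $\mathsf{Del}(\mathsf{sigk}_i)\to\mathsf{cert}$;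 $\mathsf{Cert}(\mathsf{pp},\mathsf{vk},\mathsf{ck},\mathsf{cert},S)\to\top/\bot$, where $S$ is a finite set of messages, the signing keys $\mathsf{sigk}_i$ are quantum, and everything else is classical. In all experiments below $(\mathsf{ck},\mathsf{pp})\leftarrow\mathsf{Setup}(1^\lambda)$ and, where the key pair is honest, $(\mathsf{sigk}_0,\mathsf{vk})\leftarrow\mathsf{KeyGen}(\mathsf{pp})$. The scheme is one-time secure if all of the following hold. 1. One-time correctness: there is a negligible $\nu$ such that, for all $\lambda$ and all $m\in M$, if $(\mathsf{sigk}_1,\sigma)\leftarrow\mathsf{Sign}(\mathsf{pp},\mathsf{sigk}_0,m)$, then $\mathsf{Ver}(\mathsf{pp},\mathsf{vk},m,\sigma)=\top$ with probability at least $1-\nu(\lambda)$. 2. One-time EUF-CMA security: every QPT adversary that is given $\mathsf{vk}$ and makes at most one query $m$ to the signing oracle (answered with the $\sigma$ of $\mathsf{Sign}(\mathsf{pp},\mathsf{sigk}_0,m)$) outputs, only with negligible probability, a pair $(m^*,\sigma^*)$ such that $m^*\in M$ was not queried and $\mathsf{Ver}(\mathsf{pp},\mathsf{vk},m^*,\sigma^*)=\top$.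 3. One-time deletion correctness: there is a negligible $\nu$ such that, for all $\lambda$, with probability at least $1-\nu(\lambda)$ one has $\mathsf{Cert}(\mathsf{pp},\mathsf{vk},\mathsf{ck},\mathsf{Del}(\mathsf{sigk}_0),\emptyset)=\top$; and, for all $\lambda$ and all $m\in M$, if $(\mathsf{sigk}_1,\sigma)\leftarrow\mathsf{Sign}(\mathsf{pp},\mathsf{sigk}_0,m)$, then with probability at least $1-\nu(\lambda)$ one has $\mathsf{Cert}(\mathsf{pp},\mathsf{vk},\mathsf{ck},\mathsf{Del}(\mathsf{sigk}_1),\{m\})=\top$. 4. One-time deletion security: every QPT adversary that is given $\mathsf{pp}$ outputs, only with negligible probability, a tuple $(\mathsf{vk},\mathsf{cert},S,m^*,\sigma^*)$ such that $|S|\le 1$, $m^*\notin S$, $\mathsf{Cert}(\mathsf{pp},\mathsf{vk},\mathsf{ck},\mathsf{cert},S)=\top$ and $\mathsf{Ver}(\mathsf{pp},\mathsf{vk},m^*,\sigma^*)=\top$. Theorem. If a collision-resistant family of hash functions exists and a one-time secure digital signature scheme with revocable signing keys and message space $\{0,1\}$ exists, then a one-time secure digital signature scheme with revocable signing keys and message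 space $\{0,1\}^*$ exists. -/

import Mathlib

open scoped NNReal ENNReal

noncomputable section

namespace DSR

/-! ### Classical data -/

/-- Classical data: binary trees (S-expressions). Bits, bit strings, tuples and finite lists are
all encoded as such trees, so no separate pairing function on strings is needed. -/
inductive Data where
  | nil : Data
  | cons : Data → Data → Data
  deriving DecidableEq

namespace Data

/-- The size of a datum: its number of inner nodes. -/
def size : Data → ℕ
  | nil => 0
  | cons a b => 1 + a.size + b.size

def fst : Data → Data
  | nil => nil
  | cons a _ => a

def snd : Data → Data
  | nil => nil
  | cons _ b => b

def ofList : List Data → Data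
  | [] => nil
  | a :: l => cons a (ofList l)

/-- The `i`-th entry of a list-shaped datum (`nil` if there is none). -/
def nth : ℕ → Data → Data
  | 0, x => x.fst
  | i + 1, x => nth i x.snd

def ofBool : Bool → Data
  | false => nil
  | true => cons nil nil

/-- Encoding of bit strings. -/
def ofBits (l : List Bool) : Data := ofList (l.map ofBool)

/-- The unary string `1ⁿ`, of size `n`. -/
def unary (n : ℕ) : Data := ofList (List.replicate n nil)

end Data

/-! ### Quantum memory -/

/-- State vectors of a quantum memory whose qubits are addressed by data. A basis state is the finite
set of the addresses whose qubit is `1`, so all but finitely many qubits are `0`. A state is a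
nonzero vector up to nonzero scalars (vectors are not normalised after a measurement). -/
abbrev Tape := Finset Data →₀ ℂ

namespace Tape

/-- All qubits are `0`. -/
def blank : Tape := Finsupp.single ∅ 1

/-- The squared norm. -/
def weight (ψ : Tape) : ℝ≥0 := ψ.sum fun _ c => ‖c‖₊ ^ 2

/-- The Hadamard gate on qubit `a`. -/
def had (a : Data) (ψ : Tape) : Tape :=
  ψ.sum fun s c =>
    Finsupp.single (s.erase a) (c / (Real.sqrt 2 : ℂ)) +
      Finsupp.single (insert a s) ((if a ∈ s then -c else c) / (Real.sqrt 2 : ℂ))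

/-- The gate `T = diag(1, exp(iπ/4))` on qubit `a`. -/
def tgate (a : Data) (ψ : Tape) : Tape :=
  ψ.sum fun s c =>
    Finsupp.single s (if a ∈ s then Complex.exp (Real.pi / 4 * Complex.I) * c else c)

/-- The controlled-NOT gate with control `a` and target `b` (no operation if `a = b`). -/
def cnot (a b : Data) (ψ : Tape) : Tape :=
  if a = b then ψ else ψ.mapDomain fun s => if a ∈ s then symmDiff s {b} else s

/-- The projection onto the basis states whose qubit `a` has the value `b`. -/
def proj (a : Data) (b : Bool) (ψ : Tape) : Tape := ψ.filter fun s => decide (a ∈ s) = b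

theorem weight_proj_le (a : Data) (b : Bool) (ψ : Tape) : (proj a b ψ).weight ≤ ψ.weight := by
  unfold weight proj
  rw [Finsupp.sum_filter_index, Finsupp.support_filter]
  exact Finset.sum_le_sum_of_subset (Finset.filter_subset _ _)

theorem weight_proj_div_le_one (a : Data) (ψ : Tape) :
    (proj a true ψ).weight / ψ.weight ≤ 1 :=
  div_le_one_of_le₀ (weight_proj_le a true ψ) zero_le

/-- The outcome of a measurement of qubit `a` in the computational basis, by the Born rule: it is
`1` with probability `‖proj a true ψ‖² / ‖ψ‖²`. -/
def outcome (a : Data) (ψ : Tape) : PMF Bool :=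
  PMF.ofFintype
    (fun b =>
      if b then (((proj a true ψ).weight / ψ.weight : ℝ≥0) : ℝ≥0∞)
      else 1 - (((proj a true ψ).weight / ψ.weight : ℝ≥0) : ℝ≥0∞))
    (by
      rw [Fintype.sum_bool]
      simpa using add_tsub_cancel_of_le
        (ENNReal.coe_le_one_iff.mpr (weight_proj_div_le_one a ψ)))

end Tape

/-! ### Programs, running time, QPT algorithms -/

/-- Programs of a classically controlled quantum computer. A program maps a classical input to a
classical output and acts on the quantum memory. Loops are bounded (`rep`); since only programs with
bounded running time are of interest, general loops would compute nothing more. -/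
inductive Prog where
  | id : Prog
  | nil : Prog
  | fst : Prog
  | snd : Prog
  /-- run `f`, then run `g` on its output -/
  | seq (f g : Prog) : Prog
  /-- run `f` and then `g` on the same input, and return the pair of the outputs -/
  | pair (f g : Prog) : Prog
  /-- run `c`; if its output is not `nil`, run `f` on the same input, otherwise `g` -/
  | ite (c f g : Prog) : Prog
  /-- on input `cons c x`, apply `f` to `x` repeatedly, `c.size` times -/
  | rep (f : Prog) : Prog
  /-- on input `a`, apply the Hadamard gate to qubit `a` -/
  | had : Prog
  /-- on input `a`, apply the `T` gate to qubit `a` -/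
  | tgate : Prog
  /-- on input `cons a b`, apply the controlled-NOT gate with control `a` and target `b` -/
  | cnot : Prog
  /-- on input `a`, measure qubit `a` in the computational basis and return the outcome -/
  | meas : Prog

/-- The result of a run: the classical output, the final quantum memory and the running time. -/
structure Result where
  out : Data
  tape : Tape
  time : ℕ

/-- `k` consecutive runs, the running times being added up. -/
def iterRun (f : Data → Tape → PMF Result) : ℕ → Data → Tape → PMF Result
  | 0, x, ψ => pure ⟨x, ψ, 0⟩
  | k + 1, x, ψ => do
      let r ← f x ψ
      let s ← iterRun f k r.out r.tape
      pure ⟨s.out, s.tape, r.time + s.time⟩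

/-- The distribution of the result of a program on the classical input `x` and the quantum memory
`ψ`. Every instruction costs one more than the size of its input, in addition to the cost of the
instructions that it runs. -/
def Prog.run : Prog → Data → Tape → PMF Result
  | .id, x, ψ => pure ⟨x, ψ, 1 + x.size⟩
  | .nil, x, ψ => pure ⟨Data.nil, ψ, 1 + x.size⟩
  | .fst, x, ψ => pure ⟨x.fst, ψ, 1 + x.size⟩
  | .snd, x, ψ => pure ⟨x.snd, ψ, 1 + x.size⟩
  | .seq f g, x, ψ => do
      let r ← f.run x ψ
      let s ← g.run r.out r.tape
      pure ⟨s.out, s.tape, 1 + x.size + r.time + s.time⟩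
  | .pair f g, x, ψ => do
      let r ← f.run x ψ
      let s ← g.run x r.tape
      pure ⟨Data.cons r.out s.out, s.tape, 1 + x.size + r.time + s.time⟩
  | .ite c f g, x, ψ => do
      let r ← c.run x ψ
      let s ← if r.out = Data.nil then g.run x r.tape else f.run x r.tape
      pure ⟨s.out, s.tape, 1 + x.size + r.time + s.time⟩
  | .rep f, x, ψ => do
      let r ← iterRun f.run x.fst.size x.snd ψ
      pure ⟨r.out, r.tape, 1 + x.size + r.time⟩
  | .had, x, ψ => pure ⟨Data.nil, ψ.had x, 1 + x.size⟩
  | .tgate, x, ψ => pure ⟨Data.nil, ψ.tgate x, 1 + x.size⟩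
  | .cnot, x, ψ => pure ⟨Data.nil, ψ.cnot x.fst x.snd, 1 + x.size⟩
  | .meas, x, ψ => do
      let b ← ψ.outcome x
      pure ⟨Data.ofBool b, ψ.proj x b, 1 + x.size⟩

/-- The running time is, with certainty and whatever the quantum memory contains, at most a
polynomial in the size of the classical input. -/
def Prog.PolyTime (P : Prog) : Prop :=
  ∃ p : Polynomial ℕ, ∀ (x : Data) (ψ : Tape), ψ ≠ 0 →
    ∀ r ∈ (P.run x ψ).support, r.time ≤ p.eval x.size

/-- The program does not use the quantum memory; in particular it is deterministic. -/
def Prog.Classical : Prog → Prop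
  | .id | .nil | .fst | .snd => True
  | .seq f g | .pair f g => f.Classical ∧ g.Classical
  | .ite c f g => c.Classical ∧ f.Classical ∧ g.Classical
  | .rep f => f.Classical
  | .had | .tgate | .cnot | .meas => False

/-- A (uniform) quantum polynomial-time algorithm. -/
structure QPT where
  prog : Prog
  polyTime : prog.PolyTime

/-- Run an algorithm on a classical input and a quantum memory. -/
def QPT.run (A : QPT) (x : Data) (ψ : Tape) : PMF (Data × Tape) :=
  (A.prog.run x ψ).map fun r => (r.out, r.tape)

/-- The classical output of an algorithm that starts with a blank quantum memory. -/
def QPT.output (A : QPT) (x : Data) : PMF Data :=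
  (A.prog.run x Tape.blank).map Result.out

/-! ### Probabilities -/

/-- The probability that an experiment succeeds. -/
def prob (e : PMF Prop) : ℝ := (e True).toReal

/-- Negligible functions: `λ ^ c * ν λ → 0` for every `c`. -/
def Negligible (ν : ℕ → ℝ) : Prop :=
  Asymptotics.SuperpolynomialDecay Filter.atTop (fun n : ℕ => (n : ℝ)) ν

/-! ### Collision-resistant hash functions -/

/-- A keyed family of hash functions `{0,1}^* → {0,1}^{ℓ(λ)}`. Keys are sampled by a QPT algorithm;
hash values are computed by a deterministic classical polynomial-time algorithm, which is given
`1^λ`, the key and the string. -/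
structure HashFamily where
  gen : QPT
  eval : Prog
  classical : eval.Classical
  polyTime : eval.PolyTime
  len : ℕ → ℕ
  /-- `hash n s x` is the value at `x` of the function with key `s`, for the parameter `n`. -/
  hash : ℕ → Data → List Bool → List Bool
  eval_eq : ∀ n, ∀ s ∈ (gen.output (Data.unary n)).support, ∀ x,
    (eval.run (Data.ofList [Data.unary n, s, Data.ofBits x]) Tape.blank).map Result.out =
      pure (Data.ofBits (hash n s x))
  length_eq : ∀ n, ∀ s ∈ (gen.output (Data.unary n)).support, ∀ x, (hash n s x).length = len n

def HashFamily.collisionExp (F : HashFamily) (A : QPT) (n : ℕ) : PMF Prop := do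
  let s ← F.gen.output (Data.unary n)
  let out ← A.output (Data.ofList [Data.unary n, s])
  pure (∃ x y : List Bool, out.nth 0 = Data.ofBits x ∧ out.nth 1 = Data.ofBits y ∧
    x ≠ y ∧ F.hash n s x = F.hash n s y)

def HashFamily.CollisionResistant (F : HashFamily) : Prop :=
  ∀ A : QPT, Negligible fun n => prob (F.collisionExp A n)

/-! ### Digital signatures with revocable signing keys -/

/-- A message space: a type with an encoding of its elements as data. -/
class MessageSpace (M : Type) where
  enc : M → Data
  enc_injective : Function.Injective enc

theorem Data.ofBool_injective : Function.Injective Data.ofBool := by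
  intro a b h
  cases a <;> cases b <;> simp_all [Data.ofBool]

theorem Data.ofList_injective : Function.Injective Data.ofList := by
  intro a
  induction a with
  | nil => intro b h; cases b <;> simp_all [Data.ofList]
  | cons x a ih =>
    intro b h
    cases b with
    | nil => simp [Data.ofList] at h
    | cons y b =>
      simp only [Data.ofList, Data.cons.injEq] at h
      rw [h.1, ih h.2]

theorem Data.ofBits_injective : Function.Injective Data.ofBits :=
  Data.ofList_injective.comp (List.map_injective_iff.mpr Data.ofBool_injective)

/-- The message space `{0,1}`. -/
instance : MessageSpace Bool := ⟨Data.ofBool, Data.ofBool_injective⟩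

/-- The message space `{0,1}^*`. -/
instance : MessageSpace (List Bool) := ⟨Data.ofBits, Data.ofBits_injective⟩

/-- Finite sets of messages are handed over as lists of their elements. -/
def encSet {M : Type} [MessageSpace M] (S : List M) : Data :=
  Data.ofList (S.map MessageSpace.enc)

theorem encSet_injective {M : Type} [MessageSpace M] :
    Function.Injective (encSet : List M → Data) :=
  Data.ofList_injective.comp (List.map_injective_iff.mpr MessageSpace.enc_injective)

/-- The message encoded by a datum, if there is one. -/
def decMsg (M : Type) [MessageSpace M] (d : Data) : Option M :=
  Function.partialInv MessageSpace.enc d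

/-- The set of messages encoded by a datum, if there is one. -/
def decSet (M : Type) [MessageSpace M] (d : Data) : Option (List M) :=
  Function.partialInv encSet d

/-- A (stateful) digital signature scheme with revocable signing keys for the message space `M`:
six QPT algorithms. -/
structure Scheme (M : Type) [MessageSpace M] where
  setup : QPT
  keyGen : QPT
  sign : QPT
  ver : QPT
  del : QPT
  cert : QPT

/-- A quantum signing key: a classical part and a quantum memory. -/
abbrev SigningKey := Data × Tape

namespace Scheme

variable {M : Type} [MessageSpace M] (Sch : Scheme M)

/-! The six algorithms. As usual, all of them are also given `1^λ`. -/

/-- `Setup(1^λ) → (ck, pp)` -/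
def Setup (n : ℕ) : PMF (Data × Data) :=
  (Sch.setup.output (Data.unary n)).map fun d => (d.fst, d.snd)

/-- `KeyGen(pp) → (sigk, vk)` -/
def KeyGen (n : ℕ) (pp : Data) : PMF (SigningKey × Data) :=
  (Sch.keyGen.run (Data.ofList [Data.unary n, pp]) Tape.blank).map
    fun r => ((r.1.fst, r.2), r.1.snd)

/-- `Sign(pp, sigk, m) → (sigk', σ)` -/
def Sign (n : ℕ) (pp : Data) (k : SigningKey) (m : M) : PMF (SigningKey × Data) :=
  (Sch.sign.run (Data.ofList [Data.unary n, pp, k.1, MessageSpace.enc m]) k.2).map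
    fun r => ((r.1.fst, r.2), r.1.snd)

/-- `Ver(pp, vk, m, σ)`; every output other than `nil` means acceptance. -/
def Ver (n : ℕ) (pp vk : Data) (m : M) (σ : Data) : PMF Prop :=
  (Sch.ver.output (Data.ofList [Data.unary n, pp, vk, MessageSpace.enc m, σ])).map
    fun d => d ≠ Data.nil

/-- `Del(sigk) → cert` -/
def Del (n : ℕ) (k : SigningKey) : PMF Data :=
  (Sch.del.run (Data.ofList [Data.unary n, k.1]) k.2).map Prod.fst

/-- `Cert(pp, vk, ck, cert, S)`; every output other than `nil` means acceptance. -/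
def Cert (n : ℕ) (pp vk ck c : Data) (S : List M) : PMF Prop :=
  (Sch.cert.output (Data.ofList [Data.unary n, pp, vk, ck, c, encSet S])).map
    fun d => d ≠ Data.nil

def correctExp (n : ℕ) (m : M) : PMF Prop := do
  let (_, pp) ← Sch.Setup n
  let (k, vk) ← Sch.KeyGen n pp
  let (_, σ) ← Sch.Sign n pp k m
  Sch.Ver n pp vk m σ

def OneTimeCorrect : Prop :=
  ∃ ν : ℕ → ℝ, Negligible ν ∧ ∀ (n : ℕ) (m : M), 1 - ν n ≤ prob (Sch.correctExp n m)

/-- The forgery experiment with a signing oracle that may be queried once. The adversary consists of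
the part `A₁` before and the part `A₂` after the query. `A₁` leaves a query, a classical state and
its quantum memory; no query is made if `A₁` names no message. The oracle runs on the quantum memory
of the signing key, the adversary on its own. -/
def forgeExp (A₁ A₂ : QPT) (n : ℕ) : PMF Prop := do
  let (_, pp) ← Sch.Setup n
  let (k, vk) ← Sch.KeyGen n pp
  let (q, ψ) ← A₁.run (Data.ofList [Data.unary n, vk]) Tape.blank
  let query : Option M := decMsg M (q.nth 0)
  let answer ← match query with
    | none => pure Data.nil
    | some m => (Sch.Sign n pp k m).map Prod.snd
  let (out, _) ← A₂.run (Data.ofList [Data.unary n, q.nth 1, answer]) ψ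
  match decMsg M (out.nth 0) with
  | none => pure False
  | some m' => do
      let v ← Sch.Ver n pp vk m' (out.nth 1)
      pure (v ∧ query ≠ some m')

def OneTimeUnforgeable : Prop :=
  ∀ A₁ A₂ : QPT, Negligible fun n => prob (Sch.forgeExp A₁ A₂ n)

/-- The deletion experiment in which no message (`none`) or one message has been signed. -/
def deletionExp (n : ℕ) (m : Option M) : PMF Prop := do
  let (ck, pp) ← Sch.Setup n
  let (k, vk) ← Sch.KeyGen n pp
  let k' ← match m with
    | none => pure k
    | some m => (Sch.Sign n pp k m).map Prod.fst
  let c ← Sch.Del n k'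
  Sch.Cert n pp vk ck c m.toList

def OneTimeDeletionCorrect : Prop :=
  ∃ ν : ℕ → ℝ, Negligible ν ∧ ∀ (n : ℕ) (m : Option M), 1 - ν n ≤ prob (Sch.deletionExp n m)

/-- The experiment for deletion security: given `pp`, the adversary outputs `(vk, cert, S, m', σ)`
with `|S| ≤ 1`. -/
def revokeExp (A : QPT) (n : ℕ) : PMF Prop := do
  let (ck, pp) ← Sch.Setup n
  let out ← A.output (Data.ofList [Data.unary n, pp])
  match decSet M (out.nth 2), decMsg M (out.nth 3) with
  | some S, some m' => do
      let c ← Sch.Cert n pp (out.nth 0) ck (out.nth 1) S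
      let v ← Sch.Ver n pp (out.nth 0) m' (out.nth 4)
      pure (S.length ≤ 1 ∧ c ∧ m' ∉ S ∧ v)
  | _, _ => pure False

def OneTimeDeletionSecure : Prop :=
  ∀ A : QPT, Negligible fun n => prob (Sch.revokeExp A n)

/-- The one-time variants of all four properties. -/
structure IsOneTimeSecure : Prop where
  correct : Sch.OneTimeCorrect
  unforgeable : Sch.OneTimeUnforgeable
  deletionCorrect : Sch.OneTimeDeletionCorrect
  deletionSecure : Sch.OneTimeDeletionSecure

end Scheme

end DSR

end

noncomputable section

namespace DSR

/-! Hash, then sign bit by bit. The public parameter consists of a parameter of the bit scheme and a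
hash key. A key consists of `width n` independent keys of the bit scheme, and a message is signed by
signing the bits of its hash value, each with its own key (`hashThenSign`). Verification, deletion
and certification work position by position. Correctness and deletion correctness are union bounds
over the positions. Their number is polynomially bounded because a hash value has to be written out
within the running time of `eval` (`exists_width_le`).

Deletion security (`revokeVal_le`): let an adversary win with a set `S` and a forged message `m`. If
the element of `S` has the same hash value as `m`, the two messages are a collision. Otherwise there
is a position `j` at which `S` is empty or the bits of its element and of `m` differ, and the `j`-th
components of the output win against the bit scheme. The adversary chooses the verification key
itself, so no challenge has to be planted and `j` need not be guessed: it is computed from the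
output (`extract`), and no factor is lost.

Unforgeability is a consequence of deletion security and deletion correctness
(`RobustDeletion.unforgeable`). Whoever holds an honest signing key can answer the query of a
forger, delete the key, and submit the certificate together with the forgery; this wins unless the
certificate is rejected. The query may depend on the verification key, whereas deletion correctness
speaks of a fixed message. `RobustDeletion` therefore takes the supremum over all messages inside
the expectation over the keys. For the new scheme this is harmless: a message affects a position
only through one bit, so the supremum is at most a sum over the positions and over the three cases
of no bit, `false` and `true`.

What remains is to realise these algorithms in the machine model. A register is the set of qubits
with addresses `cons t _`, and `lift` runs a program inside a register. On a product state it acts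
on one factor only (`sem_lift_put`), so the rounds of a loop over distinct registers are independent
samples (`sem_forEach`, `prodPMF`). Polynomial running time is demanded on every nonzero memory,
even if registers are entangled; `lift_cost` reduces this to a run of the original program by fixing
a basis state of all qubits outside of the register. -/

theorem Data.cons_injective_right (t : Data) : Function.Injective (Data.cons t) :=
  fun _ _ h => (Data.cons.inj h).2

@[simp] theorem Data.fst_cons (a b : Data) : (Data.cons a b).fst = a := rfl
@[simp] theorem Data.snd_cons (a b : Data) : (Data.cons a b).snd = b := rfl
@[simp] theorem Data.fst_nil : Data.nil.fst = Data.nil := rfl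
@[simp] theorem Data.snd_nil : Data.nil.snd = Data.nil := rfl

namespace Tape

/-! ### Pointwise description of the gates -/

theorem had_add (a : Data) (ψ φ : Tape) : had a (ψ + φ) = had a ψ + had a φ := by
  unfold had
  refine Finsupp.sum_add_index' (fun s => ?_) (fun s c d => ?_)
  · simp
  · have h : (if a ∈ s then -(c + d) else c + d) =
        (if a ∈ s then -c else c) + (if a ∈ s then -d else d) := by split_ifs <;> ring
    rw [h, add_div, add_div, Finsupp.single_add, Finsupp.single_add]
    abel

/-- The definition pushes basis states forward; this pulled-back form is what allows gates to be
compared with slices and products pointwise. By linearity it is enough to check basis states. -/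
theorem had_apply (a : Data) (ψ : Tape) (s : Finset Data) :
    had a ψ s = (ψ (s.erase a) + (if a ∈ s then -1 else 1) * ψ (insert a s)) /
      (Real.sqrt 2 : ℂ) := by
  induction ψ using Finsupp.induction_linear with
  | zero => simp [had]
  | add f g hf hg =>
    rw [had_add, Finsupp.add_apply, hf, hg, Finsupp.add_apply, Finsupp.add_apply]
    ring
  | single s' c =>
    unfold had
    rw [Finsupp.sum_single_index (by simp)]
    simp only [Finsupp.add_apply, Finsupp.single_apply]
    by_cases h' : a ∈ s' <;> by_cases h : a ∈ s
    · have h1 : s'.erase a ≠ s := fun e => by rw [← e] at h; simp at h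
      have h2 : s' ≠ s.erase a := fun e => by rw [e] at h'; simp at h'
      simp [h, h', h1, h2, Finset.insert_eq_of_mem]
      split_ifs <;> ring
    · have h1 : insert a s' ≠ s := fun e => by rw [← e] at h; simp at h
      have h2 : s' ≠ s.erase a := fun e => by rw [e] at h'; simp at h'
      have h3 : s'.erase a = s ↔ s' = insert a s :=
        ⟨fun e => by rw [← e, Finset.insert_erase h'],
          fun e => by rw [e, Finset.erase_insert h]⟩
      simp only [h, h', h1, h2, h3, if_true, if_false]
      split_ifs <;> ring
    · have h1 : s'.erase a ≠ s := fun e => by rw [← e] at h; simp at h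
      have h2 : s' ≠ insert a s := fun e => by rw [e] at h'; simp at h'
      have h3 : insert a s' = s ↔ s' = s.erase a :=
        ⟨fun e => by rw [← e, Finset.erase_insert h'],
          fun e => by rw [e, Finset.insert_erase h]⟩
      simp only [h, h', h1, h2, h3, if_true, if_false]
      split_ifs <;> ring
    · have h1 : insert a s' ≠ s := fun e => by rw [← e] at h; simp at h
      have h2 : s' ≠ insert a s := fun e => by rw [e] at h'; simp at h'
      simp only [h, h', h1, h2, if_false, Finset.erase_eq_of_notMem, not_false_eq_true]
      split_ifs <;> ring

theorem tgate_apply (a : Data) (ψ : Tape) (s : Finset Data) :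
    tgate a ψ s = if a ∈ s then Complex.exp (Real.pi / 4 * Complex.I) * ψ s else ψ s := by
  unfold tgate
  rw [Finsupp.sum_apply]
  simp only [Finsupp.single_apply]
  rw [Finsupp.sum, Finset.sum_ite_eq']
  by_cases h : s ∈ ψ.support
  · simp [h]
  · rw [Finsupp.notMem_support_iff] at h
    simp [h]

/-- The action of the controlled-NOT gate on basis states. -/
def flip (a b : Data) (s : Finset Data) : Finset Data := if a ∈ s then symmDiff s {b} else s

theorem flip_flip {a b : Data} (hab : a ≠ b) (s : Finset Data) : flip a b (flip a b s) = s := by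
  unfold flip
  by_cases h : a ∈ s
  · have : a ∈ symmDiff s {b} := by simp [Finset.mem_symmDiff, h, hab]
    rw [if_pos h, if_pos this, symmDiff_symmDiff_cancel_right]
  · simp [h]

theorem cnot_apply (a b : Data) (ψ : Tape) (s : Finset Data) :
    cnot a b ψ s = if a = b then ψ s else ψ (flip a b s) := by
  unfold cnot
  split_ifs with h
  · rfl
  · have hi : Function.Injective (flip a b) :=
      Function.LeftInverse.injective (g := flip a b) (flip_flip h)
    conv_lhs => rw [← flip_flip h s]
    exact Finsupp.mapDomain_apply hi ψ _

theorem proj_apply (a : Data) (b : Bool) (ψ : Tape) (s : Finset Data) :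
    proj a b ψ s = if decide (a ∈ s) = b then ψ s else 0 :=
  Finsupp.filter_apply _ _ _

theorem blank_ne_zero : blank ≠ 0 := by simp [blank]

theorem had_ne_zero (a : Data) {ψ : Tape} (h : ψ ≠ 0) : had a ψ ≠ 0 := by
  contrapose! h
  have h2 : (Real.sqrt 2 : ℂ) ≠ 0 := by simp
  -- The gate mixes only the amplitudes at `s` and `insert a s`; both their sum and their difference
  -- vanish.
  have key : ∀ s, a ∉ s → ψ s = 0 ∧ ψ (insert a s) = 0 := by
    intro s hs
    have e1 := had_apply a ψ s
    have e2 := had_apply a ψ (insert a s)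
    simp only [h, Finsupp.coe_zero, Pi.zero_apply, hs, if_false, Finset.erase_eq_of_notMem,
      not_false_eq_true, Finset.erase_insert, Finset.mem_insert_self, if_true,
      Finset.insert_idem] at e1 e2
    rw [eq_comm, div_eq_zero_iff, or_iff_left h2] at e1 e2
    constructor
    · linear_combination (e1 + e2) / 2
    · linear_combination (e1 - e2) / 2
  ext s
  by_cases hs : a ∈ s
  · have := (key (s.erase a) (by simp)).2
    rwa [Finset.insert_erase hs] at this
  · exact (key s hs).1

theorem tgate_ne_zero (a : Data) {ψ : Tape} (h : ψ ≠ 0) : tgate a ψ ≠ 0 := by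
  contrapose! h
  ext s
  have := tgate_apply a ψ s
  rw [h] at this
  split_ifs at this
  · simpa [Complex.exp_ne_zero] using this.symm
  · simpa using this.symm

theorem cnot_ne_zero (a b : Data) {ψ : Tape} (h : ψ ≠ 0) : cnot a b ψ ≠ 0 := by
  contrapose! h
  ext s
  by_cases hab : a = b
  · have := cnot_apply a b ψ s
    rw [h, if_pos hab] at this
    simpa using this.symm
  · have := cnot_apply a b ψ (flip a b s)
    rw [h, if_neg hab, flip_flip hab] at this
    simpa using this.symm

theorem weight_eq_zero {ψ : Tape} : ψ.weight = 0 ↔ ψ = 0 := by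
  unfold weight Finsupp.sum
  rw [Finset.sum_eq_zero_iff]
  constructor
  · intro h
    ext s
    by_contra hs
    have := h s (Finsupp.mem_support_iff.mpr hs)
    simp at this
    exact hs this
  · rintro rfl
    simp

theorem weight_eq_add (a : Data) (ψ : Tape) :
    ψ.weight = (proj a true ψ).weight + (proj a false ψ).weight := by
  unfold weight proj
  rw [Finsupp.sum_filter_index, Finsupp.support_filter, Finsupp.sum_filter_index,
    Finsupp.support_filter, Finsupp.sum, ← Finset.sum_filter_add_sum_filter_not ψ.support
    (fun s => decide (a ∈ s) = true)]
  simp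

theorem outcome_true (a : Data) (ψ : Tape) :
    outcome a ψ true = ((proj a true ψ).weight / ψ.weight : ℝ≥0) := by
  simp [outcome, PMF.ofFintype_apply]

/-- If the projection vanished, all the weight would lie on the other outcome and `b` would have
probability zero. -/
theorem proj_ne_zero {a : Data} {ψ : Tape} (h : ψ ≠ 0) {b : Bool}
    (hb : b ∈ (outcome a ψ).support) : proj a b ψ ≠ 0 := by
  intro h0
  apply (PMF.mem_support_iff _ _).mp hb
  have hw : ψ.weight ≠ 0 := fun e => h (weight_eq_zero.mp e)
  cases b with
  | true => rw [outcome_true, h0, weight_eq_zero.mpr rfl]; simp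
  | false =>
    have : (proj a true ψ).weight = ψ.weight := by
      rw [weight_eq_add a ψ, h0, weight_eq_zero.mpr (rfl : (0 : Tape) = 0), add_zero]
    simp [outcome, PMF.ofFintype_apply, this, div_self hw]

/-- Converse of `proj_ne_zero`. In `lift_cost` it turns a slice that survives a measurement into a
possible outcome of the projected run. -/
theorem mem_support_outcome {a : Data} {ψ : Tape} {b : Bool} (h : proj a b ψ ≠ 0) :
    b ∈ (outcome a ψ).support := by
  have hw : ψ.weight ≠ 0 := fun e => h (by rw [weight_eq_zero.mp e]; exact Finsupp.filter_zero _)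
  have hb : (proj a b ψ).weight ≠ 0 := fun e => h (weight_eq_zero.mp e)
  rw [PMF.mem_support_iff]
  cases b with
  | true =>
    rw [outcome_true, Ne, ENNReal.coe_eq_zero]
    exact div_ne_zero hb hw
  | false =>
    have h1 : (proj a true ψ).weight / ψ.weight < 1 := by
      rw [div_lt_one (pos_iff_ne_zero.mpr hw), weight_eq_add a ψ]
      exact lt_add_of_pos_right _ (pos_iff_ne_zero.mpr hb)
    simpa [outcome, PMF.ofFintype_apply, tsub_eq_zero_iff_le] using h1

/-! ### Registers: the qubits whose address is `cons t _` -/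

/-- The part of a basis state that lies in register `t`. -/
def part (t : Data) (s : Finset Data) : Finset Data :=
  s.preimage (Data.cons t) (Data.cons_injective_right t).injOn

/-- The part of a basis state outside of register `t`. -/
def rest (t : Data) (s : Finset Data) : Finset Data :=
  s.filter fun a => a = Data.nil ∨ a.fst ≠ t

/-- Basis states are determined by their parts inside and outside of register `t`. -/
def join (t : Data) (p u : Finset Data) : Finset Data := p.image (Data.cons t) ∪ rest t u

theorem mem_part {t a : Data} {s : Finset Data} : a ∈ part t s ↔ Data.cons t a ∈ s := by
  simp [part]

theorem mem_join_cons {t t' a : Data} {p u : Finset Data} :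
    Data.cons t' a ∈ join t p u ↔ if t' = t then a ∈ p else Data.cons t' a ∈ u := by
  simp only [join, rest, Finset.mem_union, Finset.mem_image, Finset.mem_filter, Data.fst_cons]
  split_ifs with h
  · subst h; simp
  · simp [h, Ne.symm h]

theorem mem_join_nil {t : Data} {p u : Finset Data} :
    Data.nil ∈ join t p u ↔ Data.nil ∈ u := by
  simp [join, rest]

theorem mem_rest_cons {t t' a : Data} {u : Finset Data} :
    Data.cons t' a ∈ rest t u ↔ t' ≠ t ∧ Data.cons t' a ∈ u := by
  simp [rest, and_comm]

theorem mem_rest_nil {t : Data} {u : Finset Data} : Data.nil ∈ rest t u ↔ Data.nil ∈ u := by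
  simp [rest]

/-- The qubit `nil` belongs to no register, so it has to be compared separately. -/
theorem ext_mem {s s' : Finset Data} (h0 : Data.nil ∈ s ↔ Data.nil ∈ s')
    (h : ∀ t a, Data.cons t a ∈ s ↔ Data.cons t a ∈ s') : s = s' := by
  ext a
  cases a with
  | nil => exact h0
  | cons t a => exact h t a

theorem join_part (t : Data) (s : Finset Data) : join t (part t s) s = s := by
  refine ext_mem mem_join_nil fun t' a => ?_
  rw [mem_join_cons]
  split_ifs with h
  · rw [mem_part, h]
  · rfl

theorem part_join (t : Data) (p u : Finset Data) : part t (join t p u) = p := by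
  ext a
  rw [mem_part, mem_join_cons, if_pos rfl]

theorem rest_join (t : Data) (p u : Finset Data) : rest t (join t p u) = rest t u := by
  refine ext_mem (by rw [mem_rest_nil, mem_rest_nil, mem_join_nil]) fun t' a => ?_
  rw [mem_rest_cons, mem_rest_cons, mem_join_cons]
  by_cases h : t' = t <;> simp [h]

theorem rest_rest (t : Data) (u : Finset Data) : rest t (rest t u) = rest t u := by
  simp [rest, Finset.filter_filter]

theorem join_injective (t : Data) (u : Finset Data) :
    Function.Injective fun p => join t p u := fun p q h => by
  rw [← part_join t p u, ← part_join t q u]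
  exact congrArg (part t) h

theorem erase_join (t a : Data) (p u : Finset Data) :
    (join t p u).erase (Data.cons t a) = join t (p.erase a) u := by
  refine ext_mem (by simp [mem_join_nil]) fun t' b => ?_
  simp only [Finset.mem_erase, mem_join_cons, ne_eq, Data.cons.injEq]
  by_cases h : t' = t <;> simp [h]

theorem insert_join (t a : Data) (p u : Finset Data) :
    insert (Data.cons t a) (join t p u) = join t (insert a p) u := by
  refine ext_mem (by simp [mem_join_nil]) fun t' b => ?_
  simp only [Finset.mem_insert, mem_join_cons, Data.cons.injEq]
  by_cases h : t' = t <;> simp [h]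

theorem flip_join (t a b : Data) (p u : Finset Data) :
    flip (Data.cons t a) (Data.cons t b) (join t p u) = join t (flip a b p) u := by
  unfold flip
  simp only [mem_join_cons, if_true]
  split_ifs with ha
  · refine ext_mem (by simp [mem_join_nil, Finset.mem_symmDiff]) fun t' c => ?_
    simp only [Finset.mem_symmDiff, mem_join_cons, Finset.mem_singleton, Data.cons.injEq]
    by_cases h : t' = t <;> simp [h]
  · rfl

/-- The (unnormalised) state of register `t` after all other qubits have been observed. -/
def slice (t : Data) (u : Finset Data) (Ψ : Tape) : Tape :=
  Ψ.comapDomain (fun p => join t p u) (join_injective t u).injOn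

theorem slice_apply (t : Data) (u : Finset Data) (Ψ : Tape) (p : Finset Data) :
    slice t u Ψ p = Ψ (join t p u) := rfl

theorem slice_ext {t : Data} {Ψ Ψ' : Tape} (h : ∀ u, slice t u Ψ = slice t u Ψ') : Ψ = Ψ' := by
  ext s
  have := DFunLike.congr_fun (h s) (part t s)
  rwa [slice_apply, slice_apply, join_part] at this

theorem exists_slice_ne_zero (t : Data) {Ψ : Tape} (h : Ψ ≠ 0) : ∃ u, slice t u Ψ ≠ 0 := by
  contrapose! h
  refine slice_ext (t := t) fun u => (h u).trans ?_
  ext p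
  rfl

theorem slice_had (t a : Data) (u : Finset Data) (Ψ : Tape) :
    slice t u (had (Data.cons t a) Ψ) = had a (slice t u Ψ) := by
  ext p
  simp only [slice_apply, had_apply, erase_join, insert_join, mem_join_cons, if_true]

theorem slice_tgate (t a : Data) (u : Finset Data) (Ψ : Tape) :
    slice t u (tgate (Data.cons t a) Ψ) = tgate a (slice t u Ψ) := by
  ext p
  simp only [slice_apply, tgate_apply, mem_join_cons, if_true]

theorem slice_cnot (t a b : Data) (u : Finset Data) (Ψ : Tape) :
    slice t u (cnot (Data.cons t a) (Data.cons t b) Ψ) = cnot a b (slice t u Ψ) := by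
  ext p
  rw [slice_apply, cnot_apply, cnot_apply, slice_apply, slice_apply, flip_join]
  simp

theorem slice_proj (t a : Data) (b : Bool) (u : Finset Data) (Ψ : Tape) :
    slice t u (proj (Data.cons t a) b Ψ) = proj a b (slice t u Ψ) := by
  ext p
  rw [slice_apply, proj_apply, proj_apply, slice_apply]
  simp [mem_join_cons]

theorem had_smul (a : Data) (c : ℂ) (ψ : Tape) : had a (c • ψ) = c • had a ψ := by
  ext s
  simp only [had_apply, Finsupp.smul_apply, smul_eq_mul]
  ring

theorem tgate_smul (a : Data) (c : ℂ) (ψ : Tape) : tgate a (c • ψ) = c • tgate a ψ := by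
  ext s
  simp only [tgate_apply, Finsupp.smul_apply, smul_eq_mul]
  split_ifs <;> ring

theorem cnot_smul (a b : Data) (c : ℂ) (ψ : Tape) : cnot a b (c • ψ) = c • cnot a b ψ := by
  ext s
  simp only [cnot_apply, Finsupp.smul_apply]
  split_ifs <;> rfl

theorem proj_smul (a : Data) (b : Bool) (c : ℂ) (ψ : Tape) :
    proj a b (c • ψ) = c • proj a b ψ := by
  ext s
  simp only [proj_apply, Finsupp.smul_apply]
  split_ifs <;> simp

/-- The state that is the product of `ψ` in register `t` and of `Φ` in all other qubits. -/
def put (t : Data) (ψ Φ : Tape) : Tape :=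
  Finsupp.onFinset (Finset.image₂ (fun p u => join t p u) ψ.support Φ.support)
    (fun s => ψ (part t s) * Φ (rest t s)) (fun s hs => by
      refine Finset.mem_image₂.mpr ⟨part t s, Finsupp.mem_support_iff.mpr (left_ne_zero_of_mul hs),
        rest t s, Finsupp.mem_support_iff.mpr (right_ne_zero_of_mul hs), ?_⟩
      conv_rhs => rw [← join_part t s]
      simp only [join, rest_rest])

theorem put_apply (t : Data) (ψ Φ : Tape) (s : Finset Data) :
    put t ψ Φ s = ψ (part t s) * Φ (rest t s) := rfl

/-- All slices of a product state are multiples of the same `ψ`. Identities for gates on a factor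
thus reduce, slice by slice, to homogeneity of the gate. -/
theorem slice_put (t : Data) (ψ Φ : Tape) (u : Finset Data) :
    slice t u (put t ψ Φ) = Φ (rest t u) • ψ := by
  ext p
  rw [slice_apply, put_apply, part_join, rest_join, Finsupp.smul_apply, smul_eq_mul, mul_comm]

theorem had_put (t a : Data) (ψ Φ : Tape) :
    had (Data.cons t a) (put t ψ Φ) = put t (had a ψ) Φ :=
  slice_ext (t := t) fun u => by rw [slice_had, slice_put, slice_put, had_smul]

theorem tgate_put (t a : Data) (ψ Φ : Tape) :
    tgate (Data.cons t a) (put t ψ Φ) = put t (tgate a ψ) Φ :=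
  slice_ext (t := t) fun u => by rw [slice_tgate, slice_put, slice_put, tgate_smul]

theorem cnot_put (t a b : Data) (ψ Φ : Tape) :
    cnot (Data.cons t a) (Data.cons t b) (put t ψ Φ) = put t (cnot a b ψ) Φ :=
  slice_ext (t := t) fun u => by rw [slice_cnot, slice_put, slice_put, cnot_smul]

theorem proj_put (t a : Data) (b : Bool) (ψ Φ : Tape) :
    proj (Data.cons t a) b (put t ψ Φ) = put t (proj a b ψ) Φ :=
  slice_ext (t := t) fun u => by rw [slice_proj, slice_put, slice_put, proj_smul]

/-- The squared norm of the component of a state in which register `t` is blank. -/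
def restWeight (t : Data) (Φ : Tape) : ℝ≥0 :=
  ∑ u ∈ Φ.support.filter (fun u => rest t u = u), ‖Φ u‖₊ ^ 2

/-- `put` evaluates `Φ` only at basis states in which register `t` is blank, hence `restWeight`
instead of `weight`. The product of the two supports is in bijection with the support of `put` via
`join`. -/
theorem weight_put (t : Data) (ψ Φ : Tape) :
    (put t ψ Φ).weight = ψ.weight * restWeight t Φ := by
  unfold weight restWeight Finsupp.sum
  rw [Finset.sum_mul_sum, ← Finset.sum_product']
  symm
  refine Finset.sum_bij_ne_zero (fun x _ _ => join t x.1 x.2) ?_ ?_ ?_ ?_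
  · rintro ⟨p, u⟩ h _
    simp only [Finset.mem_product, Finset.mem_filter, Finsupp.mem_support_iff] at h
    rw [Finsupp.mem_support_iff, put_apply, part_join, rest_join, h.2.2]
    exact mul_ne_zero h.1 h.2.1
  · rintro ⟨p, u⟩ h _ ⟨p', u'⟩ h' _ e
    simp only [Finset.mem_product, Finset.mem_filter, Finsupp.mem_support_iff] at h h'
    have e1 := congrArg (part t) e
    have e2 := congrArg (rest t) e
    simp only [part_join, rest_join, h.2.2, h'.2.2] at e1 e2
    rw [e1, e2]
  · intro s hs _
    rw [Finsupp.mem_support_iff, put_apply] at hs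
    have h1 := left_ne_zero_of_mul hs
    have h2 := right_ne_zero_of_mul hs
    refine ⟨(part t s, rest t s), ?_, ?_, ?_⟩
    · simp [h1, h2, rest_rest]
    · simp [h1, h2]
    · conv_rhs => rw [← join_part t s]
      simp only [join, rest_rest]
  · rintro ⟨p, u⟩ h _
    simp only [Finset.mem_product, Finset.mem_filter, Finsupp.mem_support_iff] at h
    simp only [put_apply, part_join, rest_join, h.2.2, nnnorm_mul, mul_pow]

/-- The weight of the other factor cancels in the Born rule. If it were zero, the product would be
the zero vector and the quotient would degenerate. -/
theorem outcome_put {t a : Data} {ψ Φ : Tape} (h : restWeight t Φ ≠ 0) :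
    outcome (Data.cons t a) (put t ψ Φ) = outcome a ψ := by
  ext b
  simp only [outcome, PMF.ofFintype_apply, proj_put, weight_put, mul_div_mul_right _ _ h]

theorem put_comm {t t' : Data} (h : t ≠ t') (ψ ψ' Φ : Tape) :
    put t ψ (put t' ψ' Φ) = put t' ψ' (put t ψ Φ) := by
  have h1 : ∀ t t' s, t ≠ t' → part t' (rest t s) = part t' s := by
    intro t t' s h
    ext a
    simp [mem_part, mem_rest_cons, h.symm]
  have h2 : ∀ s, rest t (rest t' s) = rest t' (rest t s) := by
    intro s
    simp [rest, Finset.filter_filter, and_comm]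
  ext s
  simp only [put_apply]
  rw [h1 _ _ _ h, h1 _ _ _ h.symm, h2]
  ring

theorem restWeight_ne_zero {t : Data} {Φ : Tape} {u : Finset Data} (hu : rest t u = u)
    (hΦ : Φ u ≠ 0) : restWeight t Φ ≠ 0 := by
  unfold restWeight
  intro h0
  rw [Finset.sum_eq_zero_iff] at h0
  have := h0 u (by simp [hu, hΦ])
  simp at this
  exact hΦ this

/-- Induction step for products of several registers: filling register `t` keeps some amplitude
nonzero and leaves the other blank registers blank, so that they can still be filled. -/
theorem exists_put_ne_zero {t : Data} {ψ Φ : Tape} {u : Finset Data} (hψ : ψ ≠ 0)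
    (hu : rest t u = u) (hΦ : Φ u ≠ 0) :
    ∃ v, put t ψ Φ v ≠ 0 ∧ ∀ t', t' ≠ t → rest t' u = u → rest t' v = v := by
  obtain ⟨p, hp⟩ := Finsupp.ne_iff.mp hψ
  refine ⟨join t p u, ?_, fun t' ht' h' => ?_⟩
  · rw [put_apply, part_join, rest_join, hu]
    exact mul_ne_zero hp hΦ
  · refine ext_mem mem_rest_nil fun t'' a => ?_
    rw [mem_rest_cons, and_iff_right_iff_imp]
    rintro h1 rfl
    rw [mem_join_cons, if_neg ht', ← h', mem_rest_cons] at h1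
    exact h1.1 rfl

end Tape

/-! ### Results of runs -/

theorem pmf_bind {α β : Type} (p : PMF α) (f : α → PMF β) : (p >>= f) = p.bind f := rfl
theorem pmf_pure {α : Type} (a : α) : (pure a : PMF α) = PMF.pure a := rfl

namespace Prog

theorem mem_run_id {x : Data} {ψ : Tape} {r : Result} :
    r ∈ (id.run x ψ).support ↔ r = ⟨x, ψ, 1 + x.size⟩ := by
  simp only [run, pmf_pure, PMF.mem_support_pure_iff]

theorem mem_run_nil {x : Data} {ψ : Tape} {r : Result} :
    r ∈ (nil.run x ψ).support ↔ r = ⟨Data.nil, ψ, 1 + x.size⟩ := by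
  simp only [run, pmf_pure, PMF.mem_support_pure_iff]

theorem mem_run_fst {x : Data} {ψ : Tape} {r : Result} :
    r ∈ (fst.run x ψ).support ↔ r = ⟨x.fst, ψ, 1 + x.size⟩ := by
  simp only [run, pmf_pure, PMF.mem_support_pure_iff]

theorem mem_run_snd {x : Data} {ψ : Tape} {r : Result} :
    r ∈ (snd.run x ψ).support ↔ r = ⟨x.snd, ψ, 1 + x.size⟩ := by
  simp only [run, pmf_pure, PMF.mem_support_pure_iff]

theorem mem_run_had {x : Data} {ψ : Tape} {r : Result} :
    r ∈ (had.run x ψ).support ↔ r = ⟨Data.nil, ψ.had x, 1 + x.size⟩ := by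
  simp only [run, pmf_pure, PMF.mem_support_pure_iff]

theorem mem_run_tgate {x : Data} {ψ : Tape} {r : Result} :
    r ∈ (tgate.run x ψ).support ↔ r = ⟨Data.nil, ψ.tgate x, 1 + x.size⟩ := by
  simp only [run, pmf_pure, PMF.mem_support_pure_iff]

theorem mem_run_cnot {x : Data} {ψ : Tape} {r : Result} :
    r ∈ (cnot.run x ψ).support ↔ r = ⟨Data.nil, ψ.cnot x.fst x.snd, 1 + x.size⟩ := by
  simp only [run, pmf_pure, PMF.mem_support_pure_iff]

theorem mem_run_seq {f g : Prog} {x : Data} {ψ : Tape} {r : Result} :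
    r ∈ ((seq f g).run x ψ).support ↔ ∃ r₁ ∈ (f.run x ψ).support,
      ∃ r₂ ∈ (g.run r₁.out r₁.tape).support,
        r = ⟨r₂.out, r₂.tape, 1 + x.size + r₁.time + r₂.time⟩ := by
  simp only [run, pmf_bind, pmf_pure]
  simp

theorem mem_run_pair {f g : Prog} {x : Data} {ψ : Tape} {r : Result} :
    r ∈ ((pair f g).run x ψ).support ↔ ∃ r₁ ∈ (f.run x ψ).support,
      ∃ r₂ ∈ (g.run x r₁.tape).support,
        r = ⟨Data.cons r₁.out r₂.out, r₂.tape, 1 + x.size + r₁.time + r₂.time⟩ := by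
  simp only [run, pmf_bind, pmf_pure]
  simp

theorem run_ite (c f g : Prog) (x : Data) (ψ : Tape) :
    (ite c f g).run x ψ = (c.run x ψ).bind fun r =>
      ((if r.out = Data.nil then g else f).run x r.tape).bind fun s =>
        PMF.pure ⟨s.out, s.tape, 1 + x.size + r.time + s.time⟩ := by
  simp only [run, pmf_bind, pmf_pure]
  refine congrArg _ (funext fun r => ?_)
  split_ifs <;> rfl

theorem mem_run_ite {c f g : Prog} {x : Data} {ψ : Tape} {r : Result} :
    r ∈ ((ite c f g).run x ψ).support ↔ ∃ r₁ ∈ (c.run x ψ).support,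
      ∃ r₂ ∈ ((if r₁.out = Data.nil then g else f).run x r₁.tape).support,
        r = ⟨r₂.out, r₂.tape, 1 + x.size + r₁.time + r₂.time⟩ := by
  rw [run_ite]
  simp

theorem mem_run_rep {f : Prog} {x : Data} {ψ : Tape} {r : Result} :
    r ∈ ((rep f).run x ψ).support ↔ ∃ r₁ ∈ (iterRun f.run x.fst.size x.snd ψ).support,
        r = ⟨r₁.out, r₁.tape, 1 + x.size + r₁.time⟩ := by
  simp only [run, pmf_bind, pmf_pure]
  simp

theorem mem_run_meas {x : Data} {ψ : Tape} {r : Result} :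
    r ∈ (meas.run x ψ).support ↔ ∃ b ∈ (ψ.outcome x).support,
        r = ⟨Data.ofBool b, ψ.proj x b, 1 + x.size⟩ := by
  simp only [run, pmf_bind, pmf_pure, PMF.mem_support_bind_iff,
    PMF.mem_support_pure_iff]

end Prog

theorem mem_iterRun_zero {f : Data → Tape → PMF Result} {x : Data} {ψ : Tape} {r : Result} :
    r ∈ (iterRun f 0 x ψ).support ↔ r = ⟨x, ψ, 0⟩ := by
  simp only [iterRun, pmf_pure]
  simp

theorem mem_iterRun_succ {f : Data → Tape → PMF Result} {k : ℕ} {x : Data} {ψ : Tape}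
    {r : Result} :
    r ∈ (iterRun f (k + 1) x ψ).support ↔ ∃ r₁ ∈ (f x ψ).support,
      ∃ r₂ ∈ (iterRun f k r₁.out r₁.tape).support,
        r = ⟨r₂.out, r₂.tape, r₁.time + r₂.time⟩ := by
  simp only [iterRun, pmf_bind, pmf_pure]
  simp

/-- Nonzero states stay nonzero. -/
theorem Prog.tape_ne_zero {P : Prog} {x : Data} {ψ : Tape} (hψ : ψ ≠ 0) {r : Result}
    (hr : r ∈ (P.run x ψ).support) : r.tape ≠ 0 := by
  induction P generalizing x ψ r with
  | id | nil | fst | snd =>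
    simp only [run, pmf_pure, PMF.mem_support_pure_iff] at hr
    subst hr
    exact hψ
  | seq f g hf hg =>
    obtain ⟨r₁, h₁, r₂, h₂, rfl⟩ := mem_run_seq.mp hr
    exact hg (r := r₂) (hf hψ h₁) h₂
  | pair f g hf hg =>
    obtain ⟨r₁, h₁, r₂, h₂, rfl⟩ := mem_run_pair.mp hr
    exact hg (r := r₂) (hf hψ h₁) h₂
  | ite c f g hc hf hg =>
    obtain ⟨r₁, h₁, r₂, h₂, rfl⟩ := mem_run_ite.mp hr
    split_ifs at h₂
    · exact hg (r := r₂) (hc hψ h₁) h₂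
    · exact hf (r := r₂) (hc hψ h₁) h₂
  | rep f hf =>
    obtain ⟨r₁, h₁, rfl⟩ := mem_run_rep.mp hr
    have key : ∀ (k : ℕ) (y : Data) (φ : Tape), φ ≠ 0 →
        ∀ s ∈ (iterRun f.run k y φ).support, s.tape ≠ 0 := by
      intro k
      induction k with
      | zero =>
        intro y φ hφ s hs
        rw [mem_iterRun_zero.mp hs]
        exact hφ
      | succ k ih =>
        intro y φ hφ s hs
        obtain ⟨s₁, hs₁, s₂, hs₂, rfl⟩ := mem_iterRun_succ.mp hs
        exact ih _ _ (hf hφ hs₁) s₂ hs₂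
    exact key _ _ _ hψ r₁ h₁
  | had =>
    obtain rfl := mem_run_had.mp hr
    exact Tape.had_ne_zero _ hψ
  | tgate =>
    obtain rfl := mem_run_tgate.mp hr
    exact Tape.tgate_ne_zero _ hψ
  | cnot =>
    obtain rfl := mem_run_cnot.mp hr
    exact Tape.cnot_ne_zero _ _ hψ
  | meas =>
    obtain ⟨b, hb, rfl⟩ := mem_run_meas.mp hr
    exact Tape.proj_ne_zero hψ hb

/-! ### Runs without their running time -/

/-- The distribution of the output and the final memory of a program. -/
def Prog.sem (P : Prog) (x : Data) (ψ : Tape) : PMF (Data × Tape) :=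
  (P.run x ψ).map fun r => (r.out, r.tape)

/-- `k` consecutive runs. -/
def iterSem (F : Data → Tape → PMF (Data × Tape)) : ℕ → Data × Tape → PMF (Data × Tape)
  | 0, p => PMF.pure p
  | k + 1, p => (F p.1 p.2).bind (iterSem F k)

theorem iterSem_add (F : Data → Tape → PMF (Data × Tape)) (j k : ℕ) (p : Data × Tape) :
    iterSem F (j + k) p = (iterSem F j p).bind (iterSem F k) := by
  induction j generalizing p with
  | zero => simp [iterSem]
  | succ j ih =>
    rw [Nat.succ_add, iterSem, iterSem, PMF.bind_bind]
    exact congrArg _ (funext ih)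

theorem iterSem_pure (f : Data → Data) (ψ : Tape) (k : ℕ) (x : Data) :
    iterSem (fun y φ => PMF.pure (f y, φ)) k (x, ψ) = PMF.pure (f^[k] x, ψ) := by
  induction k generalizing x with
  | zero => rfl
  | succ k ih => rw [iterSem, PMF.pure_bind, ih, Function.iterate_succ_apply]

namespace Prog

theorem sem_ne_zero {P : Prog} {x : Data} {ψ : Tape} (hψ : ψ ≠ 0) {r : Data × Tape}
    (hr : r ∈ (P.sem x ψ).support) : r.2 ≠ 0 := by
  obtain ⟨s, hs, rfl⟩ := (PMF.mem_support_map_iff _ _ _).mp hr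
  exact tape_ne_zero hψ hs

theorem sem_id (x : Data) (ψ : Tape) : id.sem x ψ = PMF.pure (x, ψ) := PMF.pure_map _ _
theorem sem_nil (x : Data) (ψ : Tape) : nil.sem x ψ = PMF.pure (Data.nil, ψ) := PMF.pure_map _ _
theorem sem_fst (x : Data) (ψ : Tape) : fst.sem x ψ = PMF.pure (x.fst, ψ) := PMF.pure_map _ _
theorem sem_snd (x : Data) (ψ : Tape) : snd.sem x ψ = PMF.pure (x.snd, ψ) := PMF.pure_map _ _
theorem sem_had (x : Data) (ψ : Tape) : had.sem x ψ = PMF.pure (Data.nil, ψ.had x) :=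
  PMF.pure_map _ _
theorem sem_tgate (x : Data) (ψ : Tape) : tgate.sem x ψ = PMF.pure (Data.nil, ψ.tgate x) :=
  PMF.pure_map _ _
theorem sem_cnot (x : Data) (ψ : Tape) :
    cnot.sem x ψ = PMF.pure (Data.nil, ψ.cnot x.fst x.snd) := PMF.pure_map _ _

theorem sem_meas (x : Data) (ψ : Tape) :
    meas.sem x ψ = (ψ.outcome x).map fun b => (Data.ofBool b, ψ.proj x b) := by
  simp only [sem, run, pmf_bind, pmf_pure, PMF.map]
  simp [Function.comp_def]

theorem sem_seq (f g : Prog) (x : Data) (ψ : Tape) :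
    (seq f g).sem x ψ = (f.sem x ψ).bind fun r => g.sem r.1 r.2 := by
  simp only [sem, run, pmf_bind, pmf_pure, PMF.map]
  simp [Function.comp_def]

theorem sem_pair (f g : Prog) (x : Data) (ψ : Tape) :
    (pair f g).sem x ψ =
      (f.sem x ψ).bind fun r => (g.sem x r.2).map fun s => (Data.cons r.1 s.1, s.2) := by
  simp only [sem, run, pmf_bind, pmf_pure, PMF.map]
  simp [Function.comp_def]

theorem sem_ite (c f g : Prog) (x : Data) (ψ : Tape) :
    (ite c f g).sem x ψ =
      (c.sem x ψ).bind fun r => (if r.1 = Data.nil then g else f).sem x r.2 := by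
  simp only [sem, run_ite, PMF.map]
  simp [Function.comp_def]

theorem iterRun_map (f : Prog) (k : ℕ) (x : Data) (ψ : Tape) :
    (iterRun f.run k x ψ).map (fun r => (r.out, r.tape)) = iterSem f.sem k (x, ψ) := by
  induction k generalizing x ψ with
  | zero => exact PMF.pure_map _ _
  | succ k ih =>
    rw [iterSem, sem, PMF.bind_map]
    simp only [Function.comp_def, ← ih]
    simp only [iterRun, pmf_bind, pmf_pure, PMF.map]
    simp [Function.comp_def]

theorem sem_rep (f : Prog) (x : Data) (ψ : Tape) :
    (rep f).sem x ψ = iterSem f.sem x.fst.size (x.snd, ψ) := by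
  rw [← iterRun_map]
  simp only [sem, run, pmf_bind, pmf_pure, PMF.map]
  simp [Function.comp_def]

/-! ### Classical programs -/

/-- Case distinction on whether a datum is `nil`. -/
def _root_.DSR.Data.sel : Data → Data → Data → Data
  | .nil, _, y => y
  | .cons _ _, x, _ => x

/-- The function that is computed by a classical program. -/
def value : Prog → Data → Data
  | .id, x => x
  | .nil, _ => Data.nil
  | .fst, x => x.fst
  | .snd, x => x.snd
  | .seq f g, x => g.value (f.value x)
  | .pair f g, x => Data.cons (f.value x) (g.value x)
  | .ite c f g, x => (c.value x).sel (f.value x) (g.value x)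
  | .rep f, x => f.value^[x.fst.size] x.snd
  | .had, _ | .tgate, _ | .cnot, _ | .meas, _ => Data.nil

theorem Classical.sem {P : Prog} (h : P.Classical) (x : Data) (ψ : Tape) :
    P.sem x ψ = PMF.pure (P.value x, ψ) := by
  induction P generalizing x ψ with
  | id => exact sem_id x ψ
  | nil => exact sem_nil x ψ
  | fst => exact sem_fst x ψ
  | snd => exact sem_snd x ψ
  | seq f g hf hg => rw [sem_seq, hf h.1, PMF.pure_bind, hg h.2, value]
  | pair f g hf hg => rw [sem_pair, hf h.1, PMF.pure_bind, hg h.2, PMF.pure_map, value]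
  | ite c f g hc hf hg =>
    rw [sem_ite, hc h.1, PMF.pure_bind, value]
    cases c.value x with
    | nil => exact hg h.2.2 x ψ
    | cons => exact hf h.2.1 x ψ
  | rep f hf =>
    have : f.sem = fun y φ => PMF.pure (f.value y, φ) := funext fun y => funext (hf h y)
    rw [sem_rep, this, iterSem_pure, value]
  | had | tgate | cnot | meas => exact h.elim

/-! ### Running a program inside a register -/

/-- On input `cons t x`, run a program on input `x` inside register `t`. -/
def lift : Prog → Prog
  | .id => .snd
  | .nil => .nil
  | .fst => .seq .snd .fst
  | .snd => .seq .snd .snd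
  | .seq f g => .seq (.pair .fst f.lift) g.lift
  | .pair f g => .pair f.lift g.lift
  | .ite c f g => .ite c.lift f.lift g.lift
  | .rep f => .seq (.pair (.seq .snd .fst) (.pair .fst (.seq .snd .snd)))
      (.seq (.rep (.pair .fst f.lift)) .snd)
  | .had => .had
  | .tgate => .tgate
  | .cnot => .seq (.pair (.pair .fst (.seq .snd .fst)) (.pair .fst (.seq .snd .snd))) .cnot
  | .meas => .meas

/-- Every gate of the lifted program has addresses `cons t _`, so it acts on the factor `ψ` alone,
and measurements have the same statistics by `outcome_put`. The composite instructions only have to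
carry the tag `t` along. -/
theorem sem_lift_put (P : Prog) {t : Data} {Φ : Tape} (hΦ : Tape.restWeight t Φ ≠ 0) (x : Data)
    (ψ : Tape) :
    P.lift.sem (Data.cons t x) (Tape.put t ψ Φ) =
      (P.sem x ψ).map fun r => (r.1, Tape.put t r.2 Φ) := by
  induction P generalizing x ψ with
  | id => simp [lift, sem_id, sem_snd, PMF.pure_map]
  | nil => simp [lift, sem_nil, PMF.pure_map]
  | fst => simp [lift, sem_seq, sem_fst, sem_snd, PMF.pure_map]
  | snd => simp [lift, sem_seq, sem_snd, PMF.pure_map]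
  | seq f g hf hg =>
    simp only [lift, sem_seq, sem_pair, sem_fst, PMF.pure_bind, hf, PMF.map_bind, PMF.bind_map,
      Function.comp_def, Data.fst_cons, hg]
  | pair f g hf hg =>
    simp only [lift, sem_pair, hf, PMF.map_bind, PMF.bind_map, Function.comp_def, hg,
      PMF.map_comp]
  | ite c f g hc hf hg =>
    simp only [lift, sem_ite, hc, PMF.map_bind, PMF.bind_map, Function.comp_def]
    congr 1
    funext r
    split_ifs
    · exact hg x r.2
    · exact hf x r.2
  | rep f hf =>
    have key : ∀ (k : ℕ) (y : Data) (φ : Tape),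
        iterSem (pair fst f.lift).sem k (Data.cons t y, Tape.put t φ Φ) =
          (iterSem f.sem k (y, φ)).map fun r => (Data.cons t r.1, Tape.put t r.2 Φ) := by
      intro k
      induction k with
      | zero => intro y φ; rw [iterSem, iterSem, PMF.pure_map]
      | succ k ih =>
        intro y φ
        simp only [iterSem, sem_pair, sem_fst, PMF.pure_bind, hf, PMF.map_comp, PMF.bind_map,
          Function.comp_def, Data.fst_cons, ih, PMF.map_bind]
    simp only [lift, sem_seq, sem_pair, sem_fst, sem_snd, PMF.pure_bind, PMF.pure_map,
      Data.fst_cons, Data.snd_cons, sem_rep, key, PMF.bind_map, Function.comp_def]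
    rfl
  | had => simp [lift, sem_had, Tape.had_put, PMF.pure_map]
  | tgate => simp [lift, sem_tgate, Tape.tgate_put, PMF.pure_map]
  | cnot =>
    simp only [lift, sem_seq, sem_pair, sem_fst, sem_snd, sem_cnot, PMF.pure_bind, PMF.pure_map,
      Data.fst_cons, Data.snd_cons, Tape.cnot_put]
  | meas =>
    simp only [lift, sem_meas, Tape.outcome_put hΦ, Tape.proj_put, PMF.map_comp,
      Function.comp_def]

end Prog

/-! ### Running times -/

namespace Data

theorem size_cons (a b : Data) : (cons a b).size = 1 + a.size + b.size := rfl
@[simp] theorem size_nil : nil.size = 0 := rfl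

theorem size_fst_add_size_snd (x : Data) : x.fst.size + x.snd.size ≤ x.size := by
  cases x with
  | nil => simp
  | cons a b => rw [size_cons, fst_cons, snd_cons]; omega

theorem size_fst_le (x : Data) : x.fst.size ≤ x.size := by
  have := x.size_fst_add_size_snd
  omega

theorem size_snd_le (x : Data) : x.snd.size ≤ x.size := by
  have := x.size_fst_add_size_snd
  omega

theorem size_le_fst_snd (x : Data) : x.size ≤ 1 + x.fst.size + x.snd.size := by
  cases x <;> simp [size_cons]

theorem size_ofBool (b : Bool) : (ofBool b).size ≤ 1 := by
  cases b <;> simp [ofBool, size_cons]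

theorem length_le_size_ofList (l : List Data) : l.length ≤ (ofList l).size := by
  induction l with
  | nil => simp
  | cons a l ih => rw [ofList, size_cons, List.length_cons]; omega

theorem size_unary (n : ℕ) : (unary n).size = n := by
  unfold unary
  induction n with
  | zero => rfl
  | succ n ih => rw [List.replicate_succ, ofList, size_cons, ih, size_nil]; omega

theorem unary_injective : Function.Injective unary := fun m n h => by
  rw [← size_unary m, h, size_unary]

theorem unary_succ (n : ℕ) : unary (n + 1) = cons nil (unary n) := rfl

end Data

theorem eval_mono (p : Polynomial ℕ) {m n : ℕ} (h : m ≤ n) : p.eval m ≤ p.eval n := by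
  induction p using Polynomial.induction_on' with
  | add p q hp hq => rw [Polynomial.eval_add, Polynomial.eval_add]; omega
  | monomial k a =>
    rw [Polynomial.eval_monomial, Polynomial.eval_monomial]
    gcongr

namespace Prog

/-- Every instruction is charged for its input, so nothing larger than the running time can be
produced. This is what makes polynomial time bounds compose. -/
theorem size_lt_time {P : Prog} {x : Data} {ψ : Tape} {r : Result}
    (hr : r ∈ (P.run x ψ).support) : 1 + x.size ≤ r.time ∧ r.out.size ≤ r.time := by
  induction P generalizing x ψ r with
  | id | nil | had | tgate | cnot =>
    simp only [run, pmf_pure, PMF.mem_support_pure_iff] at hr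
    subst hr
    simp
  | fst =>
    obtain rfl := mem_run_fst.mp hr
    have := x.size_fst_le
    simp only
    omega
  | snd =>
    obtain rfl := mem_run_snd.mp hr
    have := x.size_snd_le
    simp only
    omega
  | seq f g hf hg =>
    obtain ⟨r₁, h₁, r₂, h₂, rfl⟩ := mem_run_seq.mp hr
    have := hg h₂
    simp only
    omega
  | pair f g hf hg =>
    obtain ⟨r₁, h₁, r₂, h₂, rfl⟩ := mem_run_pair.mp hr
    have := hf h₁
    have := hg h₂
    simp only [Data.size_cons]
    omega
  | ite c f g hc hf hg =>
    obtain ⟨r₁, h₁, r₂, h₂, rfl⟩ := mem_run_ite.mp hr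
    have : r₂.out.size ≤ r₂.time := by
      split_ifs at h₂
      · exact (hg h₂).2
      · exact (hf h₂).2
    simp only
    omega
  | rep f hf =>
    obtain ⟨r₁, h₁, rfl⟩ := mem_run_rep.mp hr
    have key : ∀ (k : ℕ) (y : Data) (φ : Tape),
        ∀ s ∈ (iterRun f.run k y φ).support, s.out.size ≤ y.size + s.time := by
      intro k
      induction k with
      | zero =>
        intro y φ s hs
        rw [mem_iterRun_zero.mp hs]
        simp
      | succ k ih =>
        intro y φ s hs
        obtain ⟨s₁, hs₁, s₂, hs₂, rfl⟩ := mem_iterRun_succ.mp hs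
        have := hf hs₁
        have := ih _ _ s₂ hs₂
        simp only
        omega
    have := key _ _ _ r₁ h₁
    have := x.size_snd_le
    simp only
    omega
  | meas =>
    obtain ⟨b, hb, rfl⟩ := mem_run_meas.mp hr
    have := Data.size_ofBool b
    simp only
    omega

theorem Classical.out_eq {P : Prog} (h : P.Classical) {x : Data} {ψ : Tape} {r : Result}
    (hr : r ∈ (P.run x ψ).support) : r.out = P.value x := by
  have h1 : (r.out, r.tape) ∈ (P.sem x ψ).support :=
    (PMF.mem_support_map_iff _ _ _).mpr ⟨r, hr, rfl⟩
  rw [h.sem, PMF.mem_support_pure_iff] at h1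
  exact congrArg Prod.fst h1

theorem polyTime_of_time_eq {P : Prog}
    (h : ∀ x ψ, ∀ r ∈ (P.run x ψ).support, r.time = 1 + x.size) : P.PolyTime :=
  ⟨1 + Polynomial.X, fun x ψ _ r hr => by simp [h x ψ r hr]⟩

theorem polyTime_id : id.PolyTime := polyTime_of_time_eq fun x ψ r hr => by
  rw [mem_run_id.mp hr]

theorem polyTime_nil : nil.PolyTime := polyTime_of_time_eq fun x ψ r hr => by
  rw [mem_run_nil.mp hr]

theorem polyTime_fst : fst.PolyTime := polyTime_of_time_eq fun x ψ r hr => by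
  rw [mem_run_fst.mp hr]

theorem polyTime_snd : snd.PolyTime := polyTime_of_time_eq fun x ψ r hr => by
  rw [mem_run_snd.mp hr]

theorem PolyTime.seq {f g : Prog} (hf : f.PolyTime) (hg : g.PolyTime) : (seq f g).PolyTime := by
  obtain ⟨p, hp⟩ := hf
  obtain ⟨q, hq⟩ := hg
  -- The input of `g` is an output of `f`, hence of size at most `p`.
  refine ⟨1 + Polynomial.X + p + q.comp p, fun x ψ hψ r hr => ?_⟩
  obtain ⟨r₁, h₁, r₂, h₂, rfl⟩ := mem_run_seq.mp hr
  have e1 := hp x ψ hψ r₁ h₁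
  have e2 := hq _ _ (tape_ne_zero hψ h₁) r₂ h₂
  have e3 := eval_mono q ((size_lt_time h₁).2.trans e1)
  simp only [Polynomial.eval_add, Polynomial.eval_one, Polynomial.eval_X, Polynomial.eval_comp]
  omega

theorem PolyTime.pair {f g : Prog} (hf : f.PolyTime) (hg : g.PolyTime) :
    (pair f g).PolyTime := by
  obtain ⟨p, hp⟩ := hf
  obtain ⟨q, hq⟩ := hg
  refine ⟨1 + Polynomial.X + p + q, fun x ψ hψ r hr => ?_⟩
  obtain ⟨r₁, h₁, r₂, h₂, rfl⟩ := mem_run_pair.mp hr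
  have e1 := hp x ψ hψ r₁ h₁
  have e2 := hq _ _ (tape_ne_zero hψ h₁) r₂ h₂
  simp only [Polynomial.eval_add, Polynomial.eval_one, Polynomial.eval_X]
  omega

theorem PolyTime.ite {c f g : Prog} (hc : c.PolyTime) (hf : f.PolyTime) (hg : g.PolyTime) :
    (ite c f g).PolyTime := by
  obtain ⟨o, ho⟩ := hc
  obtain ⟨p, hp⟩ := hf
  obtain ⟨q, hq⟩ := hg
  refine ⟨1 + Polynomial.X + o + p + q, fun x ψ hψ r hr => ?_⟩
  obtain ⟨r₁, h₁, r₂, h₂, rfl⟩ := mem_run_ite.mp hr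
  have e1 := ho x ψ hψ r₁ h₁
  have h3 := tape_ne_zero hψ h₁
  simp only [Polynomial.eval_add, Polynomial.eval_one, Polynomial.eval_X]
  split_ifs at h₂
  · have e2 := hq _ _ h3 r₂ h₂
    omega
  · have e2 := hp _ _ h3 r₂ h₂
    omega

/-- A loop runs in polynomial time if its body does and the sizes of the intermediate values are
polynomially bounded. -/
theorem PolyTime.rep {f : Prog} (hf : f.PolyTime) (I : Data → ℕ → Data → Prop)
    (q : Polynomial ℕ) (h₀ : ∀ x, I x 0 x.snd)
    (hI : ∀ x k y, k < x.fst.size → I x k y → y.size ≤ q.eval x.size ∧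
      ∀ φ ≠ 0, ∀ r ∈ (f.run y φ).support, I x (k + 1) r.out) : (rep f).PolyTime := by
  obtain ⟨p, hp⟩ := hf
  refine ⟨1 + Polynomial.X + Polynomial.X * p.comp q, fun x ψ hψ r hr => ?_⟩
  obtain ⟨r₁, h₁, rfl⟩ := mem_run_rep.mp hr
  have key : ∀ (k j : ℕ) (y : Data) (φ : Tape), φ ≠ 0 → I x j y → j + k ≤ x.fst.size →
      ∀ s ∈ (iterRun f.run k y φ).support, s.time ≤ k * p.eval (q.eval x.size) := by
    intro k
    induction k with
    | zero =>
      intro j y φ _ _ _ s hs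
      rw [mem_iterRun_zero.mp hs]
      simp
    | succ k ih =>
      intro j y φ hφ hj hjk s hs
      obtain ⟨s₁, hs₁, s₂, hs₂, rfl⟩ := mem_iterRun_succ.mp hs
      obtain ⟨e1, e2⟩ := hI x j y (by omega) hj
      have e3 := ih (j + 1) _ _ (tape_ne_zero hφ hs₁) (e2 φ hφ s₁ hs₁) (by omega) s₂ hs₂
      have e4 := (hp y φ hφ s₁ hs₁).trans (eval_mono p e1)
      simp only
      rw [Nat.succ_mul]
      omega
  have e := key x.fst.size 0 x.snd ψ hψ (h₀ x) (by omega) r₁ h₁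
  have e' : x.fst.size * p.eval (q.eval x.size) ≤ x.size * p.eval (q.eval x.size) :=
    Nat.mul_le_mul_right _ x.size_fst_le
  simp only [Polynomial.eval_add, Polynomial.eval_one, Polynomial.eval_X, Polynomial.eval_mul,
    Polynomial.eval_comp]
  omega

/-- Growth by at most `c` per round, over at most `x.size` rounds, keeps all intermediate values of
linear size. -/
theorem PolyTime.rep_of_size_le {f : Prog} (hf : f.PolyTime) (hc : f.Classical) (c : ℕ)
    (h : ∀ y, (f.value y).size ≤ y.size + c) : (Prog.rep f).PolyTime := by
  refine hf.rep (fun x k y => y.size ≤ x.size + k * c) (Polynomial.X + Polynomial.X *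
    Polynomial.C c) (fun x => by simpa using x.size_snd_le)
    fun x k y hk hy => ⟨?_, fun φ _ r hr => ?_⟩
  · have e : k * c ≤ x.size * c := Nat.mul_le_mul_right c (hk.le.trans x.size_fst_le)
    simp only [Polynomial.eval_add, Polynomial.eval_mul, Polynomial.eval_X, Polynomial.eval_C]
    omega
  · rw [hc.out_eq hr, Nat.succ_mul]
    have := h y
    omega

/-! ### The cost of running a program inside a register -/

theorem one_add_size_cons_le (t x : Data) :
    1 + (Data.cons t x).size ≤ 2 * (1 + t.size) * (1 + x.size) := by
  rw [Data.size_cons]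
  nlinarith [Nat.zero_le (t.size * x.size)]

/-- Runs inside a register project to runs on the slices of the memory. -/
theorem lift_cost_iter {f : Prog} {C : ℕ} (hC : ∀ (t x : Data) (Ψ : Tape),
    ∀ r ∈ (f.lift.run (Data.cons t x) Ψ).support, ∀ u, Tape.slice t u r.tape ≠ 0 →
      Tape.slice t u Ψ ≠ 0 ∧ ∃ r₀ ∈ (f.run x (Tape.slice t u Ψ)).support, r₀.out = r.out ∧
        r₀.tape = Tape.slice t u r.tape ∧ r.time ≤ C * (1 + t.size) * r₀.time)
    (k : ℕ) (t y : Data) (Ψ : Tape) (s : Result)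
    (hs : s ∈ (iterRun (pair fst f.lift).run k (Data.cons t y) Ψ).support) (u : Finset Data)
    (hu : Tape.slice t u s.tape ≠ 0) : Tape.slice t u Ψ ≠ 0 ∧
      ∃ s₀ ∈ (iterRun f.run k y (Tape.slice t u Ψ)).support, Data.cons t s₀.out = s.out ∧
        s₀.tape = Tape.slice t u s.tape ∧ s.time ≤ (4 + C) * (1 + t.size) * s₀.time := by
  induction k generalizing y Ψ s with
  | zero =>
    rw [mem_iterRun_zero] at hs
    subst hs
    exact ⟨hu, _, mem_iterRun_zero.mpr rfl, rfl, rfl, by simp⟩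
  | succ k ih =>
    obtain ⟨r₁, h₁, r₂, h₂, rfl⟩ := mem_iterRun_succ.mp hs
    obtain ⟨r₃, h₃, r₄, h₄, rfl⟩ := mem_run_pair.mp h₁
    obtain rfl := mem_run_fst.mp h₃
    clear hs h₁ h₃
    simp only [Data.fst_cons] at h₂ h₄ ⊢
    obtain ⟨e1, s₂, hs₂, o₂, t₂, c₂⟩ := ih _ _ r₂ h₂ hu
    obtain ⟨e2, s₁, hs₁, o₁, t₁, c₁⟩ := hC t y Ψ r₄ h₄ u e1
    refine ⟨e2, _, mem_iterRun_succ.mpr ⟨s₁, hs₁, s₂, by rwa [o₁, t₁], rfl⟩, o₂, t₂, ?_⟩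
    have hb := one_add_size_cons_le t y
    have hs := (size_lt_time hs₁).1
    simp only
    calc _ ≤ 4 * (1 + t.size) * (1 + y.size) + C * (1 + t.size) * s₁.time +
          (4 + C) * (1 + t.size) * s₂.time := by linarith
      _ ≤ 4 * (1 + t.size) * s₁.time + C * (1 + t.size) * s₁.time +
          (4 + C) * (1 + t.size) * s₂.time := by gcongr
      _ = _ := by ring

/-- The register may be entangled with the rest of the memory, so product states do not suffice
here. Fix a basis state `u` of the other qubits. Gates commute with slicing at `u`, and an outcome
whose slice is nonzero has positive probability on the slice. A run whose final slice is nonzero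
therefore projects to a genuine run of `P`, where nonvanishing is traced backwards from the end of
the run. Carrying the tag `t` costs a factor proportional to `1 + t.size`. -/
theorem lift_cost (P : Prog) : ∃ C : ℕ, ∀ (t x : Data) (Ψ : Tape),
    ∀ r ∈ (P.lift.run (Data.cons t x) Ψ).support, ∀ u, Tape.slice t u r.tape ≠ 0 →
      Tape.slice t u Ψ ≠ 0 ∧ ∃ r₀ ∈ (P.run x (Tape.slice t u Ψ)).support, r₀.out = r.out ∧
        r₀.tape = Tape.slice t u r.tape ∧ r.time ≤ C * (1 + t.size) * r₀.time := by
  have base := one_add_size_cons_le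
  induction P with
  | id =>
    refine ⟨2, fun t x Ψ r hr u hu => ?_⟩
    obtain rfl := mem_run_snd.mp hr
    exact ⟨hu, _, mem_run_id.mpr rfl, rfl, rfl, base t x⟩
  | nil =>
    refine ⟨2, fun t x Ψ r hr u hu => ?_⟩
    obtain rfl := mem_run_nil.mp hr
    exact ⟨hu, _, mem_run_nil.mpr rfl, rfl, rfl, base t x⟩
  | fst =>
    refine ⟨6, fun t x Ψ r hr u hu => ?_⟩
    simp only [lift, run, pmf_pure, pmf_bind, PMF.pure_bind, PMF.mem_support_pure_iff,
      Data.snd_cons] at hr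
    subst hr
    refine ⟨hu, _, mem_run_fst.mpr rfl, rfl, rfl, ?_⟩
    have := base t x
    have : x.size ≤ (Data.cons t x).size := by rw [Data.size_cons]; omega
    simp only
    rw [mul_assoc] at *
    omega
  | snd =>
    refine ⟨6, fun t x Ψ r hr u hu => ?_⟩
    simp only [lift, run, pmf_pure, pmf_bind, PMF.pure_bind, PMF.mem_support_pure_iff,
      Data.snd_cons] at hr
    subst hr
    refine ⟨hu, _, mem_run_snd.mpr rfl, rfl, rfl, ?_⟩
    have := base t x
    have : x.size ≤ (Data.cons t x).size := by rw [Data.size_cons]; omega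
    simp only
    rw [mul_assoc] at *
    omega
  | seq f g hf hg =>
    obtain ⟨C, hC⟩ := hf
    obtain ⟨D, hD⟩ := hg
    refine ⟨6 + C + D, fun t x Ψ r hr u hu => ?_⟩
    obtain ⟨r₁, h₁, r₂, h₂, rfl⟩ := mem_run_seq.mp hr
    obtain ⟨r₃, h₃, r₄, h₄, rfl⟩ := mem_run_pair.mp h₁
    obtain rfl := mem_run_fst.mp h₃
    clear hr h₁ h₃
    simp only [Data.fst_cons] at h₂ h₄ ⊢
    obtain ⟨e1, s₂, hs₂, o₂, t₂, c₂⟩ := hD t _ _ r₂ h₂ u hu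
    obtain ⟨e2, s₁, hs₁, o₁, t₁, c₁⟩ := hC t x Ψ r₄ h₄ u e1
    refine ⟨e2, _, mem_run_seq.mpr ⟨s₁, hs₁, s₂, by rwa [o₁, t₁], rfl⟩, o₂, t₂, ?_⟩
    have hb := base t x
    simp only
    calc _ ≤ 6 * (1 + t.size) * (1 + x.size) + C * (1 + t.size) * s₁.time +
          D * (1 + t.size) * s₂.time := by linarith
      _ ≤ (6 + C + D) * (1 + t.size) * (1 + x.size) + (6 + C + D) * (1 + t.size) * s₁.time +
          (6 + C + D) * (1 + t.size) * s₂.time := by gcongr <;> omega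
      _ = _ := by ring
  | pair f g hf hg =>
    obtain ⟨C, hC⟩ := hf
    obtain ⟨D, hD⟩ := hg
    refine ⟨2 + C + D, fun t x Ψ r hr u hu => ?_⟩
    obtain ⟨r₁, h₁, r₂, h₂, rfl⟩ := mem_run_pair.mp hr
    obtain ⟨e1, s₂, hs₂, o₂, t₂, c₂⟩ := hD t _ _ r₂ h₂ u hu
    obtain ⟨e2, s₁, hs₁, o₁, t₁, c₁⟩ := hC t x Ψ r₁ h₁ u e1
    refine ⟨e2, _, mem_run_pair.mpr ⟨s₁, hs₁, s₂, by rwa [t₁], rfl⟩, by rw [o₁, o₂], t₂, ?_⟩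
    have hb := base t x
    simp only
    calc _ ≤ 2 * (1 + t.size) * (1 + x.size) + C * (1 + t.size) * s₁.time +
          D * (1 + t.size) * s₂.time := by linarith
      _ ≤ (2 + C + D) * (1 + t.size) * (1 + x.size) + (2 + C + D) * (1 + t.size) * s₁.time +
          (2 + C + D) * (1 + t.size) * s₂.time := by gcongr <;> omega
      _ = _ := by ring
  | ite c f g hc hf hg =>
    obtain ⟨B, hB⟩ := hc
    obtain ⟨C, hC⟩ := hf
    obtain ⟨D, hD⟩ := hg
    refine ⟨2 + B + C + D, fun t x Ψ r hr u hu => ?_⟩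
    obtain ⟨r₁, h₁, r₂, h₂, rfl⟩ := mem_run_ite.mp hr
    have key : Tape.slice t u r₁.tape ≠ 0 ∧ ∃ r₀ ∈ ((if r₁.out = Data.nil then g else f).run x
        (Tape.slice t u r₁.tape)).support, r₀.out = r₂.out ∧
        r₀.tape = Tape.slice t u r₂.tape ∧ r₂.time ≤ (C + D) * (1 + t.size) * r₀.time := by
      split_ifs at h₂ ⊢
      · obtain ⟨e1, s₂, hs₂, o₂, t₂, c₂⟩ := hD t _ _ r₂ h₂ u hu
        exact ⟨e1, s₂, hs₂, o₂, t₂, c₂.trans (by gcongr; omega)⟩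
      · obtain ⟨e1, s₂, hs₂, o₂, t₂, c₂⟩ := hC t _ _ r₂ h₂ u hu
        exact ⟨e1, s₂, hs₂, o₂, t₂, c₂.trans (by gcongr; omega)⟩
    obtain ⟨e1, s₂, hs₂, o₂, t₂, c₂⟩ := key
    obtain ⟨e2, s₁, hs₁, o₁, t₁, c₁⟩ := hB t x Ψ r₁ h₁ u e1
    refine ⟨e2, _, mem_run_ite.mpr ⟨s₁, hs₁, s₂, by rwa [o₁, t₁], rfl⟩, o₂, t₂, ?_⟩
    have hb := base t x
    simp only
    calc _ ≤ 2 * (1 + t.size) * (1 + x.size) + B * (1 + t.size) * s₁.time +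
          (C + D) * (1 + t.size) * s₂.time := by linarith
      _ ≤ (2 + B + C + D) * (1 + t.size) * (1 + x.size) +
          (2 + B + C + D) * (1 + t.size) * s₁.time +
          (2 + B + C + D) * (1 + t.size) * s₂.time := by gcongr <;> omega
      _ = _ := by ring
  | rep f hf =>
    obtain ⟨C, hC⟩ := hf
    -- A generous constant for the fixed number of instructions that repack `t`, the counter and the
    -- argument, each of which costs a multiple of the input size.
    refine ⟨60 + C, fun t x Ψ r hr u hu => ?_⟩
    obtain ⟨r₁, h₁, r₂, h₂, rfl⟩ := mem_run_seq.mp hr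
    simp only [run, pmf_pure, pmf_bind, PMF.pure_bind, PMF.mem_support_pure_iff,
      Data.fst_cons, Data.snd_cons] at h₁
    subst h₁
    obtain ⟨r₃, h₃, r₄, h₄, rfl⟩ := mem_run_seq.mp h₂
    obtain rfl := mem_run_snd.mp h₄
    obtain ⟨r₅, h₅, rfl⟩ := mem_run_rep.mp h₃
    clear hr h₂ h₃ h₄
    simp only [Data.fst_cons, Data.snd_cons] at h₅ hu ⊢
    obtain ⟨e2, s₁, hs₁, o₁, t₁, c₁⟩ := lift_cost_iter hC _ t _ Ψ r₅ h₅ u hu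
    refine ⟨e2, _, mem_run_rep.mpr ⟨s₁, hs₁, rfl⟩, by rw [← o₁, Data.snd_cons], t₁, ?_⟩
    -- The lifted loop ends with `snd`, which is charged for the output of the loop.
    have hsz : s₁.out.size ≤ 1 + x.size + s₁.time :=
      (size_lt_time (mem_run_rep.mpr ⟨s₁, hs₁, rfl⟩)).2
    have hb := base t x
    have hx := x.size_fst_add_size_snd
    have ho : r₅.out.size = 1 + t.size + s₁.out.size := by rw [← o₁, Data.size_cons]
    have ht : t.size + s₁.time + 1 ≤ (1 + t.size) * (1 + x.size) + (1 + t.size) * s₁.time := by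
      nlinarith [Nat.zero_le (t.size * x.size), Nat.zero_le (t.size * s₁.time)]
    rw [Data.size_cons, mul_assoc] at hb
    simp only [Data.size_cons, ho]
    calc _ ≤ 40 * ((1 + t.size) * (1 + x.size)) + 40 * ((1 + t.size) * s₁.time) +
          (4 + C) * (1 + t.size) * s₁.time := by omega
      _ = 40 * (1 + t.size) * (1 + x.size) + (44 + C) * (1 + t.size) * s₁.time := by ring
      _ ≤ (60 + C) * (1 + t.size) * (1 + x.size) + (60 + C) * (1 + t.size) * s₁.time := by
          gcongr <;> omega
      _ = _ := by ring
  | had =>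
    refine ⟨2, fun t x Ψ r hr u hu => ?_⟩
    obtain rfl := mem_run_had.mp hr
    refine ⟨fun h => hu ?_, _, mem_run_had.mpr rfl, rfl, (Tape.slice_had _ _ _ _).symm, base t x⟩
    rw [Tape.slice_had, h]
    simp [Tape.had]
  | tgate =>
    refine ⟨2, fun t x Ψ r hr u hu => ?_⟩
    obtain rfl := mem_run_tgate.mp hr
    refine ⟨fun h => hu ?_, _, mem_run_tgate.mpr rfl, rfl, (Tape.slice_tgate _ _ _ _).symm,
      base t x⟩
    rw [Tape.slice_tgate, h]
    simp [Tape.tgate]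
  | cnot =>
    refine ⟨30, fun t x Ψ r hr u hu => ?_⟩
    simp only [lift, run, pmf_pure, pmf_bind, PMF.pure_bind, PMF.mem_support_pure_iff,
      Data.fst_cons, Data.snd_cons] at hr
    subst hr
    refine ⟨fun h => hu ?_, _, mem_run_cnot.mpr rfl, rfl,
      (Tape.slice_cnot _ _ _ _ _).symm, ?_⟩
    · simp only
      rw [Tape.slice_cnot, h]
      simp [Tape.cnot]
    · have hb := base t x
      have hx := x.size_fst_add_size_snd
      simp only [Data.size_cons] at hb ⊢
      rw [mul_assoc] at *
      linarith
  | meas =>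
    refine ⟨2, fun t x Ψ r hr u hu => ?_⟩
    obtain ⟨b, hb, rfl⟩ := mem_run_meas.mp hr
    simp only at hu
    rw [Tape.slice_proj] at hu
    have hne : Tape.slice t u Ψ ≠ 0 := by
      intro h
      rw [h] at hu
      exact hu (Finsupp.filter_zero _)
    refine ⟨hne, _, mem_run_meas.mpr ⟨b, Tape.mem_support_outcome hu, rfl⟩, rfl,
      (Tape.slice_proj _ _ _ _ _).symm, base t x⟩

/-- Only inputs of the form `cons t x` are covered: without a tag, a gate could address the qubit
`nil`, which lies in no register. -/
theorem PolyTime.lift {P : Prog} (hP : P.PolyTime) : ∃ q : Polynomial ℕ, ∀ (t x : Data) (Ψ : Tape),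
    Ψ ≠ 0 → ∀ r ∈ (P.lift.run (Data.cons t x) Ψ).support,
      r.time ≤ q.eval (Data.cons t x).size := by
  obtain ⟨p, hp⟩ := hP
  obtain ⟨C, hC⟩ := lift_cost P
  refine ⟨Polynomial.C C * Polynomial.X * p, fun t x Ψ hΨ r hr => ?_⟩
  -- One surviving slice is enough, because the running time does not depend on the slice.
  obtain ⟨u, hu⟩ := Tape.exists_slice_ne_zero t (tape_ne_zero hΨ hr)
  obtain ⟨h1, r₀, h2, -, -, h3⟩ := hC t x Ψ r hr u hu
  refine h3.trans ?_
  rw [Polynomial.eval_mul, Polynomial.eval_mul, Polynomial.eval_C, Polynomial.eval_X]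
  have h4 := (hp x _ h1 r₀ h2).trans
    (eval_mono p (show x.size ≤ (Data.cons t x).size by rw [Data.size_cons]; omega))
  gcongr
  rw [Data.size_cons]
  omega

/-- Run `P` on the input computed by `a`, inside the register computed by `t`. -/
def sub (t a P : Prog) : Prog := .seq (.pair t a) P.lift

theorem PolyTime.sub {t a P : Prog} (ht : t.PolyTime) (ha : a.PolyTime) (hP : P.PolyTime) :
    (sub t a P).PolyTime := by
  obtain ⟨p, hp⟩ := ht.pair ha
  obtain ⟨q, hq⟩ := hP.lift
  refine ⟨1 + Polynomial.X + p + q.comp p, fun x ψ hψ r hr => ?_⟩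
  obtain ⟨r₁, h₁, r₂, h₂, rfl⟩ := mem_run_seq.mp hr
  have e1 := hp x ψ hψ r₁ h₁
  have e0 := (size_lt_time h₁).2
  have h3 := tape_ne_zero hψ h₁
  obtain ⟨s₁, _, s₂, _, rfl⟩ := mem_run_pair.mp h₁
  have e2 := hq _ _ _ h3 r₂ h₂
  have e3 := eval_mono q (e0.trans e1)
  simp only at e2 e3
  simp only [Polynomial.eval_add, Polynomial.eval_one, Polynomial.eval_X, Polynomial.eval_comp]
  simp only at e1
  omega

end Prog

/-! ### Expectations -/

/-- The expectation of a nonnegative function. -/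
def expect {α : Type} (p : PMF α) (φ : α → ℝ≥0∞) : ℝ≥0∞ := ∑' a, p a * φ a

section expect

variable {α β : Type}

theorem bind_apply_eq_expect (p : PMF α) (f : α → PMF β) (b : β) :
    p.bind f b = expect p fun a => f a b := PMF.bind_apply p f b

theorem expect_pure (a : α) (φ : α → ℝ≥0∞) : expect (PMF.pure a) φ = φ a := by
  unfold expect
  rw [tsum_eq_single a (fun b hb => by rw [PMF.pure_apply, if_neg hb, zero_mul]),
    PMF.pure_apply, if_pos rfl, one_mul]

theorem expect_bind (p : PMF α) (f : α → PMF β) (φ : β → ℝ≥0∞) :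
    expect (p.bind f) φ = expect p fun a => expect (f a) φ := by
  unfold expect
  simp only [PMF.bind_apply, ← ENNReal.tsum_mul_right, ← ENNReal.tsum_mul_left, mul_assoc]
  exact ENNReal.tsum_comm

theorem expect_map (p : PMF α) (f : α → β) (φ : β → ℝ≥0∞) :
    expect (p.map f) φ = expect p fun a => φ (f a) := by
  rw [PMF.map, expect_bind]
  simp only [Function.comp_apply, expect_pure]

theorem expect_mono {p : PMF α} {φ χ : α → ℝ≥0∞} (h : ∀ a ∈ p.support, φ a ≤ χ a) :
    expect p φ ≤ expect p χ :=
  ENNReal.tsum_le_tsum fun a => by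
    by_cases ha : a ∈ p.support
    · gcongr
      exact h a ha
    · rw [PMF.mem_support_iff, not_not] at ha
      simp [ha]

theorem expect_congr {p : PMF α} {φ χ : α → ℝ≥0∞} (h : ∀ a ∈ p.support, φ a = χ a) :
    expect p φ = expect p χ :=
  le_antisymm (expect_mono fun a ha => (h a ha).le) (expect_mono fun a ha => (h a ha).ge)

theorem expect_add (p : PMF α) (φ χ : α → ℝ≥0∞) :
    (expect p fun a => φ a + χ a) = expect p φ + expect p χ := by
  unfold expect
  simp only [mul_add]
  exact ENNReal.tsum_add

theorem expect_const (p : PMF α) (c : ℝ≥0∞) : (expect p fun _ => c) = c := by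
  unfold expect
  rw [ENNReal.tsum_mul_right, p.tsum_coe, one_mul]

theorem expect_sum {ι : Type} (p : PMF α) (s : Finset ι) (φ : ι → α → ℝ≥0∞) :
    (expect p fun a => ∑ i ∈ s, φ i a) = ∑ i ∈ s, expect p (φ i) := by
  classical
  induction s using Finset.induction_on with
  | empty => simp [expect]
  | insert i s hi ih => simp only [Finset.sum_insert hi, expect_add, ih]

/-- Tonelli. It is used to choose the hash key before the parameter of the bit scheme, or after it.
-/
theorem expect_comm (p : PMF α) (q : PMF β) (φ : α → β → ℝ≥0∞) :
    (expect p fun a => expect q fun b => φ a b) = expect q fun b => expect p fun a => φ a b := by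
  unfold expect
  simp only [← ENNReal.tsum_mul_left]
  rw [ENNReal.tsum_comm]
  exact tsum_congr fun b => tsum_congr fun a => by ring

theorem bind_congr_support {p : PMF α} {f g : α → PMF β} (h : ∀ a ∈ p.support, f a = g a) :
    p.bind f = p.bind g := by
  ext b
  rw [bind_apply_eq_expect, bind_apply_eq_expect]
  exact expect_congr fun a ha => by rw [h a ha]

end expect

theorem apply_true_add_apply_false (e : PMF Prop) : e True + e False = 1 := by
  rw [← e.tsum_coe, tsum_fintype, Fintype.sum_Prop]

theorem expect_prop (e : PMF Prop) (φ : Prop → ℝ≥0∞) :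
    expect e φ = e True * φ True + e False * φ False := by
  rw [expect, tsum_fintype, Fintype.sum_Prop]

/-- The indicator of a proposition. -/
def ind (p : Prop) : ℝ≥0∞ := open scoped _root_.Classical in if p then 1 else 0

theorem ind_of {p : Prop} (h : p) : ind p = 1 := if_pos h
theorem ind_of_not {p : Prop} (h : ¬p) : ind p = 0 := if_neg h

theorem ind_mono {p q : Prop} (h : p → q) : ind p ≤ ind q := by
  by_cases hp : p
  · rw [ind_of hp, ind_of (h hp)]
  · rw [ind_of_not hp]
    exact zero_le

theorem map_apply_prop {α : Type} (p : PMF α) (f : α → Prop) (b : Prop) :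
    p.map f b = expect p fun a => ind (f a = b) := by
  rw [PMF.map, bind_apply_eq_expect]
  refine congrArg _ (funext fun a => ?_)
  rw [Function.comp_apply, PMF.pure_apply, ind]
  by_cases h : f a = b
  · rw [if_pos h.symm, if_pos h]
  · rw [if_neg (Ne.symm h), if_neg h]

/-! ### Negligible quantities -/

/-- Negligible functions with values in `[0, ∞]`. -/
def NegE (f : ℕ → ℝ≥0∞) : Prop := (∀ n, f n ≠ ∞) ∧ Negligible fun n => (f n).toReal

theorem negligible_of_abs_le {μ ν : ℕ → ℝ} (h : Negligible ν) (hμ : ∀ n, |μ n| ≤ |ν n|) :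
    Negligible μ := Asymptotics.SuperpolynomialDecay.trans_abs_le h hμ

theorem NegE.mono {f g : ℕ → ℝ≥0∞} (hg : NegE g) (h : ∀ n, f n ≤ g n) : NegE f :=
  ⟨fun n => ne_top_of_le_ne_top (hg.1 n) (h n), negligible_of_abs_le hg.2 fun n => by
    rw [abs_of_nonneg ENNReal.toReal_nonneg, abs_of_nonneg ENNReal.toReal_nonneg]
    exact ENNReal.toReal_mono (hg.1 n) (h n)⟩

theorem NegE.add {f g : ℕ → ℝ≥0∞} (hf : NegE f) (hg : NegE g) : NegE fun n => f n + g n := by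
  refine ⟨fun n => ENNReal.add_ne_top.mpr ⟨hf.1 n, hg.1 n⟩, ?_⟩
  simp only [ENNReal.toReal_add (hf.1 _) (hg.1 _)]
  exact Asymptotics.SuperpolynomialDecay.add hf.2 hg.2

theorem NegE.polynomial_mul {f : ℕ → ℝ≥0∞} (hf : NegE f) (q : Polynomial ℕ) :
    NegE fun n => (q.eval n : ℕ) * f n := by
  refine ⟨fun n => ENNReal.mul_ne_top (ENNReal.natCast_ne_top _) (hf.1 n), ?_⟩
  simp only [ENNReal.toReal_mul, ENNReal.toReal_natCast]
  have := Asymptotics.SuperpolynomialDecay.polynomial_mul hf.2 (q.map (Nat.castRingHom ℝ))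
  simp only [Polynomial.eval_natCast_map, Nat.coe_castRingHom, Nat.cast_id] at this
  exact this

theorem negligible_prob_iff (e : ℕ → PMF Prop) :
    (Negligible fun n => prob (e n)) ↔ NegE fun n => e n True :=
  ⟨fun h => ⟨fun n => (e n).apply_ne_top _, h⟩, fun h => h.2⟩

theorem prob_eq_one_sub (e : PMF Prop) : prob e = 1 - (e False).toReal := by
  have h := congrArg ENNReal.toReal (apply_true_add_apply_false e)
  rw [ENNReal.toReal_add (e.apply_ne_top _) (e.apply_ne_top _), ENNReal.toReal_one] at h
  unfold prob
  linarith

/-- Failure probabilities, unlike success probabilities, can be added in a union bound. Truncation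
at zero makes the error a nonnegative quantity. -/
theorem exists_negligible_iff {ι : Type} (e : ℕ → ι → PMF Prop) :
    (∃ ν : ℕ → ℝ, Negligible ν ∧ ∀ n i, 1 - ν n ≤ prob (e n i)) ↔
      ∃ ε, NegE ε ∧ ∀ n i, e n i False ≤ ε n := by
  constructor
  · rintro ⟨ν, hν, h⟩
    refine ⟨fun n => ENNReal.ofReal (ν n), ⟨fun n => ENNReal.ofReal_ne_top,
      negligible_of_abs_le hν fun n => ?_⟩, fun n i => ?_⟩
    · rw [ENNReal.toReal_ofReal', abs_of_nonneg (le_max_right _ _)]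
      exact max_le (le_abs_self _) (abs_nonneg _)
    · have := h n i
      rw [prob_eq_one_sub] at this
      rw [← ENNReal.ofReal_toReal ((e n i).apply_ne_top False)]
      exact ENNReal.ofReal_le_ofReal (by linarith)
  · rintro ⟨ε, hε, h⟩
    refine ⟨_, hε.2, fun n i => ?_⟩
    rw [prob_eq_one_sub]
    have := ENNReal.toReal_mono (hε.1 n) (h n i)
    linarith

/-! ### Independent families -/

/-- Replace the entries `0, …, N - 1` of the family `v` by independent samples. -/
def prodPMF {α : Type} (D : ℕ → PMF α) (v : ℕ → α) : ℕ → PMF (ℕ → α)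
  | 0 => PMF.pure v
  | k + 1 => (prodPMF D v k).bind fun w => (D k).map fun r => Function.update w k r

/-- The marginals of the product; the union bounds below need nothing else about it. -/
theorem expect_prodPMF {α : Type} (D : ℕ → PMF α) (v : ℕ → α) {N i : ℕ} (hi : i < N)
    (φ : α → ℝ≥0∞) : (expect (prodPMF D v N) fun w => φ (w i)) = expect (D i) φ := by
  induction N with
  | zero => omega
  | succ N ih =>
    rw [prodPMF, expect_bind]
    simp only [expect_map]
    rcases Nat.lt_succ_iff_lt_or_eq.mp hi with h | rfl
    · simp only [Function.update_of_ne h.ne, expect_const]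
      exact ih h
    · simp only [Function.update_self, expect_const]

theorem mem_support_prodPMF {α : Type} {D : ℕ → PMF α} {v w : ℕ → α} {N : ℕ}
    (hw : w ∈ (prodPMF D v N).support) :
    (∀ i < N, w i ∈ (D i).support) ∧ ∀ i, N ≤ i → w i = v i := by
  induction N generalizing w with
  | zero =>
    rw [prodPMF, PMF.mem_support_pure_iff] at hw
    subst hw
    exact ⟨fun i hi => by omega, fun i _ => rfl⟩
  | succ N ih =>
    rw [prodPMF, PMF.mem_support_bind_iff] at hw
    obtain ⟨w', hw', hw⟩ := hw
    rw [PMF.mem_support_map_iff] at hw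
    obtain ⟨r, hr, rfl⟩ := hw
    obtain ⟨h1, h2⟩ := ih hw'
    refine ⟨fun i hi => ?_, fun i hi => ?_⟩
    · rcases Nat.lt_succ_iff_lt_or_eq.mp hi with h | rfl
      · rw [Function.update_of_ne h.ne]
        exact h1 i h
      · rwa [Function.update_self]
    · rw [Function.update_of_ne (by omega)]
      exact h2 i (by omega)

/-! ### Product states of several registers -/

/-- The state in which register `unary i` contains `Ψ i`, for `i < N`. -/
def joint : ℕ → (ℕ → Tape) → Tape
  | 0, _ => Tape.blank
  | N + 1, Ψ => Tape.put (Data.unary N) (Ψ N) (joint N Ψ)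

/-- A blank memory is a product of any number of blank registers. A program that starts on blank
memory may thus be analysed with as many registers as it uses. -/
theorem joint_blank (N : ℕ) : joint N (fun _ => Tape.blank) = Tape.blank := by
  induction N with
  | zero => rfl
  | succ N ih =>
    rw [joint, ih]
    ext s
    rw [Tape.put_apply]
    simp only [Tape.blank, Finsupp.single_apply]
    by_cases hs : s = ∅
    · subst hs
      simp [Tape.part, Tape.rest]
    · rw [if_neg (Ne.symm hs)]
      by_cases hp : ∅ = Tape.part (Data.unary N) s
      · have hr : ∅ ≠ Tape.rest (Data.unary N) s := fun h => hs (by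
          rw [← Tape.join_part (Data.unary N) s, ← hp, Tape.join, ← h]
          simp)
        rw [if_neg hr, mul_zero]
      · rw [if_neg hp, zero_mul]

theorem joint_congr {N : ℕ} {Ψ Ψ' : ℕ → Tape} (h : ∀ i < N, Ψ i = Ψ' i) :
    joint N Ψ = joint N Ψ' := by
  induction N with
  | zero => rfl
  | succ N ih => rw [joint, joint, h N (by omega), ih fun i hi => h i (by omega)]

theorem exists_joint_ne_zero {N : ℕ} {Ψ : ℕ → Tape} (h : ∀ i, Ψ i ≠ 0) :
    ∃ u, joint N Ψ u ≠ 0 ∧ ∀ j, N ≤ j → Tape.rest (Data.unary j) u = u := by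
  induction N with
  | zero => exact ⟨∅, by simp [joint, Tape.blank], fun j _ => rfl⟩
  | succ N ih =>
    obtain ⟨u, hu, hr⟩ := ih
    obtain ⟨v, hv, hv'⟩ := Tape.exists_put_ne_zero (h N) (hr N le_rfl) hu
    exact ⟨v, hv, fun j hj => hv' _ (fun e => by have := Data.unary_injective e; omega)
      (hr j (by omega))⟩

/-- Any factor of a product can be moved to the outside by `put_comm`, and what is left does not
depend on the content of that register. The nonzero amplitude at `u` supplies the nonvanishing
`restWeight` that `sem_lift_put` requires; its blankness in the registers from `N` on keeps the
induction going. -/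
theorem joint_update_aux {N i : ℕ} (hi : i < N) {Ψ : ℕ → Tape} (h : ∀ i, Ψ i ≠ 0) :
    ∃ Φ : Tape, (∃ u, Φ u ≠ 0 ∧ ∀ j, (j = i ∨ N ≤ j) → Tape.rest (Data.unary j) u = u) ∧
      ∀ ψ, joint N (Function.update Ψ i ψ) = Tape.put (Data.unary i) ψ Φ := by
  induction N with
  | zero => omega
  | succ N ih =>
    rcases Nat.lt_succ_iff_lt_or_eq.mp hi with h' | rfl
    · obtain ⟨Φ, ⟨u, hu, hr⟩, hΦ⟩ := ih h'
      obtain ⟨v, hv, hv'⟩ := Tape.exists_put_ne_zero (h N) (hr N (Or.inr le_rfl)) hu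
      refine ⟨Tape.put (Data.unary N) (Ψ N) Φ, ⟨v, hv, fun j hj => hv' _ (fun e => ?_) ?_⟩,
        fun ψ => ?_⟩
      · have := Data.unary_injective e
        omega
      · exact hr j (by omega)
      · rw [joint, hΦ, Function.update_of_ne h'.ne', Tape.put_comm]
        exact fun e => h'.ne' (Data.unary_injective e)
    · obtain ⟨u, hu, hr⟩ := exists_joint_ne_zero (N := i) h
      refine ⟨joint i Ψ, ⟨u, hu, fun j hj => hr j (by omega)⟩, fun ψ => ?_⟩
      rw [joint, Function.update_self]
      congr 1
      exact joint_congr fun j hj => Function.update_of_ne hj.ne _ _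

namespace Prog

/-- From here on the memory can be treated as a family of separate memories, of which a subroutine
changes exactly one. -/
theorem sem_sub {t a : Prog} (P : Prog) (ht : t.Classical) (ha : a.Classical) {x : Data}
    {N i : ℕ} (hi : i < N) (hx : t.value x = Data.unary i) {Ψ : ℕ → Tape} (hΨ : ∀ j, Ψ j ≠ 0) :
    (sub t a P).sem x (joint N Ψ) =
      (P.sem (a.value x) (Ψ i)).map fun r => (r.1, joint N (Function.update Ψ i r.2)) := by
  obtain ⟨Φ, ⟨u, hu, hr⟩, hΦ⟩ := joint_update_aux hi hΨ
  have h0 := hΦ (Ψ i)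
  rw [Function.update_eq_self] at h0
  rw [sub, sem_seq, Classical.sem (P := pair t a) ⟨ht, ha⟩, PMF.pure_bind, value, hx, h0,
    sem_lift_put _ (Tape.restWeight_ne_zero (hr i (Or.inl rfl)) hu)]
  simp only [hΦ]

end Prog

namespace Data

@[simp] theorem sel_nil (x y : Data) : nil.sel x y = y := rfl
@[simp] theorem sel_cons (a b x y : Data) : (cons a b).sel x y = x := rfl

theorem sel_of_ne_nil {d : Data} (h : d ≠ nil) (x y : Data) : d.sel x y = x := by
  cases d with
  | nil => exact absurd rfl h
  | cons => rfl

end Data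

namespace Prog

/-! ### Straight-line classical programs -/

/-- Classical programs without loops. -/
def Simple : Prog → Prop
  | .id | .nil | .fst | .snd => True
  | .seq f g | .pair f g => f.Simple ∧ g.Simple
  | .ite c f g => c.Simple ∧ f.Simple ∧ g.Simple
  | .rep _ | .had | .tgate | .cnot | .meas => False

theorem Simple.classical {P : Prog} (h : P.Simple) : P.Classical := by
  induction P with
  | id | nil | fst | snd => trivial
  | seq f g hf hg => exact ⟨hf h.1, hg h.2⟩
  | pair f g hf hg => exact ⟨hf h.1, hg h.2⟩
  | ite c f g hc hf hg => exact ⟨hc h.1, hf h.2.1, hg h.2.2⟩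
  | rep | had | tgate | cnot | meas => exact h.elim

theorem Simple.polyTime {P : Prog} (h : P.Simple) : P.PolyTime := by
  induction P with
  | id => exact polyTime_id
  | nil => exact polyTime_nil
  | fst => exact polyTime_fst
  | snd => exact polyTime_snd
  | seq f g hf hg => exact (hf h.1).seq (hg h.2)
  | pair f g hf hg => exact (hf h.1).pair (hg h.2)
  | ite c f g hc hf hg => exact (hc h.1).ite (hf h.2.1) (hg h.2.2)
  | rep | had | tgate | cnot | meas => exact h.elim

/-- The program that returns the datum `cons nil nil`. -/
def one : Prog := .pair .nil .nil

/-- The program that returns the `i`-th entry of a list. -/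
def arg : ℕ → Prog
  | 0 => .fst
  | i + 1 => .seq .snd (arg i)

theorem simple_arg (i : ℕ) : (arg i).Simple := by
  induction i with
  | zero => trivial
  | succ i ih => exact ⟨trivial, ih⟩

@[simp] theorem value_arg (i : ℕ) (x : Data) : (arg i).value x = x.nth i := by
  induction i generalizing x with
  | zero => rfl
  | succ i ih => exact ih x.snd

/-- The program that returns the list of the outputs of programs. -/
def list : List Prog → Prog
  | [] => .nil
  | P :: l => .pair P (list l)

/-! ### Tests of all entries of a list -/

/-- One step of `all`. -/
def allStep (T : Prog) : Prog :=
  .ite .fst (.pair (.seq .fst .snd) (.ite (.seq (.seq .fst .fst) T) .snd .nil)) .id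

/-- The program that tests whether `T` accepts all entries of a list. -/
def all (T : Prog) : Prog := .seq (.seq (.pair .id (.pair .id one)) (.rep (allStep T))) .snd

theorem simple_allStep {T : Prog} (hT : T.Simple) : (allStep T).Simple := by
  simp [allStep, Simple, hT]

theorem classical_all {T : Prog} (hT : T.Simple) : (all T).Classical := by
  have h1 : Classical (.pair .id (.pair .id one)) := Simple.classical (by simp [Simple, one])
  exact ⟨⟨h1, (simple_allStep hT).classical⟩, trivial⟩

theorem polyTime_all {T : Prog} (hT : T.Simple) : (all T).PolyTime := by
  have h1 : PolyTime (.pair .id (.pair .id one)) := Simple.polyTime (by simp [Simple, one])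
  have h2 := simple_allStep hT
  refine (h1.seq (h2.polyTime.rep_of_size_le h2.classical 0 ?_)).seq polyTime_snd
  intro y
  simp only [allStep, value]
  rcases y with _ | ⟨_ | ⟨a, b⟩, c⟩
  · simp
  · simp
  · simp only [Data.fst_cons, Data.snd_cons, Data.sel_cons, Data.size_cons]
    cases T.value a
    · simp only [Data.sel_nil, Data.size_nil]
      omega
    · simp only [Data.sel_cons]
      omega

/-- A loop over a list takes the list itself as its counter, whose size can exceed its length; the
surplus rounds happen at a fixed point. -/
theorem iterate_eq_of_fixed {α : Type} {f : α → α} {x : α} {m n : ℕ} (hmn : n ≤ m)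
    (h : f (f^[n] x) = f^[n] x) : f^[m] x = f^[n] x := by
  obtain ⟨k, rfl⟩ := Nat.exists_eq_add_of_le' hmn
  rw [Function.iterate_add_apply, Function.iterate_fixed h]

/-- The second component of the loop variable is a flag, which is cleared at the first rejected
entry and never set again. -/
theorem all_iterate (T : Prog) (l : List Data) (d : Data) :
    ∃ e, (allStep T).value^[l.length] (Data.cons (Data.ofList l) d) = Data.cons Data.nil e ∧
      (e ≠ Data.nil ↔ d ≠ Data.nil ∧ ∀ a ∈ l, T.value a ≠ Data.nil) := by
  induction l generalizing d with
  | nil => exact ⟨d, rfl, by simp⟩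
  | cons a l ih =>
    obtain ⟨e, h1, h2⟩ := ih ((T.value a).sel d Data.nil)
    refine ⟨e, ?_, ?_⟩
    · rw [List.length_cons, Function.iterate_succ_apply, ← h1]
      rfl
    · rw [h2, List.forall_mem_cons]
      cases T.value a <;> simp

theorem value_all (T : Prog) (l : List Data) :
    (all T).value (Data.ofList l) ≠ Data.nil ↔ ∀ a ∈ l, T.value a ≠ Data.nil := by
  obtain ⟨e, h1, h2⟩ := all_iterate T l (Data.cons Data.nil Data.nil)
  have h3 : (allStep T).value^[(Data.ofList l).size]
      (Data.cons (Data.ofList l) (Data.cons Data.nil Data.nil)) = Data.cons Data.nil e := by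
    rw [← h1]
    refine iterate_eq_of_fixed (Data.length_le_size_ofList l) ?_
    rw [h1]
    rfl
  simp only [all, value, one, Data.fst_cons, Data.snd_cons, h3, h2]
  simp

/-- The program that tests whether a datum encodes a bit. -/
def bitTest : Prog := .ite .id (.ite .fst .nil (.ite .snd .nil one)) one

theorem simple_bitTest : bitTest.Simple := by simp [bitTest, one, Simple]

theorem value_bitTest (d : Data) : bitTest.value d ≠ Data.nil ↔ ∃ b, Data.ofBool b = d := by
  rcases d with _ | ⟨_ | _, _ | _⟩ <;> simp [bitTest, one, value, Data.ofBool]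

theorem _root_.DSR.Data.exists_ofList (d : Data) : ∃ l, Data.ofList l = d := by
  induction d with
  | nil => exact ⟨[], rfl⟩
  | cons a b _ hb =>
    obtain ⟨l, rfl⟩ := hb
    exact ⟨a :: l, rfl⟩

theorem value_all_bitTest (d : Data) :
    (all bitTest).value d ≠ Data.nil ↔ ∃ l, Data.ofBits l = d := by
  obtain ⟨l, rfl⟩ := d.exists_ofList
  simp only [value_all, value_bitTest, Data.ofBits, Data.ofList_injective.eq_iff]
  constructor
  · intro h
    induction l with
    | nil => exact ⟨[], rfl⟩
    | cons a l ih =>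
      obtain ⟨b, rfl⟩ := h a (by simp)
      obtain ⟨l', rfl⟩ := ih fun a ha => h a (by simp [ha])
      exact ⟨b :: l', rfl⟩
  · rintro ⟨l', rfl⟩ a ha
    obtain ⟨b, _, rfl⟩ := List.mem_map.mp ha
    exact ⟨b, rfl⟩

/-! ### Splitting a list of pairs -/

/-- One step of `unzip`. -/
def unzipStep : Prog :=
  .ite .fst (.pair (.seq .fst .snd) (.pair
    (.pair (.seq .fst (.seq .fst .fst)) (.seq .snd .fst))
    (.pair (.seq .fst (.seq .fst .snd)) (.seq .snd .snd)))) .id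

/-- The program that reverses a list of pairs and splits it into the lists of the first and the
second components. -/
def unzip : Prog := .seq (.seq (.pair .id (.pair .id one)) (.rep unzipStep)) .snd

theorem simple_unzipStep : unzipStep.Simple := by simp [unzipStep, Simple]

theorem classical_unzip : unzip.Classical := by
  have h1 : Classical (.pair .id (.pair .id one)) := Simple.classical (by simp [Simple, one])
  exact ⟨⟨h1, simple_unzipStep.classical⟩, trivial⟩

theorem polyTime_unzip : unzip.PolyTime := by
  have h1 : PolyTime (.pair .id (.pair .id one)) := Simple.polyTime (by simp [Simple, one])
  refine (h1.seq (simple_unzipStep.polyTime.rep_of_size_le simple_unzipStep.classical 4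
    fun y => ?_)).seq polyTime_snd
  simp only [unzipStep, value]
  rcases y with _ | ⟨_ | ⟨a, b⟩, c⟩
  · simp
  · simp [Data.size_cons]
  · have h1 := a.size_fst_add_size_snd
    have h3 := c.size_fst_add_size_snd
    simp [Data.size_cons]
    omega

/-- The accumulators are arbitrary for the sake of the induction. Entries are pushed one by one, so
the order is reversed; this undoes the reversal caused by `gather`. -/
theorem unzip_iterate (l f s : List Data) :
    unzipStep.value^[l.length]
        (Data.cons (Data.ofList l) (Data.cons (Data.ofList f) (Data.ofList s))) =
      Data.cons Data.nil (Data.cons (Data.ofList ((l.map Data.fst).reverse ++ f))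
        (Data.ofList ((l.map Data.snd).reverse ++ s))) := by
  induction l generalizing f s with
  | nil => rfl
  | cons a l ih =>
    have h := ih (a.fst :: f) (a.snd :: s)
    rw [List.length_cons, Function.iterate_succ_apply]
    simp only [List.map_cons, List.reverse_cons, List.append_assoc, List.singleton_append]
    rw [← h]
    simp [unzipStep, value, Data.ofList]

theorem value_unzip (l : List Data) :
    unzip.value (Data.ofList l.reverse) =
      Data.cons (Data.ofList (l.map Data.fst)) (Data.ofList (l.map Data.snd)) := by
  have h1 := unzip_iterate l.reverse [] []
  have h3 : unzipStep.value^[(Data.ofList l.reverse).size]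
      (Data.cons (Data.ofList l.reverse) (Data.cons Data.nil Data.nil)) = _ :=
    (iterate_eq_of_fixed (Data.length_le_size_ofList _) (by erw [h1]; rfl)).trans h1
  simp only [unzip, value, one, Data.fst_cons, Data.snd_cons, h3]
  simp

/-! ### Loops over lists -/

/-- As long as `c` holds of the first component of a pair, replace that component by its image
under `nx`, and put the output of `f` on top of the second component. -/
def gather (c nx f : Prog) : Prog :=
  .ite (.seq .fst c) (.pair (.seq .fst nx) (.pair (.seq .fst f) .snd)) .id

/-- The outputs of `f` are only stored and never read again in the loop. The inputs of `f` thus grow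
only by a constant per round, and so every stored output is polynomially bounded. -/
theorem polyTime_rep_gather {c nx f : Prog} (hc : c.PolyTime) (hn : nx.PolyTime)
    (hf : f.PolyTime) (hnc : nx.Classical)
    (hs : ∀ y, (nx.value y).size ≤ y.size + 5) : (rep (gather c nx f)).PolyTime := by
  have hg : (gather c nx f).PolyTime := (polyTime_fst.seq hc).ite
    ((polyTime_fst.seq hn).pair ((polyTime_fst.seq hf).pair polyTime_snd)) polyTime_id
  obtain ⟨p, hp⟩ := hf
  -- Since there are at most `x.size` rounds, the first component stays below `6 * x.size`; each
  -- round stores one new node and one output of `f`.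
  refine hg.rep (fun x k y => y.fst.size ≤ x.size + 5 * k ∧
      y.snd.size ≤ x.size + k * (1 + p.eval (6 * x.size)))
    (1 + 7 * Polynomial.X + Polynomial.X * (1 + p.comp (6 * Polynomial.X)))
    (fun x => ?_) fun x k y hk ⟨h1, h2⟩ => ⟨?_, fun φ hφ r hr => ?_⟩
  · have e1 := x.size_snd_le
    have e2 := x.snd.size_fst_add_size_snd
    constructor <;> omega
  · have e1 := x.size_fst_le
    have e2 := y.size_le_fst_snd
    have e3 : k * (1 + p.eval (6 * x.size)) ≤ x.size * (1 + p.eval (6 * x.size)) :=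
      Nat.mul_le_mul_right _ (by omega)
    simp only [Polynomial.eval_add, Polynomial.eval_mul, Polynomial.eval_one, Polynomial.eval_X,
      Polynomial.eval_comp, Polynomial.eval_ofNat]
    omega
  · obtain ⟨r₁, hr₁, r₂, hr₂, rfl⟩ := mem_run_ite.mp hr
    have e1 := x.size_fst_le
    split_ifs at hr₂
    · obtain rfl := mem_run_id.mp hr₂
      refine ⟨by simp only; omega, h2.trans ?_⟩
      gcongr
      omega
    · have hφ₁ := tape_ne_zero hφ hr₁
      obtain ⟨s₁, hs₁, s₂, hs₂, rfl⟩ := mem_run_pair.mp hr₂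
      obtain ⟨s₃, hs₃, s₄, hs₄, rfl⟩ := mem_run_pair.mp hs₂
      obtain rfl := mem_run_snd.mp hs₄
      obtain ⟨s₅, hs₅, s₆, hs₆, rfl⟩ := mem_run_seq.mp hs₃
      obtain rfl := mem_run_fst.mp hs₅
      have hφ₂ := tape_ne_zero hφ₁ hs₁
      have e2 := hp _ _ hφ₂ _ hs₆
      have e3 := (size_lt_time hs₆).2
      have e4 := eval_mono p (show y.fst.size ≤ 6 * x.size by omega)
      have e5 : s₁.out = nx.value y.fst :=
        Classical.out_eq (P := seq fst nx) ⟨trivial, hnc⟩ hs₁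
      have e6 := hs y.fst
      simp only [Data.fst_cons, Data.snd_cons, Data.size_cons] at *
      rw [e5]
      refine ⟨by omega, ?_⟩
      rw [Nat.add_mul k 1]
      omega

/-- The condition of the loop of `forEach`: the first list is not empty. -/
def hasNext : Prog := .seq .snd (.seq .snd .fst)

/-- Increase the index and remove the heads of the three lists. -/
def next : Prog :=
  .pair (.pair .nil .fst) (.pair (.seq .snd .fst) (.pair (.seq .snd (.seq .snd (.seq .fst .snd)))
    (.pair (.seq .snd (.seq .snd (.seq .snd (.seq .fst .snd))))
      (.seq .snd (.seq .snd (.seq .snd (.seq .snd .snd)))))))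

/-- The loop of `forEach`. -/
def forEachStep (a P : Prog) : Prog := gather hasNext next (sub .fst a P)

/-- On input `cons ctx (cons l₁ (cons l₂ l₃))` with lists `lᵢ`, run `P` in register `i` on the input
that `a` computes from the index `i`, the datum `ctx` and the remaining parts of the three lists,
for `i < length l₁`. The outputs, which should be pairs, are returned as two lists. -/
def forEach (a P : Prog) : Prog :=
  .seq (.seq (.pair (.seq .snd .fst) (.pair (.pair .nil .id) .nil)) (.rep (forEachStep a P)))
    (.seq .snd unzip)

theorem polyTime_forEach {a P : Prog} (ha : a.Simple) (hP : P.PolyTime) :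
    (forEach a P).PolyTime := by
  have h1 : PolyTime (.pair (.seq .snd .fst) (.pair (.pair .nil .id) .nil)) :=
    Simple.polyTime (by simp [Simple])
  have h2 : hasNext.Simple := by simp [hasNext, Simple]
  have h3 : next.Simple := by simp [next, Simple]
  refine (h1.seq (polyTime_rep_gather h2.polyTime h3.polyTime (polyTime_fst.sub ha.polyTime hP)
    h3.classical fun y => ?_)).seq (polyTime_snd.seq polyTime_unzip)
  -- The growth by 5 occurs only for malformed values: `next` builds five nodes even from `nil`.
  rcases y with _ | ⟨i, _ | ⟨ctx, _ | ⟨l₁, _ | ⟨l₂, l₃⟩⟩⟩⟩ <;>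
    simp only [next, value, Data.fst_cons, Data.snd_cons, Data.fst_nil, Data.snd_nil,
      Data.size_cons, Data.size_nil]
  · omega
  · omega
  · omega
  · have := l₁.size_snd_le
    omega
  · have := l₁.size_snd_le
    have := l₂.size_snd_le
    have := l₃.size_snd_le
    omega

/-- The value of the loop variable of `forEach` before round `i`. -/
def slot (ctx : Data) (l₁ : List Data) (l₂ l₃ : Data) (i : ℕ) : Data :=
  Data.cons (Data.unary i) (Data.cons ctx (Data.cons (Data.ofList (l₁.drop i))
    (Data.cons (Data.snd^[i] l₂) (Data.snd^[i] l₃))))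

theorem value_next_slot (ctx : Data) (l₁ : List Data) (l₂ l₃ : Data) (i : ℕ) :
    next.value (slot ctx l₁ l₂ l₃ i) = slot ctx l₁ l₂ l₃ (i + 1) := by
  have h : (Data.ofList (l₁.drop i)).snd = Data.ofList (l₁.drop (i + 1)) := by
    rw [← List.drop_drop]
    cases l₁.drop i <;> rfl
  simp only [next, slot, value, Data.fst_cons, Data.snd_cons, h, Function.iterate_succ_apply',
    Data.unary_succ]

theorem sem_forEachStep {a : Prog} (P : Prog) (ha : a.Simple) {ctx : Data} {l₁ : List Data}
    {l₂ l₃ acc : Data} {i : ℕ} (hi : i < l₁.length) {Ψ : ℕ → Tape} (hΨ : ∀ j, Ψ j ≠ 0) :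
    (forEachStep a P).sem (Data.cons (slot ctx l₁ l₂ l₃ i) acc) (joint l₁.length Ψ) =
      (P.sem (a.value (slot ctx l₁ l₂ l₃ i)) (Ψ i)).map fun r =>
        (Data.cons (slot ctx l₁ l₂ l₃ (i + 1)) (Data.cons r.1 acc),
          joint l₁.length (Function.update Ψ i r.2)) := by
  have h1 : Classical (.seq .fst hasNext) := Simple.classical (by simp [Simple, hasNext])
  have h2 : Classical (.seq .fst next) := Simple.classical (by simp [Simple, next])
  have h3 : value (.seq .fst hasNext) (Data.cons (slot ctx l₁ l₂ l₃ i) acc) ≠ Data.nil := by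
    simp only [value, hasNext, slot, Data.fst_cons, Data.snd_cons]
    rw [List.drop_eq_getElem_cons hi]
    exact Data.noConfusion
  simp only [forEachStep, gather, sem_ite, h1.sem, PMF.pure_bind, h3, if_false, sem_pair, h2.sem,
    sem_seq, sem_fst, sem_snd, Data.fst_cons, Data.snd_cons, PMF.pure_map]
  rw [sem_sub (i := i) P (show Classical .fst from trivial) ha.classical hi rfl hΨ]
  simp only [PMF.map_bind, PMF.bind_map, Function.comp_def, value, Data.fst_cons,
    value_next_slot, PMF.pure_map]
  rfl

/-- Round `i` touches register `i` only, so after `k` rounds the outputs and memories are `k`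
independent samples and the other registers are as at the start. -/
theorem iterSem_forEachStep {a : Prog} (P : Prog) (ha : a.Simple) {ctx : Data}
    {l₁ : List Data} {l₂ l₃ : Data} {Ψ : ℕ → Tape} (hΨ : ∀ j, Ψ j ≠ 0) {k : ℕ}
    (hk : k ≤ l₁.length) :
    iterSem (forEachStep a P).sem k
        (Data.cons (slot ctx l₁ l₂ l₃ 0) Data.nil, joint l₁.length Ψ) =
      (prodPMF (fun i => P.sem (a.value (slot ctx l₁ l₂ l₃ i)) (Ψ i))
        (fun j => (Data.nil, Ψ j)) k).map fun w =>
          (Data.cons (slot ctx l₁ l₂ l₃ k)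
            (Data.ofList ((List.range k).map fun i => (w i).1).reverse),
            joint l₁.length fun j => (w j).2) := by
  induction k with
  | zero => simp [iterSem, prodPMF, PMF.pure_map, Data.ofList]
  | succ k ih =>
    rw [iterSem_add _ k 1, ih (by omega), prodPMF, PMF.map_bind, PMF.bind_map]
    refine bind_congr_support fun w hw => ?_
    obtain ⟨hw1, hw2⟩ := mem_support_prodPMF hw
    have hne : ∀ j, (w j).2 ≠ 0 := fun j => by
      by_cases hj : j < k
      · exact sem_ne_zero (hΨ j) (hw1 j hj)
      · rw [hw2 j (by omega)]
        exact hΨ j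
    -- No earlier round has touched register `k`, so the law of this round does not depend on the
    -- earlier samples.
    have hk2 : (w k).2 = Ψ k := by rw [hw2 k le_rfl]
    have hone : ∀ (F : Data → Tape → PMF (Data × Tape)) p, iterSem F 1 p = F p.1 p.2 := by
      intro F p
      simp only [iterSem]
      exact PMF.bind_pure _
    simp only [Function.comp_apply, hone]
    rw [sem_forEachStep P ha (by omega) hne, hk2, PMF.map_comp]
    congr 1
    funext r
    have e1 : ((List.range (k + 1)).map fun i => (Function.update w k r i).1).reverse =
        r.1 :: ((List.range k).map fun i => (w i).1).reverse := by
      rw [List.range_succ, List.map_append, List.reverse_append]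
      simp only [List.map_cons, List.map_nil, Function.update_self, List.reverse_singleton,
        List.singleton_append, List.cons.injEq, true_and]
      congr 1
      refine List.map_congr_left fun i hi => ?_
      rw [Function.update_of_ne (List.mem_range.mp hi).ne]
    have e2 : (fun j => (Function.update w k r j).2) =
        Function.update (fun j => (w j).2) k r.2 := by
      funext j
      by_cases hj : j = k
      · subst hj; simp
      · simp [hj]
    simp only [Function.comp_apply, e1, e2, Data.ofList]

/-- The outputs of the rounds of `forEach` are independent. -/
theorem sem_forEach {a : Prog} (P : Prog) (ha : a.Simple) (ctx : Data) (l₁ : List Data)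
    (l₂ l₃ : Data) {Ψ : ℕ → Tape} (hΨ : ∀ j, Ψ j ≠ 0) :
    (forEach a P).sem (Data.cons ctx (Data.cons (Data.ofList l₁) (Data.cons l₂ l₃)))
        (joint l₁.length Ψ) =
      (prodPMF (fun i => P.sem (a.value (slot ctx l₁ l₂ l₃ i)) (Ψ i))
        (fun j => (Data.nil, Ψ j)) l₁.length).map fun w =>
          (Data.cons (Data.ofList ((List.range l₁.length).map fun i => (w i).1.fst))
            (Data.ofList ((List.range l₁.length).map fun i => (w i).1.snd)),
            joint l₁.length fun j => (w j).2) := by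
  have h1 : Classical (.pair (.seq .snd .fst) (.pair (.pair .nil .id) .nil)) :=
    Simple.classical (by simp [Simple])
  have h3 : Classical (.seq .fst hasNext) := Simple.classical (by simp [Simple, hasNext])
  obtain ⟨j, hj⟩ := Nat.exists_eq_add_of_le (Data.length_le_size_ofList l₁)
  -- The counter is the size of the encoded list. In the `j` rounds beyond its length the list is
  -- used up and nothing changes.
  have hfix : ∀ acc Φ, iterSem (forEachStep a P).sem j
      (Data.cons (slot ctx l₁ l₂ l₃ l₁.length) acc, Φ) =
        PMF.pure (Data.cons (slot ctx l₁ l₂ l₃ l₁.length) acc, Φ) := by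
    intro acc Φ
    clear hj
    induction j with
    | zero => rfl
    | succ j ih =>
      have hs : (forEachStep a P).sem (Data.cons (slot ctx l₁ l₂ l₃ l₁.length) acc) Φ =
          PMF.pure (Data.cons (slot ctx l₁ l₂ l₃ l₁.length) acc, Φ) := by
        simp only [forEachStep, gather, sem_ite, h3.sem, PMF.pure_bind]
        rw [if_pos, sem_id]
        simp [value, hasNext, slot, Data.ofList]
      rw [iterSem, hs, PMF.pure_bind, ih]
  have hstart : Data.cons Data.nil (Data.cons ctx (Data.cons (Data.ofList l₁)
      (Data.cons l₂ l₃))) = slot ctx l₁ l₂ l₃ 0 := rfl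
  simp only [forEach, sem_seq, h1.sem, PMF.pure_bind, sem_rep, value, Data.fst_cons,
    Data.snd_cons, hj, iterSem_add, hstart, iterSem_forEachStep P ha hΨ le_rfl]
  simp only [PMF.bind_map, Function.comp_def, hfix, PMF.bind_bind, PMF.pure_bind, sem_snd,
    classical_unzip.sem, Data.snd_cons, value_unzip, List.map_map]
  rfl

end Prog

/-! ### Sequences of subroutines in separate registers -/

theorem update_ne_zero {Ψ : ℕ → Tape} (hΨ : ∀ j, Ψ j ≠ 0) {ψ : Tape} (hψ : ψ ≠ 0) (i j : ℕ) :
    Function.update Ψ i ψ j ≠ 0 := by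
  by_cases h : j = i
  · subst h
    rwa [Function.update_self]
  · rw [Function.update_of_ne h]
    exact hΨ j

namespace Prog

/-- Put the output of a program on top of its input. -/
def push (f : Prog) : Prog := .pair f .id

theorem expect_seq (f g : Prog) (x : Data) (ψ : Tape) (φ : Data × Tape → ℝ≥0∞) :
    expect ((seq f g).sem x ψ) φ = expect (f.sem x ψ) fun r => expect (g.sem r.1 r.2) φ := by
  rw [sem_seq, expect_bind]

theorem sem_push (f : Prog) (x : Data) (ψ : Tape) :
    (push f).sem x ψ = (f.sem x ψ).map fun r => (Data.cons r.1 x, r.2) := by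
  rw [push, sem_pair]
  simp only [sem_id, PMF.pure_map]
  rfl

theorem sem_push_sub {t a : Prog} (P : Prog) (ht : t.Classical) (ha : a.Classical) {x : Data}
    {N i : ℕ} (hi : i < N) (hx : t.value x = Data.unary i) {Ψ : ℕ → Tape} (hΨ : ∀ j, Ψ j ≠ 0) :
    (push (sub t a P)).sem x (joint N Ψ) =
      (P.sem (a.value x) (Ψ i)).map fun r =>
        (Data.cons r.1 x, joint N (Function.update Ψ i r.2)) := by
  rw [push, sem_pair, sem_sub P ht ha hi hx hΨ, PMF.bind_map]
  simp only [Function.comp_def, sem_id, PMF.pure_map]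
  rfl

theorem expect_seq_push_sub {t a : Prog} (P Q : Prog) (ht : t.Classical) (ha : a.Simple)
    {x y : Data} {N i : ℕ} (hi : i < N) (hx : t.value x = Data.unary i) (hy : a.value x = y)
    {Ψ : ℕ → Tape} (hΨ : ∀ j, Ψ j ≠ 0) (φ : Data × Tape → ℝ≥0∞) :
    expect ((seq (push (sub t a P)) Q).sem x (joint N Ψ)) φ = expect (P.sem y (Ψ i)) fun r =>
      expect (Q.sem (Data.cons r.1 x) (joint N (Function.update Ψ i r.2))) φ := by
  rw [expect_seq, sem_push_sub P ht ha.classical hi hx hΨ, expect_map, hy]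

end Prog

/-! ### Algorithms as programs, and decoding of messages -/

theorem QPT.run_eq_sem (A : QPT) (x : Data) (ψ : Tape) : A.run x ψ = A.prog.sem x ψ := rfl

theorem QPT.output_eq_map_sem (A : QPT) (x : Data) :
    A.output x = (A.prog.sem x Tape.blank).map Prod.fst := by
  rw [Prog.sem, PMF.map_comp]
  rfl

theorem decMsg_enc {M : Type} [MessageSpace M] (m : M) : decMsg M (MessageSpace.enc m) = some m :=
  Function.partialInv_left MessageSpace.enc_injective m

theorem enc_of_decMsg_eq_some {M : Type} [MessageSpace M] {d : Data} {m : M}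
    (h : decMsg M d = some m) : MessageSpace.enc m = d :=
  (MessageSpace.enc_injective.isPartialInv m d).mp h

theorem decSet_enc {M : Type} [MessageSpace M] (S : List M) : decSet M (encSet S) = some S :=
  Function.partialInv_left encSet_injective S

theorem encSet_of_decSet_eq_some {M : Type} [MessageSpace M] {d : Data} {S : List M}
    (h : decSet M d = some S) : encSet S = d :=
  (encSet_injective.isPartialInv S d).mp h

namespace Scheme

variable {M : Type} [MessageSpace M] (Sch : Scheme M)

/-! ### Success probabilities as expectations -/

/-- Sign a message, if there is one. -/
def signOpt (n : ℕ) (pp : Data) (k : SigningKey) : Option M → PMF (SigningKey × Data)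
  | none => PMF.pure (k, Data.nil)
  | some m => Sch.Sign n pp k m

/-- The probability that deletion fails for given keys. -/
def delFail (n : ℕ) (ck pp : Data) (k : SigningKey) (vk : Data) (o : Option M) : ℝ≥0∞ :=
  expect (Sch.signOpt n pp k o) fun r => expect (Sch.Del n r.1) fun c =>
    Sch.Cert n pp vk ck c o.toList False

theorem correctExp_apply (n : ℕ) (m : M) (b : Prop) :
    Sch.correctExp n m b = expect (Sch.Setup n) fun s => expect (Sch.KeyGen n s.2) fun k =>
      expect (Sch.Sign n s.2 k.1 m) fun r => Sch.Ver n s.2 k.2 m r.2 b := by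
  refine (bind_apply_eq_expect _ _ _).trans (congrArg _ (funext fun s => ?_))
  refine (bind_apply_eq_expect _ _ _).trans (congrArg _ (funext fun k => ?_))
  exact bind_apply_eq_expect _ _ _

theorem deletionExp_apply_false (n : ℕ) (o : Option M) :
    Sch.deletionExp n o False = expect (Sch.Setup n) fun s => expect (Sch.KeyGen n s.2) fun k =>
      Sch.delFail n s.1 s.2 k.1 k.2 o := by
  refine (bind_apply_eq_expect _ _ _).trans (congrArg _ (funext fun s => ?_))
  refine (bind_apply_eq_expect _ _ _).trans (congrArg _ (funext fun k => ?_))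
  cases o with
  | none =>
    refine (bind_apply_eq_expect _ _ _).trans ?_
    rw [delFail, signOpt, expect_pure, pmf_pure, expect_pure]
    exact bind_apply_eq_expect _ _ _
  | some m =>
    refine (bind_apply_eq_expect _ _ _).trans ?_
    rw [delFail, signOpt, expect_map]
    exact congrArg _ (funext fun r => bind_apply_eq_expect _ _ _)

/-- The probability that a forger wins when its output is `out`, after the query `o`. -/
def forgeVal (n : ℕ) (pp vk : Data) (o : Option M) (out : Data) : ℝ≥0∞ :=
  match decMsg M (out.nth 0) with
  | none => 0
  | some m' => open Classical in
      if o ≠ some m' then Sch.Ver n pp vk m' (out.nth 1) True else 0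

theorem forgeExp_apply_true (A₁ A₂ : QPT) (n : ℕ) :
    Sch.forgeExp A₁ A₂ n True = expect (Sch.Setup n) fun s => expect (Sch.KeyGen n s.2) fun k =>
      expect (A₁.run (Data.ofList [Data.unary n, k.2]) Tape.blank) fun q =>
        expect (Sch.signOpt n s.2 k.1 (decMsg M (q.1.nth 0))) fun r =>
          expect (A₂.run (Data.ofList [Data.unary n, q.1.nth 1, r.2]) q.2) fun out =>
            Sch.forgeVal n s.2 k.2 (decMsg M (q.1.nth 0)) out.1 := by
  have key : ∀ (pp vk : Data) (o : Option M) (x : Data) (ψ : Tape),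
      ((A₂.run x ψ).bind fun r => match r with
        | (out, _) => match decMsg M (out.nth 0) with
          | none => (pure False : PMF Prop)
          | some m' => (Sch.Ver n pp vk m' (out.nth 1)).bind fun v =>
              (pure (v ∧ o ≠ some m') : PMF Prop)) True =
        expect (A₂.run x ψ) fun out => Sch.forgeVal n pp vk o out.1 := by
    intro pp vk o x ψ
    refine (bind_apply_eq_expect _ _ _).trans (congrArg _ (funext fun r => ?_))
    obtain ⟨out, φ⟩ := r
    simp only [forgeVal]
    cases decMsg M (out.nth 0) with
    | none => simp [pmf_pure]
    | some m' =>
      simp only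
      rw [bind_apply_eq_expect, expect_prop]
      by_cases h : o = some m' <;> simp [h, pmf_pure]
  refine (bind_apply_eq_expect _ _ _).trans (congrArg _ (funext fun s => ?_))
  refine (bind_apply_eq_expect _ _ _).trans (congrArg _ (funext fun k => ?_))
  refine (bind_apply_eq_expect _ _ _).trans (congrArg _ (funext fun q => ?_))
  obtain ⟨q, ψ⟩ := q
  simp only
  cases decMsg M (q.nth 0) with
  | none =>
    refine (bind_apply_eq_expect _ _ _).trans ?_
    rw [pmf_pure, expect_pure, signOpt, expect_pure]
    exact key _ _ _ _ _
  | some m =>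
    refine (bind_apply_eq_expect _ _ _).trans ?_
    rw [signOpt, expect_map]
    exact congrArg _ (funext fun r => key _ _ _ _ _)

/-- The probability that an adversary against deletion security wins when its output is `out`. -/
def revokeVal (n : ℕ) (ck pp out : Data) : ℝ≥0∞ :=
  match decSet M (out.nth 2), decMsg M (out.nth 3) with
  | some S, some m' => open Classical in
      if S.length ≤ 1 ∧ m' ∉ S then Sch.Cert n pp (out.nth 0) ck (out.nth 1) S True *
        Sch.Ver n pp (out.nth 0) m' (out.nth 4) True else 0
  | _, _ => 0

theorem revokeExp_apply_true (A : QPT) (n : ℕ) :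
    Sch.revokeExp A n True = expect (Sch.Setup n) fun s =>
      expect (A.output (Data.ofList [Data.unary n, s.2])) fun out =>
        Sch.revokeVal n s.1 s.2 out := by
  refine (bind_apply_eq_expect _ _ _).trans (congrArg _ (funext fun s => ?_))
  refine (bind_apply_eq_expect _ _ _).trans (congrArg _ (funext fun out => ?_))
  obtain ⟨ck, pp⟩ := s
  simp only [revokeVal]
  cases decSet M (out.nth 2) with
  | none => simp [pmf_pure]
  | some S =>
    cases decMsg M (out.nth 3) with
    | none => simp [pmf_pure]
    | some m' =>
      simp only [pmf_bind]
      rw [bind_apply_eq_expect, expect_prop, bind_apply_eq_expect, bind_apply_eq_expect,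
        expect_prop, expect_prop]
      by_cases h : S.length ≤ 1 <;> by_cases h' : m' ∈ S <;> simp [h, h', pmf_pure]

/-! ### Unforgeability from the security of deletion -/

/-- Deletion works with overwhelming probability even if the message depends on the keys. -/
def RobustDeletion : Prop :=
  ∃ ε, NegE ε ∧ ∀ n, (expect (Sch.Setup n) fun s => expect (Sch.KeyGen n s.2) fun k =>
    ⨆ o, Sch.delFail n s.1 s.2 k.1 k.2 o) ≤ ε n

theorem RobustDeletion.deletionCorrect {Sch : Scheme M} (h : Sch.RobustDeletion) :
    Sch.OneTimeDeletionCorrect := by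
  obtain ⟨ε, hε, h⟩ := h
  refine (exists_negligible_iff _).mpr ⟨ε, hε, fun n o => le_trans ?_ (h n)⟩
  rw [deletionExp_apply_false]
  exact expect_mono fun s _ => expect_mono fun k _ =>
    le_iSup (fun o => Sch.delFail n s.1 s.2 k.1 k.2 o) o

open Prog in
/-- Generate keys, run a forger, delete the signing key, and output the certificate together with
the forgery. The program `T` tests whether a datum encodes a message. -/
def forgerToRevoker (T : Prog) (A₁ A₂ : QPT) : Prog :=
  .seq (push (sub .nil (list [arg 0, arg 1]) Sch.keyGen.prog)) <|
  .seq (push (sub one (list [arg 1, .seq (arg 0) .snd]) A₁.prog)) <|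
  .seq (push (.ite (.seq (.seq (arg 0) (arg 0)) T)
    (.seq (sub .nil (list [arg 2, arg 3, .seq (arg 1) .fst, .seq (arg 0) (arg 0)]) Sch.sign.prog)
      (.pair .fst .snd))
    (.pair (.seq (arg 1) .fst) .nil))) <|
  .seq (push (sub .nil (list [arg 3, .seq (arg 0) .fst]) Sch.del.prog)) <|
  .seq (push (sub one (list [arg 4, .seq (arg 2) (arg 1), .seq (arg 1) .snd]) A₂.prog)) <|
  list [.seq (arg 4) .snd, arg 1,
    .ite (.seq (.seq (arg 3) (arg 0)) T) (list [.seq (arg 3) (arg 0)]) .nil,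
    .seq (arg 0) (arg 0), .seq (arg 0) (arg 1)]

open Prog in
theorem polyTime_forgerToRevoker {T : Prog} (hT : T.PolyTime) (A₁ A₂ : QPT) :
    (Sch.forgerToRevoker T A₁ A₂).PolyTime := by
  have hp : ∀ {f : Prog}, f.PolyTime → (push f).PolyTime := fun h => h.pair polyTime_id
  have hs : ∀ i j, (Prog.seq (arg i) (arg j)).Simple := fun i j => ⟨simple_arg i, simple_arg j⟩
  refine (hp ((Simple.polyTime ?_).sub (Simple.polyTime ?_) Sch.keyGen.polyTime)).seq <|
    (hp ((Simple.polyTime ?_).sub (Simple.polyTime ?_) A₁.polyTime)).seq <|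
    (hp (((Simple.polyTime (hs 0 0)).seq hT).ite
      (((Simple.polyTime ?_).sub (Simple.polyTime ?_) Sch.sign.polyTime).seq (Simple.polyTime ?_))
      (Simple.polyTime ?_))).seq <|
    (hp ((Simple.polyTime ?_).sub (Simple.polyTime ?_) Sch.del.polyTime)).seq <|
    (hp ((Simple.polyTime ?_).sub (Simple.polyTime ?_) A₂.polyTime)).seq <|
    (Simple.polyTime ?_).pair <| (Simple.polyTime ?_).pair <|
    (((Simple.polyTime (hs 3 0)).seq hT).ite (Simple.polyTime ?_) polyTime_nil).pair
    (Simple.polyTime ?_)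
  all_goals simp [Simple, one, list, simple_arg]

theorem signOpt_ne_zero {n : ℕ} {pp : Data} {k : SigningKey} {o : Option M} (hk : k.2 ≠ 0)
    {r : SigningKey × Data} (hr : r ∈ (Sch.signOpt n pp k o).support) : r.1.2 ≠ 0 := by
  cases o with
  | none =>
    rw [signOpt, PMF.mem_support_pure_iff] at hr
    rwa [hr]
  | some m =>
    rw [signOpt, Sign, PMF.mem_support_map_iff] at hr
    obtain ⟨s, hs, rfl⟩ := hr
    exact Prog.sem_ne_zero (r := s) hk hs

theorem value_eq_nil {T : Prog}
    (hTM : ∀ d, T.value d ≠ Data.nil ↔ ∃ m : M, MessageSpace.enc m = d) {d : Data}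
    (hd : decMsg M d = none) : T.value d = Data.nil := by
  by_contra h
  obtain ⟨m, hm⟩ := (hTM _).mp h
  rw [← hm, decMsg_enc] at hd
  exact Option.some_ne_none m hd

open Prog in
-- The test `T` decides whether a query was made, in agreement with `decMsg`; so the simulated
-- oracle is exactly `signOpt`.
theorem sem_signIte {T : Prog} (hT : T.Classical)
    (hTM : ∀ d, T.value d ≠ Data.nil ↔ ∃ m : M, MessageSpace.enc m = d) {n : ℕ}
    {pp k q : Data} {Ψ : ℕ → Tape} (hΨ : ∀ j, Ψ j ≠ 0) :
    (Prog.ite (.seq (.seq (arg 0) (arg 0)) T)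
      (.seq (sub .nil (list [arg 2, arg 3, .seq (arg 1) .fst, .seq (arg 0) (arg 0)])
        Sch.sign.prog) (.pair .fst .snd)) (.pair (.seq (arg 1) .fst) .nil)).sem
        (Data.cons q (Data.cons k (Data.ofList [Data.unary n, pp]))) (joint 2 Ψ) =
      (Sch.signOpt n pp (k.fst, Ψ 0) (decMsg M (q.nth 0))).map fun r =>
        (Data.cons r.1.1 r.2, joint 2 (Function.update Ψ 0 r.1.2)) := by
  have hc : Classical (.seq (.seq (arg 0) (arg 0)) T) :=
    ⟨⟨(simple_arg 0).classical, (simple_arg 0).classical⟩, hT⟩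
  have hv : value (.seq (.seq (arg 0) (arg 0)) T)
      (Data.cons q (Data.cons k (Data.ofList [Data.unary n, pp]))) = T.value (q.nth 0) := rfl
  have hf : Classical (.pair .fst .snd) := ⟨trivial, trivial⟩
  have hg : Classical (.pair (.seq (arg 1) .fst) .nil) :=
    Simple.classical (by simp [Simple, simple_arg])
  have hnil : Prog.nil.Classical := trivial
  have ha : Classical (list [arg 2, arg 3, .seq (arg 1) .fst, .seq (arg 0) (arg 0)]) :=
    Simple.classical (by simp [Simple, list, simple_arg])
  rw [sem_ite, hc.sem, PMF.pure_bind, hv]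
  cases hd : decMsg M (q.nth 0) with
  | none =>
    rw [if_pos (value_eq_nil hTM hd), signOpt, PMF.pure_map, hg.sem, Function.update_eq_self]
    rfl
  | some m =>
    have hm := enc_of_decMsg_eq_some hd
    rw [if_neg ((hTM _).mpr ⟨m, hm⟩), signOpt, sem_seq,
      sem_sub (i := 0) _ hnil ha (by norm_num) rfl hΨ, PMF.bind_map]
    simp only [Function.comp_def, hf.sem]
    rw [Sign, PMF.map_comp, hm]
    rfl

theorem sel_decMsg {T : Prog}
    (hTM : ∀ d, T.value d ≠ Data.nil ↔ ∃ m : M, MessageSpace.enc m = d) (d : Data) :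
    (T.value d).sel (Data.cons d Data.nil) Data.nil = encSet (decMsg M d).toList := by
  cases hd : decMsg M d with
  | none =>
    rw [value_eq_nil hTM hd]
    rfl
  | some m =>
    have hm := enc_of_decMsg_eq_some hd
    rw [Data.sel_of_ne_nil ((hTM _).mpr ⟨m, hm⟩), ← hm]
    rfl

open Prog in
-- The signing key lives in register `unary 0` and the memory of the forger in register `unary 1`.
-- All classical outputs are piled up, so `arg i` counts back from the latest one. The honest
-- deletion may precede the second half of the forger because the two act on different registers.
theorem expect_forgerToRevoker {T : Prog} (hT : T.Classical)
    (hTM : ∀ d, T.value d ≠ Data.nil ↔ ∃ m : M, MessageSpace.enc m = d) (A₁ A₂ : QPT) (n : ℕ)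
    (pp : Data) (φ : Data → ℝ≥0∞) :
    (expect ((Sch.forgerToRevoker T A₁ A₂).sem (Data.ofList [Data.unary n, pp]) Tape.blank)
        fun r => φ r.1) =
      expect (Sch.KeyGen n pp) fun k =>
        expect (A₁.run (Data.ofList [Data.unary n, k.2]) Tape.blank) fun q =>
          expect (Sch.signOpt n pp k.1 (decMsg M (q.1.nth 0))) fun r =>
            expect (Sch.Del n r.1) fun c =>
              expect (A₂.run (Data.ofList [Data.unary n, q.1.nth 1, r.2]) q.2) fun out =>
                φ (Data.ofList [k.2, c, encSet (decMsg M (q.1.nth 0)).toList,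
                  out.1.nth 0, out.1.nth 1]) := by
  have h1 : one.Classical := ⟨trivial, trivial⟩
  have hnil : Prog.nil.Classical := trivial
  have hb : ∀ j : ℕ, (fun _ : ℕ => Tape.blank) j ≠ 0 := fun _ => Tape.blank_ne_zero
  simp only [KeyGen, Del, QPT.run_eq_sem, expect_map]
  conv_lhs => rw [← joint_blank 2]
  rw [forgerToRevoker, expect_seq_push_sub (i := 0) _ _ hnil
    (by simp [Simple, list, simple_arg]) (by norm_num) rfl rfl hb]
  refine expect_congr fun k hk => ?_
  have hk0 := update_ne_zero hb (sem_ne_zero Tape.blank_ne_zero hk) 0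
  rw [expect_seq_push_sub (i := 1) _ _ h1
    (by simp [Simple, list, simple_arg]) (by norm_num) rfl rfl hk0]
  refine expect_congr fun q hq => ?_
  have hq0 := update_ne_zero hk0 (sem_ne_zero (hk0 1) hq) 1
  have hsign := Sch.sem_signIte hT hTM (n := n) (pp := pp) (k := k.1) (q := q.1) hq0
  rw [expect_seq, sem_push, hsign, PMF.map_comp, expect_map]
  refine expect_congr fun r hr => ?_
  have hr0 := update_ne_zero hq0 (Sch.signOpt_ne_zero (by exact hq0 0) hr) 0
  rw [Function.comp_apply, expect_seq_push_sub (i := 0) _ _ hnil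
    (by simp [Simple, list, simple_arg]) (by norm_num) rfl rfl hr0]
  refine expect_congr fun c hc => ?_
  have hc0 := update_ne_zero hr0 (sem_ne_zero (hr0 0) hc) 0
  rw [expect_seq_push_sub (i := 1) _ _ h1
    (by simp [Simple, list, simple_arg]) (by norm_num) rfl rfl hc0]
  refine expect_congr fun out _ => ?_
  have hcl : Classical (list [.seq (arg 4) .snd, arg 1,
      .ite (.seq (.seq (arg 3) (arg 0)) T) (list [.seq (arg 3) (arg 0)]) .nil,
      .seq (arg 0) (arg 0), .seq (arg 0) (arg 1)]) := by
    simp [list, Classical, hT, (simple_arg _).classical]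
  rw [hcl.sem, expect_pure]
  congr 1
  simp only [list, value, value_arg]
  rw [← sel_decMsg hTM]
  rfl

/-- Split according to whether the certificate is accepted, which is independent of the verification
of the forgery. An accepted certificate makes the forgery a win against deletion; a rejected one is
a failure of deletion. -/
theorem forgeVal_le (n : ℕ) (ck pp vk c : Data) (o : Option M) (out : Data) :
    Sch.forgeVal n pp vk o out ≤ Sch.revokeVal n ck pp
      (Data.ofList [vk, c, encSet o.toList, out.nth 0, out.nth 1]) +
        Sch.Cert n pp vk ck c o.toList False := by
  have h2 : (Data.ofList [vk, c, encSet o.toList, out.nth 0, out.nth 1]).nth 2 =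
      encSet o.toList := rfl
  have h3 : (Data.ofList [vk, c, encSet o.toList, out.nth 0, out.nth 1]).nth 3 =
      out.nth 0 := rfl
  rw [forgeVal, revokeVal, h2, h3, decSet_enc]
  cases decMsg M (out.nth 0) with
  | none => exact zero_le
  | some m' =>
    simp only
    by_cases h : o = some m'
    · rw [if_neg (by simp [h])]
      exact zero_le
    · have hS : o.toList.length ≤ 1 ∧ m' ∉ o.toList := by
        cases o with
        | none => simp
        | some m => simpa [eq_comm] using h
      rw [if_pos h, if_pos hS]
      have hv : Sch.Ver n pp vk m' (out.nth 1) True ≤ 1 := PMF.coe_le_one _ _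
      calc Sch.Ver n pp vk m' (out.nth 1) True
          = (Sch.Cert n pp vk ck c o.toList True + Sch.Cert n pp vk ck c o.toList False) *
            Sch.Ver n pp vk m' (out.nth 1) True := by rw [apply_true_add_apply_false, one_mul]
        _ ≤ _ := by
          rw [add_mul]
          exact add_le_add le_rfl (mul_le_of_le_one_right' hv)

/-- If deletion works with overwhelming probability for every message, then a forger breaks the
security of deletion. -/
theorem RobustDeletion.unforgeable {Sch : Scheme M} (hrob : Sch.RobustDeletion)
    (hsec : Sch.OneTimeDeletionSecure) {T : Prog} (hT : T.Classical) (hTp : T.PolyTime)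
    (hTM : ∀ d, T.value d ≠ Data.nil ↔ ∃ m : M, MessageSpace.enc m = d) :
    Sch.OneTimeUnforgeable := by
  intro A₁ A₂
  obtain ⟨ε, hε, hrob⟩ := hrob
  have hB := (negligible_prob_iff _).mp (hsec ⟨_, Sch.polyTime_forgerToRevoker hTp A₁ A₂⟩)
  refine (negligible_prob_iff _).mpr ((hB.add hε).mono fun n => ?_)
  refine le_trans ?_ (add_le_add le_rfl (hrob n))
  rw [forgeExp_apply_true, revokeExp_apply_true, ← expect_add]
  refine expect_mono fun s _ => ?_
  rw [QPT.output_eq_map_sem, expect_map, Sch.expect_forgerToRevoker hT hTM, ← expect_add]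
  refine expect_mono fun k _ => ?_
  rw [← expect_const (A₁.run (Data.ofList [Data.unary n, k.2]) Tape.blank)
    (⨆ o, Sch.delFail n s.1 s.2 k.1 k.2 o), ← expect_add]
  refine expect_mono fun q _ => ?_
  -- The query depends on `vk`. This is the place that needs the supremum in `RobustDeletion`.
  refine le_trans ?_ (add_le_add le_rfl (le_iSup _ (decMsg M (q.1.nth 0))))
  rw [delFail, ← expect_add]
  refine expect_mono fun r _ => ?_
  rw [← expect_add, ← expect_const (Sch.Del n r.1) (expect (A₂.run _ _) _)]
  refine expect_mono fun c _ => ?_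
  rw [← expect_const (A₂.run (Data.ofList [Data.unary n, q.1.nth 1, r.2]) q.2)
    (Sch.Cert n s.2 k.2 s.1 c _ False), ← expect_add]
  exact expect_mono fun out _ => Sch.forgeVal_le n s.1 s.2 k.2 c _ out.1

end Scheme

/-! ### Families of data as lists -/

namespace Data

/-- The list of the first `N` members of a family. -/
def pack (N : ℕ) (f : ℕ → Data) : Data := ofList ((List.range N).map f)

theorem nth_eq (i : ℕ) (x : Data) : x.nth i = (snd^[i] x).fst := by
  induction i generalizing x with
  | zero => rfl
  | succ i ih => exact ih x.snd

theorem iterate_snd_ofList (i : ℕ) (l : List Data) : snd^[i] (ofList l) = ofList (l.drop i) := by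
  induction i generalizing l with
  | zero => rfl
  | succ i ih =>
    rw [Function.iterate_succ_apply]
    cases l with
    | nil =>
      have := ih []
      rw [List.drop_nil] at this ⊢
      exact this
    | cons a l => exact ih l

theorem fst_ofList_drop {N i : ℕ} (hi : i < N) (f : ℕ → Data) :
    (ofList (((List.range N).map f).drop i)).fst = f i := by
  rw [List.drop_eq_getElem_cons (by simpa using hi)]
  simp [ofList]

theorem nth_pack {N i : ℕ} (hi : i < N) (f : ℕ → Data) : (pack N f).nth i = f i := by
  rw [nth_eq, pack, iterate_snd_ofList, fst_ofList_drop hi]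

theorem pack_eq_ofList (l : List Data) : ofList l = pack l.length fun i => l.getD i nil := by
  congr 1
  refine List.ext_getElem (by simp) fun i h1 h2 => ?_
  simp [h1]

theorem pack_congr {N : ℕ} {f g : ℕ → Data} (h : ∀ i < N, f i = g i) : pack N f = pack N g :=
  congrArg ofList (List.map_congr_left fun i hi => h i (List.mem_range.mp hi))

end Data

theorem prodPMF_congr {α : Type} {D D' : ℕ → PMF α} {v : ℕ → α} {N : ℕ}
    (h : ∀ i < N, D i = D' i) : prodPMF D v N = prodPMF D' v N := by
  induction N with
  | zero => rfl
  | succ N ih => rw [prodPMF, prodPMF, ih fun i hi => h i (by omega), h N (by omega)]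

namespace Prog

/-! ### Access to the loop variable of `forEach` -/

/-- The `i`-th entry of the context. -/
def ctxArg (i : ℕ) : Prog := .seq (.seq .snd .fst) (arg i)
/-- The head of the first list. -/
def head₁ : Prog := .seq .snd (.seq .snd (.seq .fst .fst))
/-- The head of the second list. -/
def head₂ : Prog := .seq .snd (.seq .snd (.seq .snd (.seq .fst .fst)))
/-- The head of the third list. -/
def head₃ : Prog := .seq .snd (.seq .snd (.seq .snd (.seq .snd .fst)))

theorem simple_ctxArg (i : ℕ) : (ctxArg i).Simple := ⟨⟨trivial, trivial⟩, simple_arg i⟩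
theorem simple_head₁ : head₁.Simple := by simp [head₁, Simple]
theorem simple_head₂ : head₂.Simple := by simp [head₂, Simple]
theorem simple_head₃ : head₃.Simple := by simp [head₃, Simple]

section slot

variable (ctx l₂ l₃ : Data) (f : ℕ → Data) {N i : ℕ}

theorem value_ctxArg (l₁ : List Data) (j : ℕ) :
    (ctxArg j).value (slot ctx l₁ l₂ l₃ i) = ctx.nth j := value_arg j ctx

theorem value_head₁ (hi : i < N) :
    head₁.value (slot ctx ((List.range N).map f) l₂ l₃ i) = f i :=
  Data.fst_ofList_drop hi f

theorem value_head₂ (l₁ : List Data) : head₂.value (slot ctx l₁ l₂ l₃ i) = l₂.nth i :=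
  (Data.nth_eq i l₂).symm

theorem value_head₃ (l₁ : List Data) : head₃.value (slot ctx l₁ l₂ l₃ i) = l₃.nth i :=
  (Data.nth_eq i l₃).symm

end slot

theorem expect_forEach {a : Prog} (P : Prog) (ha : a.Simple) (ctx l₂ l₃ : Data)
    (f : ℕ → Data) {N : ℕ} {Ψ : ℕ → Tape} (hΨ : ∀ j, Ψ j ≠ 0) (y : ℕ → Data)
    (hy : ∀ i < N, a.value (slot ctx ((List.range N).map f) l₂ l₃ i) = y i)
    (φ : Data × Tape → ℝ≥0∞) :
    expect ((forEach a P).sem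
        (Data.cons ctx (Data.cons (Data.pack N f) (Data.cons l₂ l₃))) (joint N Ψ)) φ =
      expect (prodPMF (fun i => P.sem (y i) (Ψ i)) (fun j => (Data.nil, Ψ j)) N) fun w =>
        φ (Data.cons (Data.pack N fun i => (w i).1.fst) (Data.pack N fun i => (w i).1.snd),
          joint N fun j => (w j).2) := by
  have hN : ((List.range N).map f).length = N := by simp
  have h := sem_forEach P ha ctx ((List.range N).map f) l₂ l₃ hΨ
  rw [hN] at h
  rw [Data.pack, h, expect_map]
  refine congrArg (fun p => expect p _) (prodPMF_congr fun i hi => ?_)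
  rw [hy i hi]

/-! ### Programs that accept if all rounds of a loop accept -/

/-- The event that a program, started with a blank memory, does not return `nil`. -/
def accept (P : Prog) (x : Data) : PMF Prop := (P.sem x Tape.blank).map fun r => r.1 ≠ Data.nil

theorem accept_apply (P : Prog) (x : Data) (b : Prop) :
    accept P x b = expect (P.sem x Tape.blank) fun r => ind ((r.1 ≠ Data.nil) = b) :=
  map_apply_prop _ _ _

/-- Prepare lists, run `Q` for the entries of the lists, and accept if all these runs do. -/
def conj (prep a Q : Prog) : Prog :=
  .seq (.seq prep (forEach a (.pair Q .nil))) (.seq .fst (all .id))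

theorem polyTime_conj {prep a Q : Prog} (hp : prep.PolyTime) (ha : a.Simple) (hQ : Q.PolyTime) :
    (conj prep a Q).PolyTime :=
  (hp.seq (polyTime_forEach ha (hQ.pair polyTime_nil))).seq
    (polyTime_fst.seq (polyTime_all trivial))

theorem accept_conj_apply {prep a Q : Prog} (hp : prep.Classical) (ha : a.Simple)
    {x ctx l₂ l₃ : Data} {f : ℕ → Data} {N : ℕ}
    (hx : prep.value x = Data.cons ctx (Data.cons (Data.pack N f) (Data.cons l₂ l₃)))
    {y : ℕ → Data} (hy : ∀ i < N, a.value (slot ctx ((List.range N).map f) l₂ l₃ i) = y i)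
    (b : Prop) :
    accept (conj prep a Q) x b = expect (prodPMF (fun i => (pair Q nil).sem (y i) Tape.blank)
      (fun _ => (Data.nil, Tape.blank)) N) fun w =>
        ind ((∀ i < N, (w i).1.fst ≠ Data.nil) = b) := by
  have hc : Classical (.seq .fst (all .id)) := ⟨trivial, classical_all trivial⟩
  rw [accept_apply, conj, expect_seq, expect_seq, hp.sem, expect_pure, hx]
  conv_lhs => rw [← joint_blank N]
  rw [expect_forEach _ ha ctx l₂ l₃ f (fun _ => Tape.blank_ne_zero) y hy]
  refine congrArg _ (funext fun w => ?_)
  rw [hc.sem, expect_pure]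
  simp only [value, Data.fst_cons, Data.pack, value_all]
  simp

theorem expect_sem_pair_nil (Q : Prog) (x : Data) (ψ : Tape) (φ : Data → ℝ≥0∞) :
    (expect ((pair Q nil).sem x ψ) fun r => φ r.1.fst) = expect (Q.sem x ψ) fun r => φ r.1 := by
  rw [sem_pair, expect_bind]
  simp only [sem_nil, PMF.pure_map, expect_pure, Data.fst_cons]

/-- A single check, seen as a marginal of all checks. This puts it on the same probability space as
the conjunction. -/
theorem accept_eq_expect_prodPMF (Q : Prog) (y : ℕ → Data) {N i : ℕ} (hi : i < N) (b : Prop) :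
    accept Q (y i) b = expect (prodPMF (fun i => (pair Q nil).sem (y i) Tape.blank)
      (fun _ => (Data.nil, Tape.blank)) N) fun w => ind (((w i).1.fst ≠ Data.nil) = b) := by
  rw [accept_apply]
  exact (expect_sem_pair_nil Q (y i) Tape.blank fun d => ind ((d ≠ Data.nil) = b)).symm.trans
    (expect_prodPMF (fun i => (pair Q nil).sem (y i) Tape.blank) _ hi
      fun r : Data × Tape => ind ((r.1.fst ≠ Data.nil) = b)).symm

theorem accept_conj_true_le {prep a Q : Prog} (hp : prep.Classical) (ha : a.Simple)
    {x ctx l₂ l₃ : Data} {f : ℕ → Data} {N : ℕ}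
    (hx : prep.value x = Data.cons ctx (Data.cons (Data.pack N f) (Data.cons l₂ l₃)))
    {y : ℕ → Data} (hy : ∀ i < N, a.value (slot ctx ((List.range N).map f) l₂ l₃ i) = y i)
    {i : ℕ} (hi : i < N) : accept (conj prep a Q) x True ≤ accept Q (y i) True := by
  rw [accept_conj_apply hp ha hx hy, accept_eq_expect_prodPMF Q y hi]
  refine expect_mono fun w _ => ind_mono fun h => ?_
  rw [eq_iff_iff, iff_true] at h ⊢
  exact h i hi

/-- Union bound: if the conjunction rejects, some round does. -/
theorem accept_conj_false_le {prep a Q : Prog} (hp : prep.Classical) (ha : a.Simple)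
    {x ctx l₂ l₃ : Data} {f : ℕ → Data} {N : ℕ}
    (hx : prep.value x = Data.cons ctx (Data.cons (Data.pack N f) (Data.cons l₂ l₃)))
    {y : ℕ → Data} (hy : ∀ i < N, a.value (slot ctx ((List.range N).map f) l₂ l₃ i) = y i) :
    accept (conj prep a Q) x False ≤ ∑ i ∈ Finset.range N, accept Q (y i) False := by
  rw [accept_conj_apply hp ha hx hy, Finset.sum_congr rfl fun i hi =>
    accept_eq_expect_prodPMF Q y (Finset.mem_range.mp hi) False, ← expect_sum]
  refine expect_mono fun w _ => ?_
  by_cases h : (∀ i < N, (w i).1.fst ≠ Data.nil) = False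
  · have h' := h
    simp only [eq_iff_iff, iff_false, not_forall] at h'
    obtain ⟨i, hi, h'⟩ := h'
    refine le_trans ?_ (Finset.single_le_sum (fun i _ => zero_le) (Finset.mem_range.mpr hi))
    exact ind_mono fun _ => by rwa [eq_iff_iff, iff_false]
  · rw [ind_of_not h]
    exact zero_le

end Prog

/-! ### Verification and certification as acceptance of programs -/

theorem Scheme.Ver_eq_accept {M : Type} [MessageSpace M] (Sch : Scheme M) (n : ℕ)
    (pp vk : Data) (m : M) (σ : Data) : Sch.Ver n pp vk m σ =
      Sch.ver.prog.accept (Data.ofList [Data.unary n, pp, vk, MessageSpace.enc m, σ]) := by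
  rw [Ver, QPT.output_eq_map_sem, PMF.map_comp]
  rfl

theorem Scheme.Cert_eq_accept {M : Type} [MessageSpace M] (Sch : Scheme M) (n : ℕ)
    (pp vk ck c : Data) (S : List M) : Sch.Cert n pp vk ck c S =
      Sch.cert.prog.accept (Data.ofList [Data.unary n, pp, vk, ck, c, encSet S]) := by
  rw [Cert, QPT.output_eq_map_sem, PMF.map_comp]
  rfl

/-! ### Hash values as lists of bits -/

namespace HashFamily

variable (F : HashFamily)

/-- The number of bits that are signed in place of a message. -/
def width (n : ℕ) : ℕ := F.len n + 1

/-- The bits that are signed in place of a message: a constant bit and the bits of the hash value.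
The constant bit ensures that there is at least one bit. -/
def bit (n : ℕ) (s : Data) (m : List Bool) (i : ℕ) : Bool := (false :: F.hash n s m).getD i false

/-- The program that computes the bits of a message. -/
def bits : Prog := .pair .nil F.eval

variable {F} {n : ℕ} {s : Data}

theorem value_eval (hs : s ∈ (F.gen.output (Data.unary n)).support) (m : List Bool) :
    F.eval.value (Data.ofList [Data.unary n, s, Data.ofBits m]) = Data.ofBits (F.hash n s m) := by
  have h1 := F.eval_eq n s hs m
  have h2 := congrArg (PMF.map Prod.fst) (F.classical.sem
    (Data.ofList [Data.unary n, s, Data.ofBits m]) Tape.blank)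
  rw [Prog.sem, PMF.map_comp, PMF.pure_map] at h2
  have h3 := h2.symm.trans h1
  have h4 := congrArg PMF.support h3
  rw [pmf_pure, PMF.support_pure, PMF.support_pure] at h4
  exact Set.singleton_injective h4

theorem value_bits (hs : s ∈ (F.gen.output (Data.unary n)).support) (m : List Bool) :
    F.bits.value (Data.ofList [Data.unary n, s, Data.ofBits m]) =
      Data.pack (F.width n) fun i => Data.ofBool (F.bit n s m i) := by
  have h : F.bits.value (Data.ofList [Data.unary n, s, Data.ofBits m]) =
      Data.ofList ((false :: F.hash n s m).map Data.ofBool) :=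
    congrArg (Data.cons Data.nil) (value_eval hs m)
  rw [h, Data.pack_eq_ofList, List.length_map, List.length_cons, F.length_eq n s hs m]
  refine Data.pack_congr fun i _ => ?_
  exact List.getD_map (l := false :: F.hash n s m) (d := false) (n := i) (f := Data.ofBool)

theorem hash_eq_of_bit_eq (hs : s ∈ (F.gen.output (Data.unary n)).support) {m m' : List Bool}
    (h : ∀ i < F.width n, F.bit n s m i = F.bit n s m' i) : F.hash n s m = F.hash n s m' := by
  have h1 := F.length_eq n s hs m
  have h2 := F.length_eq n s hs m'
  refine List.ext_getElem (h1.trans h2.symm) fun i hi hi' => ?_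
  -- Position `0` is the constant bit, so the hash value is shifted by one.
  have := h (i + 1) (by rw [width]; omega)
  simpa [bit, hi, hi'] using this

variable (F) in
-- The length of hash values has no explicit bound. But `eval` has to write out the hash value of
-- the empty string, on a key that `gen` has written out, so both running times bound it.
theorem exists_width_le : ∃ q : Polynomial ℕ, ∀ n, F.width n ≤ q.eval n := by
  obtain ⟨p, hp⟩ := F.gen.polyTime
  obtain ⟨q, hq⟩ := F.polyTime
  -- The 3 counts the nodes of the list of the three inputs of `eval`; the final 1 is the constant
  -- bit.
  refine ⟨q.comp (Polynomial.X + p + 3) + 1, fun n => ?_⟩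
  obtain ⟨s, hs⟩ := (F.gen.output (Data.unary n)).support_nonempty
  have hs' := hs
  rw [QPT.output, PMF.mem_support_map_iff] at hs'
  obtain ⟨r, hr, rfl⟩ := hs'
  have h1 := hp _ _ Tape.blank_ne_zero r hr
  have h2 := (Prog.size_lt_time hr).2
  have h3 : Data.ofBits (F.hash n r.out []) ∈
      ((F.eval.run (Data.ofList [Data.unary n, r.out, Data.ofBits []]) Tape.blank).map
        Result.out).support := by
    rw [F.eval_eq n r.out hs []]
    exact (PMF.mem_support_pure_iff _ _).mpr rfl
  rw [PMF.mem_support_map_iff] at h3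
  obtain ⟨t, ht, hto⟩ := h3
  have h4 := hq _ _ Tape.blank_ne_zero t ht
  have h5 := (Prog.size_lt_time ht).2
  have h6 := Data.length_le_size_ofList ((F.hash n r.out []).map Data.ofBool)
  have h7 : (Data.ofList ((F.hash n r.out []).map Data.ofBool)).size = t.out.size :=
    congrArg Data.size hto.symm
  rw [List.length_map, F.length_eq n r.out hs []] at h6
  have h8 : (Data.ofList [Data.unary n, r.out, Data.ofBits []]).size ≤ n + p.eval n + 3 := by
    simp only [Data.ofList, Data.ofBits, List.map_nil, Data.size_cons, Data.size_unary,
      Data.size_nil] at h1 ⊢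
    omega
  have h9 := eval_mono q h8
  simp only [width, Polynomial.eval_add, Polynomial.eval_comp, Polynomial.eval_X,
    Polynomial.eval_one, Polynomial.eval_ofNat]
  omega

end HashFamily

/-! ### Families of keys as keys -/

theorem expect_prodPMF_map {α β : Type} (f : α → β) (D : ℕ → PMF α) (v : ℕ → α) (N : ℕ)
    (φ : (ℕ → β) → ℝ≥0∞) : (expect (prodPMF D v N) fun w => φ fun i => f (w i)) =
      expect (prodPMF (fun i => (D i).map f) (fun i => f (v i)) N) φ := by
  induction N generalizing φ with
  | zero => simp only [prodPMF, expect_pure]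
  | succ N ih =>
    simp only [prodPMF, expect_bind, expect_map]
    rw [← ih]
    refine congrArg _ (funext fun w => congrArg _ (funext fun r => congrArg φ (funext fun i => ?_)))
    by_cases h : i = N
    · subst h
      simp only [Function.update_self]
    · simp only [Function.update_of_ne h]

/-- The key that consists of the first `N` members of a family of keys. -/
def packKey (N : ℕ) (κ : ℕ → SigningKey) : SigningKey :=
  (Data.pack N fun i => (κ i).1, joint N fun i => (κ i).2)

/-- The signing key and the classical part of the result of a program. -/
def splitKey (r : Data × Tape) : SigningKey × Data := ((r.1.fst, r.2), r.1.snd)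

open Prog in
theorem expect_seq_forEach {prep a : Prog} (P : Prog) (hp : prep.Classical) (ha : a.Simple)
    {x ctx l₂ l₃ : Data} {f : ℕ → Data} {N : ℕ}
    (hx : prep.value x = Data.cons ctx (Data.cons (Data.pack N f) (Data.cons l₂ l₃)))
    {y : ℕ → Data} (hy : ∀ i < N, a.value (slot ctx ((List.range N).map f) l₂ l₃ i) = y i)
    {Ψ : ℕ → Tape} (hΨ : ∀ j, Ψ j ≠ 0) (φ : SigningKey × Data → ℝ≥0∞) :
    expect (((Prog.seq prep (forEach a P)).sem x (joint N Ψ)).map splitKey) φ =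
      expect (prodPMF (fun i => (P.sem (y i) (Ψ i)).map splitKey)
        (fun j => ((Data.nil, Ψ j), Data.nil)) N) fun w =>
          φ (packKey N fun i => (w i).1, Data.pack N fun i => (w i).2) := by
  rw [expect_map, expect_seq, hp.sem, expect_pure, hx, expect_forEach P ha ctx l₂ l₃ f hΨ y hy]
  exact expect_prodPMF_map splitKey (fun i => P.sem (y i) (Ψ i)) (fun j => (Data.nil, Ψ j)) N
    fun w => φ (packKey N fun i => (w i).1, Data.pack N fun i => (w i).2)

/-! ### Signing the bits of the hash value -/

namespace HashFamily

variable (F : HashFamily)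

open Prog

theorem simple_nil : Simple .nil := trivial
theorem simple_snd : Simple .snd := trivial
theorem simple_one : one.Simple := ⟨trivial, trivial⟩

/-- Prepare a loop over the bits of the message `m`. The public parameter is the entry `1` of the
input. -/
def prep (m l₂ l₃ : Prog) : Prog :=
  .pair .id (.pair (.seq (list [arg 0, .seq (arg 1) .snd, m]) F.bits) (.pair l₂ l₃))

theorem polyTime_prep {m l₂ l₃ : Prog} (hm : m.Simple) (h₂ : l₂.Simple) (h₃ : l₃.Simple) :
    (F.prep m l₂ l₃).PolyTime :=
  polyTime_id.pair (((Simple.polyTime (by simp [Simple, list, simple_arg, hm])).seq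
    (polyTime_nil.pair F.polyTime)).pair (h₂.polyTime.pair h₃.polyTime))

theorem classical_prep {m l₂ l₃ : Prog} (hm : m.Simple) (h₂ : l₂.Simple) (h₃ : l₃.Simple) :
    (F.prep m l₂ l₃).Classical :=
  ⟨trivial, ⟨Simple.classical (by simp [Simple, list, simple_arg, hm]), trivial, F.classical⟩,
    h₂.classical, h₃.classical⟩

variable {F} in
theorem value_prep {n : ℕ} {s : Data} (hs : s ∈ (F.gen.output (Data.unary n)).support)
    (m l₂ l₃ : Prog) {x : Data} (h0 : x.nth 0 = Data.unary n) (h1 : (x.nth 1).snd = s)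
    {msg : List Bool} (hm : m.value x = Data.ofBits msg) :
    (F.prep m l₂ l₃).value x = Data.cons x
      (Data.cons (Data.pack (F.width n) fun i => Data.ofBool (F.bit n s msg i))
        (Data.cons (l₂.value x) (l₃.value x))) := by
  simp only [prep, value, list, value_arg, h0, h1, hm]
  rw [← value_bits hs]
  rfl

/-- The signature scheme in which the bits of the hash value of a message are signed by independent
keys of a signature scheme for single bits. -/
def hashThenSign (Sch : Scheme Bool) : Scheme (List Bool) where
  setup := ⟨.seq (push (sub .nil .id Sch.setup.prog)) <| .seq (push (sub one .snd F.gen.prog)) <|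
      .pair (.seq (arg 1) .fst) (.pair (.seq (arg 1) .snd) (arg 0)),
    ((polyTime_nil.sub polyTime_id Sch.setup.polyTime).pair polyTime_id).seq <|
    ((simple_one.polyTime.sub polyTime_snd F.gen.polyTime).pair
      polyTime_id).seq <| Simple.polyTime (by simp [Simple, simple_arg])⟩
  keyGen := ⟨.seq (F.prep .nil .nil .nil)
      (forEach (list [ctxArg 0, .seq (ctxArg 1) .fst]) Sch.keyGen.prog),
    (F.polyTime_prep simple_nil simple_nil simple_nil).seq
      (polyTime_forEach (by simp [Simple, list, simple_ctxArg]) Sch.keyGen.polyTime)⟩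
  sign := ⟨.seq (F.prep (arg 3) (arg 2) .nil)
      (forEach (list [ctxArg 0, .seq (ctxArg 1) .fst, head₂, head₁]) Sch.sign.prog),
    (F.polyTime_prep (simple_arg 3) (simple_arg 2) simple_nil).seq
      (polyTime_forEach (by simp [Simple, list, simple_ctxArg, simple_head₁, simple_head₂])
        Sch.sign.polyTime)⟩
  ver := ⟨conj (F.prep (arg 3) (arg 2) (arg 4))
      (list [ctxArg 0, .seq (ctxArg 1) .fst, head₂, head₁, head₃]) Sch.ver.prog,
    polyTime_conj (F.polyTime_prep (simple_arg 3) (simple_arg 2) (simple_arg 4))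
      (by simp [Simple, list, simple_ctxArg, simple_head₁, simple_head₂, simple_head₃])
      Sch.ver.polyTime⟩
  del := ⟨.seq (.seq (.pair .id (.pair (arg 1) (.pair .nil .nil)))
      (forEach (list [ctxArg 0, head₁]) (.pair Sch.del.prog .nil))) .fst,
    ((Simple.polyTime (by simp [Simple, simple_arg])).seq
      (polyTime_forEach (by simp [Simple, list, simple_ctxArg, simple_head₁])
        (Sch.del.polyTime.pair polyTime_nil))).seq polyTime_fst⟩
  cert := ⟨conj (F.prep (.seq (arg 5) .fst) (arg 2) (arg 4))
      (list [ctxArg 0, .seq (ctxArg 1) .fst, head₂, ctxArg 3, head₃,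
        .ite (ctxArg 5) (list [head₁]) .nil]) Sch.cert.prog,
    polyTime_conj (F.polyTime_prep ⟨simple_arg 5, trivial⟩ (simple_arg 2) (simple_arg 4))
      (by simp [Simple, list, simple_ctxArg, simple_head₁, simple_head₂, simple_head₃])
      Sch.cert.polyTime⟩

variable {F} {Sch : Scheme Bool} {n : ℕ} {s : Data}

theorem expect_Setup (φ : Data × Data → ℝ≥0∞) :
    expect ((F.hashThenSign Sch).Setup n) φ = expect (Sch.Setup n) fun c =>
      expect (F.gen.output (Data.unary n)) fun s => φ (c.1, Data.cons c.2 s) := by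
  have hb : ∀ j : ℕ, (fun _ : ℕ => Tape.blank) j ≠ 0 := fun _ => Tape.blank_ne_zero
  simp only [Scheme.Setup, QPT.output_eq_map_sem, expect_map, hashThenSign]
  conv_lhs => rw [← joint_blank 2]
  rw [expect_seq_push_sub (i := 0) (N := 2) _ _ simple_nil.classical
    (a := .id) trivial (by norm_num) rfl rfl hb]
  refine expect_congr fun c hc => ?_
  have hc0 := update_ne_zero hb (sem_ne_zero Tape.blank_ne_zero hc) 0
  rw [expect_seq_push_sub (i := 1) (N := 2) _ _ simple_one.classical simple_snd
    (by norm_num) rfl rfl hc0]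
  refine expect_congr fun r _ => ?_
  rw [Classical.sem (Simple.classical (by simp [Simple, simple_arg])), expect_pure]
  rfl

/-- No message is available yet: the bits of the empty string are computed only to obtain a list
with `width n` entries that drives the loop. -/
theorem expect_KeyGen (hs : s ∈ (F.gen.output (Data.unary n)).support) (pp : Data)
    (φ : SigningKey × Data → ℝ≥0∞) :
    expect ((F.hashThenSign Sch).KeyGen n (Data.cons pp s)) φ =
      expect (prodPMF (fun _ => Sch.KeyGen n pp) (fun _ => ((Data.nil, Tape.blank), Data.nil))
        (F.width n)) fun w =>
          φ (packKey (F.width n) fun i => (w i).1, Data.pack (F.width n) fun i => (w i).2) := by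
  have h := expect_seq_forEach Sch.keyGen.prog (F.classical_prep simple_nil simple_nil simple_nil)
    (a := list [ctxArg 0, .seq (ctxArg 1) .fst]) (by simp [Simple, list, simple_ctxArg])
    (value_prep hs .nil .nil .nil (x := Data.ofList [Data.unary n, Data.cons pp s]) rfl rfl
      (msg := []) rfl) (y := fun _ => Data.ofList [Data.unary n, pp])
    (fun i _ => rfl) (fun _ => Tape.blank_ne_zero) φ
  rw [joint_blank] at h
  exact h

theorem expect_Sign (hs : s ∈ (F.gen.output (Data.unary n)).support) (pp : Data)
    {κ : ℕ → SigningKey} (hκ : ∀ j, (κ j).2 ≠ 0) (m : List Bool)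
    (φ : SigningKey × Data → ℝ≥0∞) :
    expect ((F.hashThenSign Sch).Sign n (Data.cons pp s) (packKey (F.width n) κ) m) φ =
      expect (prodPMF (fun i => Sch.Sign n pp (κ i) (F.bit n s m i))
        (fun j => ((Data.nil, (κ j).2), Data.nil)) (F.width n)) fun w =>
          φ (packKey (F.width n) fun i => (w i).1, Data.pack (F.width n) fun i => (w i).2) := by
  refine expect_seq_forEach Sch.sign.prog
    (F.classical_prep (simple_arg 3) (simple_arg 2) simple_nil)
    (a := list [ctxArg 0, .seq (ctxArg 1) .fst, head₂, head₁])
    (by simp [Simple, list, simple_ctxArg, simple_head₁, simple_head₂])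
    (value_prep hs (arg 3) (arg 2) .nil (x := Data.ofList [Data.unary n, Data.cons pp s,
      Data.pack (F.width n) fun i => (κ i).1, Data.ofBits m]) rfl rfl (msg := m) rfl)
    (y := fun i => Data.ofList [Data.unary n, pp, (κ i).1, Data.ofBool (F.bit n s m i)])
    (fun i hi => ?_) hκ φ
  simp only [list, value, value_ctxArg, value_head₁ _ _ _ _ hi, value_head₂, value_arg]
  have : (Data.ofList [Data.unary n, Data.cons pp s, Data.pack (F.width n) fun i => (κ i).1,
    Data.ofBits m]).nth 2 = Data.pack (F.width n) fun i => (κ i).1 := rfl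
  rw [this, Data.nth_pack hi]
  rfl

theorem expect_Del (n : ℕ) {N : ℕ} {κ : ℕ → SigningKey} (hκ : ∀ j, (κ j).2 ≠ 0)
    (φ : Data → ℝ≥0∞) :
    expect ((F.hashThenSign Sch).Del n (packKey N κ)) φ =
      expect (prodPMF (fun i => Sch.Del n (κ i)) (fun _ => Data.nil) N) fun w =>
        φ (Data.pack N w) := by
  have h1 : Classical (.pair .id (.pair (arg 1) (.pair .nil .nil))) :=
    Simple.classical (by simp [Simple, simple_arg])
  simp only [Scheme.Del, QPT.run_eq_sem, hashThenSign, expect_map, packKey]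
  rw [expect_seq, expect_seq, h1.sem, expect_pure]
  have h := expect_forEach (.pair Sch.del.prog .nil) (a := list [ctxArg 0, head₁])
    (by simp [Simple, list, simple_ctxArg, simple_head₁])
    (Data.ofList [Data.unary n, Data.pack N fun i => (κ i).1]) Data.nil Data.nil
    (fun i => (κ i).1) (N := N) hκ (fun i => Data.ofList [Data.unary n, (κ i).1])
    (fun i hi => by
      simp only [list, value, value_ctxArg, value_head₁ _ _ _ _ hi]
      rfl)
  refine (h _).trans ?_
  simp only [sem_fst, expect_pure, Data.fst_cons]
  refine (expect_prodPMF_map (fun r : Data × Tape => r.1.fst) _ _ N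
    fun w => φ (Data.pack N w)).trans ?_
  congr 2
  funext i
  rw [sem_pair, PMF.map_bind]
  simp only [sem_nil, PMF.pure_map, Data.fst_cons]
  rfl

end HashFamily

namespace HashFamily

open Prog

variable {F : HashFamily} {Sch : Scheme Bool} {n : ℕ} {s : Data}

/-! ### Verification of signatures and certificates -/

section verification

variable (pp vk ck c σ : Data)

theorem value_verArgs (m : List Bool) {i : ℕ} (hi : i < F.width n) :
    (list [ctxArg 0, .seq (ctxArg 1) .fst, head₂, head₁, head₃]).value
      (slot (Data.ofList [Data.unary n, Data.cons pp s, vk, Data.ofBits m, σ])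
        ((List.range (F.width n)).map fun i => Data.ofBool (F.bit n s m i)) vk σ i) =
      Data.ofList [Data.unary n, pp, vk.nth i, Data.ofBool (F.bit n s m i), σ.nth i] := by
  simp only [list, value, value_ctxArg, value_head₁ _ _ _ _ hi, value_head₂, value_head₃]
  rfl

theorem simple_verArgs :
    (list [ctxArg 0, .seq (ctxArg 1) .fst, head₂, head₁, head₃]).Simple := by
  simp [Simple, list, simple_ctxArg, simple_head₁, simple_head₂, simple_head₃]

theorem Ver_true_le (hs : s ∈ (F.gen.output (Data.unary n)).support) (m : List Bool)
    {i : ℕ} (hi : i < F.width n) :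
    (F.hashThenSign Sch).Ver n (Data.cons pp s) vk m σ True ≤
      Sch.Ver n pp (vk.nth i) (F.bit n s m i) (σ.nth i) True := by
  rw [Scheme.Ver_eq_accept, Scheme.Ver_eq_accept]
  exact accept_conj_true_le (F.classical_prep (simple_arg 3) (simple_arg 2) (simple_arg 4))
    simple_verArgs (value_prep hs (arg 3) (arg 2) (arg 4) rfl rfl (value_arg 3 _))
    (fun i hi => value_verArgs pp vk σ m hi) hi

theorem Ver_false_le (hs : s ∈ (F.gen.output (Data.unary n)).support) (m : List Bool) :
    (F.hashThenSign Sch).Ver n (Data.cons pp s) vk m σ False ≤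
      ∑ i ∈ Finset.range (F.width n),
        Sch.Ver n pp (vk.nth i) (F.bit n s m i) (σ.nth i) False := by
  simp only [Scheme.Ver_eq_accept]
  exact accept_conj_false_le (F.classical_prep (simple_arg 3) (simple_arg 2) (simple_arg 4))
    simple_verArgs (value_prep hs (arg 3) (arg 2) (arg 4) rfl rfl (value_arg 3 _))
    (fun i hi => value_verArgs pp vk σ m hi)

theorem simple_certArgs :
    (list [ctxArg 0, .seq (ctxArg 1) .fst, head₂, ctxArg 3, head₃,
      .ite (ctxArg 5) (list [head₁]) .nil]).Simple := by
  simp [Simple, list, simple_ctxArg, simple_head₁, simple_head₂, simple_head₃]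

theorem value_certArgs (o : Option (List Bool)) {i : ℕ} (hi : i < F.width n) :
    (list [ctxArg 0, .seq (ctxArg 1) .fst, head₂, ctxArg 3, head₃,
        .ite (ctxArg 5) (list [head₁]) .nil]).value
      (slot (Data.ofList [Data.unary n, Data.cons pp s, vk, ck, c, encSet o.toList])
        ((List.range (F.width n)).map fun i => Data.ofBool (F.bit n s (o.getD []) i)) vk c i) =
      Data.ofList [Data.unary n, pp, vk.nth i, ck, c.nth i,
        encSet (o.map fun m => F.bit n s m i).toList] := by
  simp only [list, value, value_ctxArg, value_head₁ _ _ _ _ hi, value_head₂, value_head₃]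
  cases o <;> rfl

theorem simple_fst_arg : Simple (.seq (arg 5) .fst) := ⟨simple_arg 5, trivial⟩

/-- For the empty set the missing element is read as the empty string. Its bits only control the
number of rounds then, since each round is passed the empty set. -/
theorem value_fst_set (o : Option (List Bool)) :
    (Prog.seq (arg 5) .fst).value
      (Data.ofList [Data.unary n, Data.cons pp s, vk, ck, c, encSet o.toList]) =
        Data.ofBits (o.getD []) := by
  cases o <;> rfl

theorem Cert_true_le (hs : s ∈ (F.gen.output (Data.unary n)).support) (o : Option (List Bool))
    {i : ℕ} (hi : i < F.width n) :
    (F.hashThenSign Sch).Cert n (Data.cons pp s) vk ck c o.toList True ≤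
      Sch.Cert n pp (vk.nth i) ck (c.nth i) (o.map fun m => F.bit n s m i).toList True := by
  rw [Scheme.Cert_eq_accept, Scheme.Cert_eq_accept]
  exact accept_conj_true_le
    (F.classical_prep simple_fst_arg (simple_arg 2) (simple_arg 4))
    simple_certArgs (value_prep hs _ (arg 2) (arg 4) rfl rfl (value_fst_set pp vk ck c o))
    (fun i hi => value_certArgs pp vk ck c o hi) hi

theorem Cert_false_le (hs : s ∈ (F.gen.output (Data.unary n)).support) (o : Option (List Bool)) :
    (F.hashThenSign Sch).Cert n (Data.cons pp s) vk ck c o.toList False ≤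
      ∑ i ∈ Finset.range (F.width n), Sch.Cert n pp (vk.nth i) ck (c.nth i)
        (o.map fun m => F.bit n s m i).toList False := by
  simp only [Scheme.Cert_eq_accept]
  exact accept_conj_false_le
    (F.classical_prep simple_fst_arg (simple_arg 2) (simple_arg 4))
    simple_certArgs (value_prep hs _ (arg 2) (arg 4) rfl rfl (value_fst_set pp vk ck c o))
    (fun i hi => value_certArgs pp vk ck c o hi)

end verification

/-! ### Correctness -/

theorem KeyGen_ne_zero {M : Type} [MessageSpace M] {Sch : Scheme M} {pp : Data}
    {k : SigningKey × Data} (hk : k ∈ (Sch.KeyGen n pp).support) : k.1.2 ≠ 0 := by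
  rw [Scheme.KeyGen, PMF.mem_support_map_iff] at hk
  obtain ⟨r, hr, rfl⟩ := hk
  exact sem_ne_zero (r := r) Tape.blank_ne_zero hr

theorem Sign_ne_zero {M : Type} [MessageSpace M] {Sch : Scheme M} {pp : Data} {k : SigningKey}
    (hk : k.2 ≠ 0) {m : M} {r : SigningKey × Data} (hr : r ∈ (Sch.Sign n pp k m).support) :
    r.1.2 ≠ 0 := Sch.signOpt_ne_zero (o := some m) hk hr

theorem prodPMF_ne_zero {D : ℕ → PMF (SigningKey × Data)} {v : ℕ → SigningKey × Data} {N : ℕ}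
    (hD : ∀ i, ∀ r ∈ (D i).support, r.1.2 ≠ 0) (hv : ∀ i, (v i).1.2 ≠ 0)
    {w : ℕ → SigningKey × Data} (hw : w ∈ (prodPMF D v N).support) (i : ℕ) : (w i).1.2 ≠ 0 := by
  obtain ⟨h1, h2⟩ := mem_support_prodPMF hw
  by_cases hi : i < N
  · exact hD i _ (h1 i hi)
  · rw [h2 i (by omega)]
    exact hv i

/-- Union bound over positions: each summand depends on one sample only, so the joint expectation
reduces to marginals. -/
theorem expect_sum_prodPMF_le {α : Type} (D : ℕ → PMF α) (v : ℕ → α) (N : ℕ)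
    (Φ : (ℕ → α) → ℝ≥0∞) (φ : ℕ → α → ℝ≥0∞)
    (h : ∀ w ∈ (prodPMF D v N).support, Φ w ≤ ∑ i ∈ Finset.range N, φ i (w i)) :
    expect (prodPMF D v N) Φ ≤ ∑ i ∈ Finset.range N, expect (D i) (φ i) := by
  refine (expect_mono h).trans ?_
  rw [expect_sum]
  exact (Finset.sum_congr rfl fun i hi =>
    expect_prodPMF D v (Finset.mem_range.mp hi) (φ i)).le

theorem correctExp_false_le (m : List Bool) {e : ℝ≥0∞}
    (he : ∀ b, Sch.correctExp n b False ≤ e) :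
    (F.hashThenSign Sch).correctExp n m False ≤ F.width n * e := by
  -- With the hash key outermost, the bits to be signed are fixed before the bit scheme is set up,
  -- and its correctness for fixed messages applies.
  rw [Scheme.correctExp_apply, expect_Setup, expect_comm]
  rw [← expect_const (F.gen.output (Data.unary n)) (F.width n * e)]
  refine expect_mono fun s hs => ?_
  have h : ∀ c : Data × Data, (expect ((F.hashThenSign Sch).KeyGen n (Data.cons c.2 s)) fun k =>
      expect ((F.hashThenSign Sch).Sign n (Data.cons c.2 s) k.1 m) fun r =>
        (F.hashThenSign Sch).Ver n (Data.cons c.2 s) k.2 m r.2 False) ≤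
      ∑ i ∈ Finset.range (F.width n), expect (Sch.KeyGen n c.2) fun k =>
        expect (Sch.Sign n c.2 k.1 (F.bit n s m i)) fun r =>
          Sch.Ver n c.2 k.2 (F.bit n s m i) r.2 False := by
    intro c
    rw [expect_KeyGen hs]
    refine expect_sum_prodPMF_le _ _ _ _ (fun i (k : SigningKey × Data) =>
      expect (Sch.Sign n c.2 k.1 (F.bit n s m i))
      fun r => Sch.Ver n c.2 k.2 (F.bit n s m i) r.2 False) fun w hw => ?_
    have hw0 := prodPMF_ne_zero (fun _ _ => KeyGen_ne_zero) (fun _ => Tape.blank_ne_zero) hw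
    rw [expect_Sign hs c.2 hw0]
    refine expect_sum_prodPMF_le _ _ _ _
      (fun i (r : SigningKey × Data) => Sch.Ver n c.2 (w i).2 (F.bit n s m i) r.2 False)
      fun r _ => ?_
    refine (Ver_false_le c.2 _ _ hs m).trans (Finset.sum_le_sum fun i hi => ?_)
    rw [Data.nth_pack (Finset.mem_range.mp hi), Data.nth_pack (Finset.mem_range.mp hi)]
  refine (expect_mono fun c _ => h c).trans ?_
  rw [expect_sum]
  refine (Finset.sum_le_card_nsmul _ _ e fun i _ => ?_).trans ?_
  · refine le_trans ?_ (he (F.bit n s m i))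
    rw [Scheme.correctExp_apply]
  · rw [Finset.card_range, nsmul_eq_mul]

theorem oneTimeCorrect (h : Sch.OneTimeCorrect) : (F.hashThenSign Sch).OneTimeCorrect := by
  obtain ⟨ε, hε, h⟩ := (exists_negligible_iff _).mp h
  obtain ⟨q, hq⟩ := F.exists_width_le
  refine (exists_negligible_iff _).mpr ⟨_, hε.polynomial_mul q, fun n m => ?_⟩
  refine (correctExp_false_le m (h n)).trans ?_
  gcongr
  exact hq n

theorem delFail_le (hs : s ∈ (F.gen.output (Data.unary n)).support) (ck pp : Data)
    {w : ℕ → SigningKey × Data} (hw : ∀ i, (w i).1.2 ≠ 0) (o : Option (List Bool)) :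
    (F.hashThenSign Sch).delFail n ck (Data.cons pp s) (packKey (F.width n) fun i => (w i).1)
        (Data.pack (F.width n) fun i => (w i).2) o ≤
      ∑ i ∈ Finset.range (F.width n),
        Sch.delFail n ck pp (w i).1 (w i).2 (o.map fun m => F.bit n s m i) := by
  have h : ∀ κ : ℕ → SigningKey, (∀ i, (κ i).2 ≠ 0) →
      (expect ((F.hashThenSign Sch).Del n (packKey (F.width n) κ)) fun c =>
        (F.hashThenSign Sch).Cert n (Data.cons pp s) (Data.pack (F.width n) fun i => (w i).2)
          ck c o.toList False) ≤
      ∑ i ∈ Finset.range (F.width n), expect (Sch.Del n (κ i)) fun c =>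
        Sch.Cert n pp (w i).2 ck c (o.map fun m => F.bit n s m i).toList False := by
    intro κ hκ
    rw [expect_Del n hκ]
    refine expect_sum_prodPMF_le _ _ _ _ (fun i (c : Data) =>
      Sch.Cert n pp (w i).2 ck c (o.map fun m => F.bit n s m i).toList False) fun c _ => ?_
    refine (Cert_false_le pp _ ck _ hs o).trans (Finset.sum_le_sum fun i hi => ?_)
    rw [Data.nth_pack (Finset.mem_range.mp hi), Data.nth_pack (Finset.mem_range.mp hi)]
  cases o with
  | none => simpa only [Scheme.delFail, Scheme.signOpt, expect_pure, Option.map_none] using h _ hw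
  | some m =>
    simp only [Scheme.delFail, Scheme.signOpt, Option.map_some]
    rw [expect_Sign hs pp hw]
    refine expect_sum_prodPMF_le _ _ _ _ (fun i (r : SigningKey × Data) =>
      expect (Sch.Del n r.1) fun c =>
      Sch.Cert n pp (w i).2 ck c (some (F.bit n s m i)).toList False) fun r hr => ?_
    exact h _ (prodPMF_ne_zero (v := fun j => ((Data.nil, (w j).1.2), Data.nil))
      (fun i _ => Sign_ne_zero (hw i)) hw hr)

/-- At each position, the infinitely many messages collapse to one of three requests, so the
supremum is bounded by a finite sum that does not mention the message. The sum can then be taken out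
of the expectation over the keys. -/
theorem robustDeletion (h : Sch.OneTimeDeletionCorrect) :
    (F.hashThenSign Sch).RobustDeletion := by
  obtain ⟨ε, hε, h⟩ := (exists_negligible_iff _).mp h
  obtain ⟨q, hq⟩ := F.exists_width_le
  -- The factor 3 counts `none`, `some false` and `some true`.
  refine ⟨_, hε.polynomial_mul (q * 3), fun n => ?_⟩
  have key : ∀ s ∈ (F.gen.output (Data.unary n)).support, ∀ c : Data × Data,
      (expect ((F.hashThenSign Sch).KeyGen n (Data.cons c.2 s)) fun k =>
        ⨆ o, (F.hashThenSign Sch).delFail n c.1 (Data.cons c.2 s) k.1 k.2 o) ≤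
      ∑ i ∈ Finset.range (F.width n), expect (Sch.KeyGen n c.2) fun k =>
        ∑ o : Option Bool, Sch.delFail n c.1 c.2 k.1 k.2 o := by
    intro s hs c
    rw [expect_KeyGen hs]
    refine expect_sum_prodPMF_le _ _ _ _
      (fun i (k : SigningKey × Data) => ∑ o : Option Bool, Sch.delFail n c.1 c.2 k.1 k.2 o)
      fun w hw => iSup_le fun o => ?_
    have hw0 := prodPMF_ne_zero (fun _ _ => KeyGen_ne_zero) (fun _ => Tape.blank_ne_zero) hw
    refine (delFail_le hs c.1 c.2 hw0 o).trans (Finset.sum_le_sum fun i _ => ?_)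
    exact Finset.single_le_sum (f := fun o => Sch.delFail n c.1 c.2 (w i).1 (w i).2 o)
      (fun _ _ => zero_le) (Finset.mem_univ _)
  rw [expect_Setup, expect_comm, ← expect_const (F.gen.output (Data.unary n)) (_ * _)]
  refine expect_mono fun s hs => (expect_mono fun c _ => key s hs c).trans ?_
  simp only [expect_sum]
  refine (Finset.sum_le_card_nsmul _ _ (3 * ε n) fun i _ => ?_).trans ?_
  · refine (Finset.sum_le_card_nsmul _ _ (ε n) fun o _ => ?_).trans ?_
    · rw [← Scheme.deletionExp_apply_false]
      exact h n o
    · simp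
  · rw [Finset.card_range, nsmul_eq_mul, ← mul_assoc]
    have := hq n
    gcongr
    simp only [Polynomial.eval_mul, Polynomial.eval_ofNat]
    exact_mod_cast Nat.mul_le_mul_right 3 this

end HashFamily

namespace HashFamily

open Prog

/-! ### The first difference of two lists of bits -/

/-- The program that tests whether two programs both return `nil` or both do not. -/
def sameTest (f g : Prog) : Prog := .ite f g (.ite g .nil one)

/-- Replace all entries of the list of length six but the first one by their tails, as long as the
first entry is not `nil` and the heads of the next two entries agree. -/
def diffStep : Prog :=
  .ite (.ite (arg 0) (sameTest (.seq (arg 1) .fst) (.seq (arg 2) .fst)) .nil)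
    (list [arg 0, .seq (arg 1) .snd, .seq (arg 2) .snd, .seq (arg 3) .snd, .seq (arg 4) .snd,
      .seq (arg 5) .snd]) .id

theorem simple_diffStep : diffStep.Simple := by
  simp [diffStep, sameTest, Simple, list, one, simple_arg]

/-- The state of the loop after `j` rounds. -/
def diffState (S h h' v c σ : Data) (j : ℕ) : Data :=
  Data.ofList [S, Data.snd^[j] h, Data.snd^[j] h', Data.snd^[j] v, Data.snd^[j] c, Data.snd^[j] σ]

theorem value_diffStep (S h h' v c σ : Data) (j : ℕ) :
    diffStep.value (diffState S h h' v c σ j) =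
      (S.sel ((h.nth j).sel (h'.nth j) ((h'.nth j).sel Data.nil (Data.cons Data.nil Data.nil)))
        Data.nil).sel (diffState S h h' v c σ (j + 1)) (diffState S h h' v c σ j) := by
  simp only [diffState, Function.iterate_succ_apply', Data.nth_eq]
  rfl

/-- The loop advances while a signed message exists and the bits agree, and is stationary from round
`j` on. If `S` is `nil`, the hypotheses force `j = 0`. The counter is a list of `N` bits, so round
`j` is reached. -/
theorem value_rep_diffStep {S v c σ : Data} {b b' : ℕ → Bool} {N j : ℕ} (hj : j < N)
    (hlt : ∀ i < j, S ≠ Data.nil ∧ b i = b' i) (hjj : S = Data.nil ∨ b j ≠ b' j) :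
    (Prog.rep diffStep).value (Data.cons (Data.pack N fun i => Data.ofBool (b i))
      (diffState S (Data.pack N fun i => Data.ofBool (b i))
        (Data.pack N fun i => Data.ofBool (b' i)) v c σ 0)) =
      diffState S (Data.pack N fun i => Data.ofBool (b i))
        (Data.pack N fun i => Data.ofBool (b' i)) v c σ j := by
  have h1 : ∀ i ≤ j, diffStep.value^[i] (diffState S (Data.pack N fun i => Data.ofBool (b i))
        (Data.pack N fun i => Data.ofBool (b' i)) v c σ 0) =
      diffState S (Data.pack N fun i => Data.ofBool (b i))
        (Data.pack N fun i => Data.ofBool (b' i)) v c σ i := by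
    intro i hi
    induction i with
    | zero => rfl
    | succ i ih =>
      obtain ⟨hS, hb⟩ := hlt i (by omega)
      rw [Function.iterate_succ_apply', ih (by omega), value_diffStep,
        Data.nth_pack (by omega), Data.nth_pack (by omega), hb, Data.sel_of_ne_nil hS]
      cases b' i <;> rfl
  rw [← h1 j le_rfl]
  refine iterate_eq_of_fixed ?_ ?_
  · have := Data.length_le_size_ofList ((List.range N).map fun i => Data.ofBool (b i))
    rw [List.length_map, List.length_range] at this
    exact hj.le.trans this
  · rw [Data.snd_cons, h1 j le_rfl, value_diffStep, Data.nth_pack hj, Data.nth_pack hj]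
    rcases hjj with rfl | hb
    · rfl
    · cases S with
      | nil => rfl
      | cons x y =>
        cases hx : b j <;> cases hy : b' j
        all_goals first | rfl | exact absurd (hx.trans hy.symm) hb

theorem polyTime_rep_diffStep : (Prog.rep diffStep).PolyTime := by
  -- The rebuilt list has six nodes, which on malformed inputs need not have been there before.
  refine simple_diffStep.polyTime.rep_of_size_le simple_diffStep.classical 6 fun y => ?_
  have e0 := y.size_fst_add_size_snd
  have e1 := y.snd.size_fst_add_size_snd
  have e2 := y.snd.snd.size_fst_add_size_snd
  have e3 := y.snd.snd.snd.size_fst_add_size_snd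
  have e4 := y.snd.snd.snd.snd.size_fst_add_size_snd
  have e5 := y.snd.snd.snd.snd.snd.size_fst_add_size_snd
  have f1 := y.snd.fst.size_snd_le
  have f2 := y.snd.snd.fst.size_snd_le
  have f3 := y.snd.snd.snd.fst.size_snd_le
  have f4 := y.snd.snd.snd.snd.fst.size_snd_le
  have f5 := y.snd.snd.snd.snd.snd.fst.size_snd_le
  rw [diffStep, value]
  generalize value _ y = d
  cases d with
  | nil => exact Nat.le_add_right _ _
  | cons x z =>
    simp only [Data.sel_cons, list, value, value_arg, Data.size_cons, Data.size_nil, Data.nth]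
    omega

/-! ### Security of deletion -/

variable (F : HashFamily)

/-- From the output of an adversary, the key, the parameter and the public parameter, compute the
output of an adversary against the scheme for single bits, by means of the first bit at which the
signed message (if there is one) and the forged one differ. -/
def extract : Prog :=
  .seq (.pair (.seq (list [arg 2, arg 1, .seq (.seq (arg 0) (arg 2)) .fst]) F.bits)
    (list [.seq (arg 0) (arg 2),
      .seq (list [arg 2, arg 1, .seq (.seq (arg 0) (arg 2)) .fst]) F.bits,
      .seq (list [arg 2, arg 1, .seq (arg 0) (arg 3)]) F.bits,
      .seq (arg 0) (arg 0), .seq (arg 0) (arg 1), .seq (arg 0) (arg 4)])) <|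
  .seq (.rep diffStep) <|
  list [.seq (arg 3) .fst, .seq (arg 4) .fst,
    .ite (arg 0) (list [.seq (arg 1) .fst]) .nil, .seq (arg 2) .fst, .seq (arg 5) .fst]

theorem classical_extract : F.extract.Classical := by
  have h : F.bits.Classical := ⟨trivial, F.classical⟩
  simp [extract, Classical, list, h, (simple_arg _).classical, simple_diffStep.classical]

theorem polyTime_extract : F.extract.PolyTime := by
  have hb : F.bits.PolyTime := polyTime_nil.pair F.polyTime
  have hs : ∀ i j, (Prog.seq (arg i) (arg j)).PolyTime := fun i j =>
    (simple_arg i).polyTime.seq (simple_arg j).polyTime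
  have h1 : (Prog.seq (list [arg 2, arg 1, .seq (.seq (arg 0) (arg 2)) .fst]) F.bits).PolyTime :=
    (Simple.polyTime (by simp [Simple, list, simple_arg])).seq hb
  have h2 : (Prog.seq (list [arg 2, arg 1, .seq (arg 0) (arg 3)]) F.bits).PolyTime :=
    (Simple.polyTime (by simp [Simple, list, simple_arg])).seq hb
  exact (h1.pair ((hs 0 2).pair (h1.pair (h2.pair ((hs 0 0).pair ((hs 0 1).pair
    ((hs 0 4).pair polyTime_nil))))))).seq (polyTime_rep_diffStep.seq
      (Simple.polyTime (by simp [Simple, list, simple_arg])))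

variable {F} {Sch : Scheme Bool} {n : ℕ} {s : Data}

/-- Here `j` is the first position at which the bits differ, or `0` if nothing was signed: for `o =
none` the hypothesis on smaller positions forces `j = 0`. -/
theorem value_extract (hs : s ∈ (F.gen.output (Data.unary n)).support) {pp out : Data}
    {o : Option (List Bool)} {m : List Bool} (h2 : out.nth 2 = encSet o.toList)
    (h3 : out.nth 3 = Data.ofBits m) {j : ℕ} (hj : j < F.width n)
    (hlt : ∀ i < j, ∃ m' ∈ o, F.bit n s m' i = F.bit n s m i)
    (hjj : ∀ m' ∈ o, F.bit n s m' j ≠ F.bit n s m j) :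
    F.extract.value (Data.cons out (Data.cons s (Data.ofList [Data.unary n, pp]))) =
      Data.ofList [(out.nth 0).nth j, (out.nth 1).nth j,
        encSet (o.map fun m' => F.bit n s m' j).toList, Data.ofBool (F.bit n s m j),
        (out.nth 4).nth j] := by
  have hS : (encSet o.toList).fst = Data.ofBits (o.getD []) := by cases o <;> rfl
  have e1 : value (.seq (list [arg 2, arg 1, .seq (.seq (arg 0) (arg 2)) .fst]) F.bits)
      (Data.cons out (Data.cons s (Data.ofList [Data.unary n, pp]))) =
        Data.pack (F.width n) fun i => Data.ofBool (F.bit n s (o.getD []) i) := by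
    rw [← value_bits hs, ← hS, ← h2]
    simp only [value, list, value_arg]
    rfl
  have e2 : value (.seq (list [arg 2, arg 1, .seq (arg 0) (arg 3)]) F.bits)
      (Data.cons out (Data.cons s (Data.ofList [Data.unary n, pp]))) =
        Data.pack (F.width n) fun i => Data.ofBool (F.bit n s m i) := by
    rw [← value_bits hs, ← h3]
    simp only [value, list, value_arg]
    rfl
  have e3 := value_rep_diffStep (S := encSet o.toList) (v := out.nth 0) (c := out.nth 1)
    (σ := out.nth 4) (b := F.bit n s (o.getD [])) (b' := F.bit n s m) hj
    (fun i hi => by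
      obtain ⟨m', rfl, h⟩ := hlt i hi
      exact ⟨Data.noConfusion, h⟩)
    (by
      cases o with
      | none => exact Or.inl rfl
      | some m' => exact Or.inr (hjj m' rfl))
  have e4 : value (.pair (.seq (list [arg 2, arg 1, .seq (.seq (arg 0) (arg 2)) .fst]) F.bits)
    (list [.seq (arg 0) (arg 2),
      .seq (list [arg 2, arg 1, .seq (.seq (arg 0) (arg 2)) .fst]) F.bits,
      .seq (list [arg 2, arg 1, .seq (arg 0) (arg 3)]) F.bits,
      .seq (arg 0) (arg 0), .seq (arg 0) (arg 1), .seq (arg 0) (arg 4)]))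
      (Data.cons out (Data.cons s (Data.ofList [Data.unary n, pp]))) =
      Data.cons (Data.pack (F.width n) fun i => Data.ofBool (F.bit n s (o.getD []) i))
        (diffState (encSet o.toList)
          (Data.pack (F.width n) fun i => Data.ofBool (F.bit n s (o.getD []) i))
          (Data.pack (F.width n) fun i => Data.ofBool (F.bit n s m i)) (out.nth 0) (out.nth 1)
          (out.nth 4) 0) := by
    rw [← e1, ← e2, ← h2]
    simp only [list, value, value_arg]
    rfl
  have hn : ∀ (P Q : Prog) x, value (.seq P Q) x = Q.value (P.value x) := fun _ _ _ => rfl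
  rw [extract, hn, hn, e4, e3]
  have p1 := Data.nth_pack hj fun i => Data.ofBool (F.bit n s (o.getD []) i)
  have p2 := Data.nth_pack hj fun i => Data.ofBool (F.bit n s m i)
  rw [← p2]
  have p3 : encSet (o.map fun m' => F.bit n s m' j).toList = (encSet o.toList).sel
      (Data.cons ((Data.pack (F.width n) fun i => Data.ofBool (F.bit n s (o.getD []) i)).nth j)
        Data.nil) Data.nil := by
    rw [p1]
    cases o <;> rfl
  rw [p3]
  simp only [Data.nth_eq j]
  simp only [list, value, value_arg]
  rfl

/-- The event that the entries `0` and `1` of the output of an adversary are a collision. -/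
def IsCollision (F : HashFamily) (n : ℕ) (s out : Data) : Prop :=
  ∃ x y : List Bool, out.nth 0 = Data.ofBits x ∧ out.nth 1 = Data.ofBits y ∧
    x ≠ y ∧ F.hash n s x = F.hash n s y

/-- Different hash values differ in some bit. If nothing was signed, position `0` serves; it exists
even for empty hash values thanks to the constant bit. -/
theorem exists_first_difference (hs : s ∈ (F.gen.output (Data.unary n)).support)
    {o : Option (List Bool)} {m : List Bool} (h : ∀ m' ∈ o, F.hash n s m' ≠ F.hash n s m) :
    ∃ j < F.width n, (∀ i < j, ∃ m' ∈ o, F.bit n s m' i = F.bit n s m i) ∧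
      ∀ m' ∈ o, F.bit n s m' j ≠ F.bit n s m j := by
  cases o with
  | none => exact ⟨0, Nat.succ_pos _, by simp, by simp⟩
  | some m' =>
    have hex : ∃ j, j < F.width n ∧ F.bit n s m' j ≠ F.bit n s m j := by
      by_contra! hall
      exact h m' rfl (hash_eq_of_bit_eq hs hall)
    classical
    obtain ⟨h1, h2⟩ := Nat.find_spec hex
    refine ⟨Nat.find hex, h1, fun i hi => ⟨m', rfl, ?_⟩, ?_⟩
    · by_contra hne
      exact Nat.find_min hex hi ⟨hi.trans h1, hne⟩
    · rintro _ ⟨⟩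
      exact h2

/-- The core of the reduction, valid for each single output of the adversary. Without a collision,
position `j` alone wins: the composite checks are conjunctions, so each is at most as likely to
accept as its `j`-th component, and the two checks are independent. -/
theorem revokeVal_le (hs : s ∈ (F.gen.output (Data.unary n)).support) (ck pp out : Data) :
    (F.hashThenSign Sch).revokeVal n ck (Data.cons pp s) out ≤
      Sch.revokeVal n ck pp
        (F.extract.value (Data.cons out (Data.cons s (Data.ofList [Data.unary n, pp])))) +
      ind (F.IsCollision n s (Data.ofList [(out.nth 2).fst, out.nth 3])) := by
  rw [Scheme.revokeVal]
  cases h2 : decSet (List Bool) (out.nth 2) with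
  | none => exact zero_le
  | some S =>
    cases h3 : decMsg (List Bool) (out.nth 3) with
    | none => exact zero_le
    | some m =>
      simp only
      split_ifs with h
      swap
      · exact zero_le
      obtain ⟨hS, hm⟩ := h
      have h2' := (encSet_of_decSet_eq_some h2).symm
      have h3' : out.nth 3 = Data.ofBits m := (enc_of_decMsg_eq_some h3).symm
      obtain ⟨o, rfl⟩ : ∃ o : Option (List Bool), S = o.toList := by
        match S, hS with
        | [], _ => exact ⟨none, rfl⟩
        | [a], _ => exact ⟨some a, rfl⟩
      by_cases hc : ∀ m' ∈ o, F.hash n s m' ≠ F.hash n s m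
      · obtain ⟨j, hj, hlt, hjj⟩ := exists_first_difference hs hc
        refine le_trans ?_ le_self_add
        rw [value_extract hs h2' h3' hj hlt hjj, Scheme.revokeVal]
        have q2 : ∀ a b c d e : Data, (Data.ofList [a, b, c, d, e]).nth 2 = c :=
          fun _ _ _ _ _ => rfl
        have q3 : ∀ a b c d e : Data, (Data.ofList [a, b, c, d, e]).nth 3 = d :=
          fun _ _ _ _ _ => rfl
        have q4 : decMsg Bool (Data.ofBool (F.bit n s m j)) = some (F.bit n s m j) :=
          decMsg_enc (F.bit n s m j)
        rw [q2, q3, decSet_enc, q4]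
        simp only
        rw [if_pos]
        · exact mul_le_mul' (Cert_true_le _ _ _ _ hs o hj) (Ver_true_le _ _ _ hs m hj)
        · cases o with
          | none => simp
          | some m' => simpa [eq_comm] using hjj m' rfl
      · push Not at hc
        obtain ⟨m', rfl, hc⟩ := hc
        -- The messages collide, and the indicator already accounts for the whole probability.
        refine le_trans (mul_le_one' (PMF.coe_le_one _ _) (PMF.coe_le_one _ _)) ?_
        rw [ind_of]
        · exact le_add_self
        · refine ⟨m', m, ?_, h3', ?_, hc⟩
          · rw [h2']
            rfl
          · rintro rfl
            simp at hm

variable (F Sch) in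
/-- The adversary against the scheme for single bits. -/
def bitRevoker (A : QPT) : QPT where
  prog := .seq (push (sub .nil (arg 0) F.gen.prog)) <|
    .seq (push (sub one (list [arg 1, .pair (arg 2) (arg 0)]) A.prog)) F.extract
  polyTime := ((polyTime_nil.sub (simple_arg 0).polyTime F.gen.polyTime).pair polyTime_id).seq <|
    ((simple_one.polyTime.sub (Simple.polyTime (by simp [Simple, list, simple_arg]))
      A.polyTime).pair polyTime_id).seq F.polyTime_extract

variable (Sch) in
/-- The adversary against the family of hash functions. -/
def collisionFinder (A : QPT) : QPT where
  prog := .seq (push (sub .nil (arg 0) Sch.setup.prog)) <|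
    .seq (push (sub one (list [arg 1, .pair (.seq (arg 0) .snd) (arg 2)]) A.prog)) <|
    list [.seq (.seq (arg 0) (arg 2)) .fst, .seq (arg 0) (arg 3)]
  polyTime :=
    ((polyTime_nil.sub (simple_arg 0).polyTime Sch.setup.polyTime).pair polyTime_id).seq <|
    ((simple_one.polyTime.sub (Simple.polyTime (by simp [Simple, list, simple_arg]))
      A.polyTime).pair polyTime_id).seq (Simple.polyTime (by simp [Simple, list, simple_arg]))

theorem expect_bitRevoker (A : QPT) (pp : Data) (φ : Data → ℝ≥0∞) :
    expect ((F.bitRevoker A).output (Data.ofList [Data.unary n, pp])) φ =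
      expect (F.gen.output (Data.unary n)) fun s =>
        expect (A.output (Data.ofList [Data.unary n, Data.cons pp s])) fun out =>
          φ (F.extract.value (Data.cons out (Data.cons s (Data.ofList [Data.unary n, pp])))) := by
  have hb : ∀ j : ℕ, (fun _ : ℕ => Tape.blank) j ≠ 0 := fun _ => Tape.blank_ne_zero
  simp only [QPT.output_eq_map_sem, expect_map, bitRevoker]
  conv_lhs => rw [← joint_blank 2]
  rw [expect_seq_push_sub (i := 0) (N := 2) _ _ simple_nil.classical (simple_arg 0)
    (by norm_num) rfl (value_arg 0 _) hb]
  refine expect_congr fun r hr => ?_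
  have hr0 := update_ne_zero hb (sem_ne_zero Tape.blank_ne_zero hr) 0
  rw [expect_seq_push_sub (i := 1) (N := 2) _ _ simple_one.classical
    (by simp [Simple, list, simple_arg]) (by norm_num) rfl rfl hr0]
  refine expect_congr fun out _ => ?_
  rw [F.classical_extract.sem, expect_pure]

theorem expect_collisionFinder (A : QPT) (s : Data) (φ : Data → ℝ≥0∞) :
    expect ((collisionFinder Sch A).output (Data.ofList [Data.unary n, s])) φ =
      expect (Sch.Setup n) fun c =>
        expect (A.output (Data.ofList [Data.unary n, Data.cons c.2 s])) fun out =>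
          φ (Data.ofList [(out.nth 2).fst, out.nth 3]) := by
  have hb : ∀ j : ℕ, (fun _ : ℕ => Tape.blank) j ≠ 0 := fun _ => Tape.blank_ne_zero
  simp only [Scheme.Setup, QPT.output_eq_map_sem, expect_map, collisionFinder]
  conv_lhs => rw [← joint_blank 2]
  rw [expect_seq_push_sub (i := 0) (N := 2) _ _ simple_nil.classical (simple_arg 0)
    (by norm_num) rfl (value_arg 0 _) hb]
  refine expect_congr fun r hr => ?_
  have hr0 := update_ne_zero hb (sem_ne_zero Tape.blank_ne_zero hr) 0
  rw [expect_seq_push_sub (i := 1) (N := 2) _ _ simple_one.classical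
    (by simp [Simple, list, simple_arg]) (by norm_num) rfl rfl hr0]
  refine expect_congr fun out _ => ?_
  rw [Classical.sem (Simple.classical (by simp [Simple, list, simple_arg])), expect_pure]
  simp only [list, value, value_arg]
  rfl

theorem collisionExp_apply_true (A : QPT) (n : ℕ) :
    F.collisionExp A n True = expect (F.gen.output (Data.unary n)) fun s =>
      expect (A.output (Data.ofList [Data.unary n, s])) fun out => ind (F.IsCollision n s out) := by
  refine (bind_apply_eq_expect _ _ _).trans (congrArg _ (funext fun s => ?_))
  refine (bind_apply_eq_expect _ _ _).trans (congrArg _ (funext fun out => ?_))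
  have h : ∀ p : Prop, (PMF.pure p : PMF Prop) True = ind p := by
    intro p
    by_cases hp : p <;> simp [hp, ind]
  exact h (F.IsCollision n s out)

/-- The parameter of the bit scheme and the hash key are sampled independently. Each of the two
reductions receives one of them and samples the other itself, so both present the adversary with the
correct joint distribution. -/
theorem oneTimeDeletionSecure (hF : F.CollisionResistant) (h : Sch.OneTimeDeletionSecure) :
    (F.hashThenSign Sch).OneTimeDeletionSecure := by
  intro A
  have h1 := (negligible_prob_iff _).mp (h (F.bitRevoker A))
  have h2 := (negligible_prob_iff _).mp (hF (collisionFinder Sch A))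
  refine (negligible_prob_iff _).mpr ((h1.add h2).mono fun n => ?_)
  rw [Scheme.revokeExp_apply_true, Scheme.revokeExp_apply_true, collisionExp_apply_true,
    expect_Setup]
  simp only [expect_bitRevoker, expect_collisionFinder]
  -- The collision finder samples the parameter after the hash key; exchanging the two aligns it
  -- with the other experiments.
  rw [expect_comm (F.gen.output (Data.unary n)), ← expect_add]
  refine expect_mono fun c _ => ?_
  rw [← expect_add]
  refine expect_mono fun s hs => ?_
  rw [← expect_add]
  exact expect_mono fun out _ => revokeVal_le hs c.1 c.2 out

theorem isOneTimeSecure (hF : F.CollisionResistant) (h : Sch.IsOneTimeSecure) :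
    (F.hashThenSign Sch).IsOneTimeSecure where
  correct := oneTimeCorrect h.correct
  -- Forgeries are excluded by deletion security of the new scheme itself, with `all bitTest`
  -- recognising the encodings of bit strings.
  unforgeable := (robustDeletion h.deletionCorrect).unforgeable
    (oneTimeDeletionSecure hF h.deletionSecure) (classical_all simple_bitTest)
    (polyTime_all simple_bitTest) value_all_bitTest
  deletionCorrect := (robustDeletion h.deletionCorrect).deletionCorrect
  deletionSecure := oneTimeDeletionSecure hF h.deletionSecure

end HashFamily

end DSR

end

theorem mainTheorem4
    (hHash : ∃ F : DSR.HashFamily, F.CollisionResistant)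
    (hBit : ∃ Sch : DSR.Scheme Bool, Sch.IsOneTimeSecure) :
    ∃ Sch : DSR.Scheme (List Bool), Sch.IsOneTimeSecure := by
  obtain ⟨F, hF⟩ := hHash
  obtain ⟨Sch, hSch⟩ := hBit
  exact ⟨F.hashThenSign Sch, DSR.HashFamily.isOneTimeSecure hF hSch⟩
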